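/- Let $H$ be a separable real Hilbert space, let $Q\in\mathcal L(H)$ be symmetric, strictly positive and of finite trace, with an orthonormal basis $(e_k)$ of eigenvectors $Qe_k=\lambda_ke_k$, and let $\mu=\mathcal N_{0,Q}$ be the Gaussian measure on $H$ with mean $0$ and covariance $Q$. Let $\mathcal E_0(H)$ be the linear span of the functions $x\mapsto\cos\langle x,h\rangle$ and $x\mapsto\sin\langle x,h\rangle$, $h\in H$. Let $W^{1,2}_0(H,\mu)$ be the domain of the closure in $L^2(H,\mu)$ of $Q^{1/2}D$ on $\mathcal E_0(H)$; let $W^{2,2}_0(H,\mu)$ be the completion of $\mathcal E_0(H)$ for the sum of the $L^2$ norms of $\varphi$, $|Q^{1/2}D\varphi|$ and the Hilbert–Schmidt norm of $Q^{1/2}D^2\varphi\,Q^{1/2}$; and let $W^{1,1}_0(H,\mu)$ be the domain of the closure in $L^1(H,\mu)$ of $Q^{1/2}D$ on the smooth cylindrical functions $x\mapsto u(\langle x,y_1\rangle,\dots,\langle x,y_n\rangle)$, $u\in C_b^\infty(\mathbb R^n)$. Let $L_0$ be the closure in $L^2(H,\mu)$ of $\mathcal L_0\varphi(x)=\tfrac12\mathrm{Tr}[QD^2\varphi(x)]-\tfrac12\langle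 x,D\varphi(x)\rangle$, $\varphi\in\mathcal E_0(H)$; one has $D(L_0)\subset W^{2,2}_0(H,\mu)$. Let $g\in D(L_0)$ be such that $|Q^{1/2}Dg|^{-1}\in L^4(H,\mu)$ (in particular $Q^{1/2}Dg\neq0$ $\mu$-a.e.), and set $$\psi:=\frac{L_0g}{|Q^{1/2}Dg|^2}-\frac{\langle Q^{1/2}D^2g\,Q^{1/2}\cdot Q^{1/2}Dg,\;Q^{1/2}Dg\rangle}{|Q^{1/2}Dg|^4}.$$ (a) If $\psi\in W^{1,2}_0(H,\mu)$, then the image measure $\mu\circ g^{-1}$ has a density $k$ with respect to Lebesgue measure, and $k\in W^{1,1}(\mathbb R)$. (b) Let $\rho\in W^{1,1}_0(H,\mu)$ satisfy $\psi\rho\in L^1(H,\mu)$ and $\dfrac{|Q^{1/2}D\rho|}{|Q^{1/2}Dg|}\in L^1(H,\mu)$, and set $$\rho_1:=2\psi\rho+\frac{\langle Q^{1/2}Dg,Q^{1/2}D\rho\rangle}{|Q^{1/2}Dg|^2}.$$ If $\rho_1\in W^{1,1}_0(H,\mu)$, $\psi\rho_1\in L^1(H,\mu)$ and $\dfrac{|Q^{1/2}D\rho_1|}{|Q^{1/2}Dg|}\in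 L^1(H,\mu)$, then the signed image measure $(\rho\mu)\circ g^{-1}$, $I\mapsto\int_{g^{-1}(I)}\rho\,d\mu$, has a density $k_\rho$ with respect to Lebesgue measure, and $k_\rho\in W^{1,1}(\mathbb R)$. -/

import Mathlib

open MeasureTheory ProbabilityTheory Filter Topology Gradient
open scoped ENNReal ContDiff RealInnerProductSpace

namespace GaussSobolev

/-- Spectral data of a symmetric, strictly positive operator `Q` with finite trace: an orthonormal
basis `e` of eigenvectors, `Q eₖ = λₖ eₖ` with `λₖ > 0` and `∑ₖ λₖ < ∞`. -/
structure CovEigenbasis {H : Type*} [NormedAddCommGroup H] [InnerProductSpace ℝ H]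
    (ι : Type*) (Q : H →L[ℝ] H) where
  /-- the orthonormal basis `(eₖ)` -/
  e : HilbertBasis ι ℝ H
  /-- the eigenvalues `(λₖ)` -/
  lam : ι → ℝ
  lam_pos : ∀ k, 0 < lam k
  summable_lam : Summable lam
  apply_e : ∀ k, Q (e k) = lam k • e k

variable {H : Type*} [NormedAddCommGroup H] [InnerProductSpace ℝ H]
  {ι : Type*} {Q : H →L[ℝ] H}

theorem CovEigenbasis.sqrt_lam_le (S : CovEigenbasis ι Q) (k : ι) :
    √(S.lam k) ≤ √(∑' j, S.lam j) :=
  Real.sqrt_le_sqrt (S.summable_lam.le_tsum k fun j _ => (S.lam_pos j).le)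

theorem CovEigenbasis.memℓp_sqrt_mul (S : CovEigenbasis ι Q) (x : H) :
    Memℓp (fun k => √(S.lam k) * S.e.repr x k) 2 := by
  refine ((lp.memℓp (S.e.repr x)).norm.const_mul (√(∑' j, S.lam j))).mono fun k => ?_
  rw [norm_mul, Real.norm_of_nonneg (Real.sqrt_nonneg _)]
  exact mul_le_mul_of_nonneg_right (S.sqrt_lam_le k) (norm_nonneg _)

/-- The operator `Q^{1/2}`, i.e. `Q^{1/2} x = ∑ₖ √λₖ ⟨x, eₖ⟩ eₖ`. -/
noncomputable def CovEigenbasis.sqrtQ (S : CovEigenbasis ι Q) : H →L[ℝ] H :=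
  LinearMap.mkContinuous
    { toFun := fun x => S.e.repr.symm ⟨fun k => √(S.lam k) * S.e.repr x k, S.memℓp_sqrt_mul x⟩
      map_add' := fun x y => by
        rw [← map_add]
        congr 1
        ext k
        simp only [map_add, lp.coeFn_add, Pi.add_apply, mul_add]
      map_smul' := fun c x => by
        rw [RingHom.id_apply, ← map_smul]
        congr 1
        ext k
        simp [mul_left_comm] }
    (√(∑' j, S.lam j))
    (fun x => by
      have h : ‖(⟨fun k => √(S.lam k) * S.e.repr x k, S.memℓp_sqrt_mul x⟩ :
          lp (fun _ : ι => ℝ) 2)‖ ≤ ‖(√(∑' j, S.lam j)) • S.e.repr x‖ := by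
        refine lp.norm_mono (by norm_num) fun k => ?_
        simp only [lp.coeFn_smul, Pi.smul_apply, smul_eq_mul, norm_mul]
        rw [Real.norm_of_nonneg (Real.sqrt_nonneg _), Real.norm_of_nonneg (Real.sqrt_nonneg _)]
        exact mul_le_mul_of_nonneg_right (S.sqrt_lam_le k) (norm_nonneg _)
      simpa [norm_smul, abs_of_nonneg (Real.sqrt_nonneg _)] using h)

theorem CovEigenbasis.repr_sqrtQ (S : CovEigenbasis ι Q) (x : H) (k : ι) :
    S.e.repr (S.sqrtQ x) k = √(S.lam k) * S.e.repr x k := by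
  simp [CovEigenbasis.sqrtQ]

theorem CovEigenbasis.sqrtQ_apply_e (S : CovEigenbasis ι Q) (k : ι) :
    S.sqrtQ (S.e k) = √(S.lam k) • S.e k := by
  classical
  apply S.e.repr.injective
  ext j
  rw [S.repr_sqrtQ, map_smul, lp.coeFn_smul, Pi.smul_apply, smul_eq_mul, S.e.repr_self]
  by_cases h : j = k
  · subst h; rfl
  · simp [lp.single_apply, h]

/-! ### Classes of smooth functions -/

/-- `𝓔₀(H)`: the linear span of the real and imaginary parts of `x ↦ exp (i ⟨x, h⟩)`, `h ∈ H`. -/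
noncomputable def expFunctions (H : Type*) [NormedAddCommGroup H] [InnerProductSpace ℝ H] :
    Submodule ℝ (H → ℝ) :=
  Submodule.span ℝ (Set.range (fun (h : H) (x : H) => Real.cos ⟪x, h⟫) ∪
    Set.range (fun (h : H) (x : H) => Real.sin ⟪x, h⟫))

/-- Smooth cylindrical functions: `f x = u (⟨x, y₁⟩, …, ⟨x, yₙ⟩)` with `u ∈ C_b^∞(ℝⁿ)`
(`u` is bounded together with its derivatives of every order). -/
def cylFunctions (H : Type*) [NormedAddCommGroup H] [InnerProductSpace ℝ H] : Set (H → ℝ) :=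
  {f | ∃ (n : ℕ) (y : Fin n → H) (u : (Fin n → ℝ) → ℝ), ContDiff ℝ ∞ u ∧
    (∀ j : ℕ, ∃ C : ℝ, ∀ z, ‖iteratedFDeriv ℝ j u z‖ ≤ C) ∧
    f = fun x => u (fun i => ⟪x, y i⟫)}

/-! ### Differential operators on smooth functions -/

variable [CompleteSpace H]

/-- `Q^{1/2} D φ (x)`. -/
noncomputable def CovEigenbasis.grad (S : CovEigenbasis ι Q) (φ : H → ℝ) (x : H) : H :=
  S.sqrtQ (∇ φ x)

/-- `Q^{1/2} D²φ(x) Q^{1/2}`. -/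
noncomputable def CovEigenbasis.hess (S : CovEigenbasis ι Q) (φ : H → ℝ) (x : H) : H →L[ℝ] H :=
  S.sqrtQ ∘L (fderiv ℝ (fun z => ∇ φ z) x) ∘L S.sqrtQ

/-- `𝓛₀ φ (x) = ½ Tr [Q D²φ(x)] - ½ ⟨x, Dφ(x)⟩`. -/
noncomputable def CovEigenbasis.ouOp (S : CovEigenbasis ι Q) (φ : H → ℝ) (x : H) : ℝ :=
  (1 / 2) * ∑' k, ⟪Q (fderiv ℝ (fun z => ∇ φ z) x (S.e k)), S.e k⟫ - (1 / 2) * ⟪x, ∇ φ x⟫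

/-! ### Closures in `L^p(H, μ)` -/

variable [MeasurableSpace H]

/-- `f` belongs to the domain of the closure in `L^p(H, μ)` of `Q^{1/2} D`, defined initially on
the class `𝓒`, and the closure maps `f` to `F`. -/
def CovEigenbasis.IsSobolevGrad (S : CovEigenbasis ι Q) (μ : Measure H) (𝓒 : Set (H → ℝ))
    (p : ℝ≥0∞) (f : H → ℝ) (F : H → H) : Prop :=
  MemLp f p μ ∧ MemLp F p μ ∧ ∃ φ : ℕ → H → ℝ, (∀ n, φ n ∈ 𝓒) ∧
    Tendsto (fun n => eLpNorm (fun x => φ n x - f x) p μ) atTop (𝓝 0) ∧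
    Tendsto (fun n => eLpNorm (fun x => S.grad (φ n) x - F x) p μ) atTop (𝓝 0)

/-- `f ∈ W^{1,2}_0(H, μ)`. -/
def CovEigenbasis.MemW12 (S : CovEigenbasis ι Q) (μ : Measure H) (f : H → ℝ) : Prop :=
  ∃ F, S.IsSobolevGrad μ (expFunctions H) 2 f F

/-- `f ∈ W^{1,1}_0(H, μ)`. -/
def CovEigenbasis.MemW11 (S : CovEigenbasis ι Q) (μ : Measure H) (f : H → ℝ) : Prop :=
  ∃ F, S.IsSobolevGrad μ (cylFunctions H) 1 f F

open Classical in
/-- `Q^{1/2} D f` for `f ∈ W^{1,2}_0(H, μ)` (and `0` for other `f`). -/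
noncomputable def CovEigenbasis.grad12 (S : CovEigenbasis ι Q) (μ : Measure H) (f : H → ℝ) :
    H → H :=
  if h : S.MemW12 μ f then h.choose else 0

open Classical in
/-- `Q^{1/2} D f` for `f ∈ W^{1,1}_0(H, μ)` (and `0` for other `f`). -/
noncomputable def CovEigenbasis.grad11 (S : CovEigenbasis ι Q) (μ : Measure H) (f : H → ℝ) :
    H → H :=
  if h : S.MemW11 μ f then h.choose else 0

/-- `f ∈ W^{2,2}_0(H, μ)` with `Q^{1/2} D² f Q^{1/2} = T`: functions of `𝓔₀(H)` converge to `f`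
together with their first derivatives in `L²(H, μ)`, and with their second derivatives in
`L²(H, μ)` with respect to the Hilbert–Schmidt norm. -/
def CovEigenbasis.IsSobolevHess (S : CovEigenbasis ι Q) (μ : Measure H)
    (f : H → ℝ) (T : H → H →L[ℝ] H) : Prop :=
  MemLp f 2 μ ∧ AEStronglyMeasurable T μ ∧ ∃ F : H → H, MemLp F 2 μ ∧
    ∃ φ : ℕ → H → ℝ, (∀ n, φ n ∈ expFunctions H) ∧
      Tendsto (fun n => eLpNorm (fun x => φ n x - f x) 2 μ) atTop (𝓝 0) ∧
      Tendsto (fun n => eLpNorm (fun x => S.grad (φ n) x - F x) 2 μ) atTop (𝓝 0) ∧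
      Tendsto (fun n => ∫⁻ x, ∑' k, ‖(S.hess (φ n) x - T x) (S.e k)‖ₑ ^ 2 ∂μ) atTop (𝓝 0)

open Classical in
/-- `Q^{1/2} D² f Q^{1/2}` for `f ∈ W^{2,2}_0(H, μ)` (and `0` for other `f`). -/
noncomputable def CovEigenbasis.hess22 (S : CovEigenbasis ι Q) (μ : Measure H) (f : H → ℝ) :
    H → H →L[ℝ] H :=
  if h : ∃ T, S.IsSobolevHess μ f T then h.choose else 0

/-- `f ∈ D(L₀)` and `L₀ f = l`, where `L₀` is the closure in `L²(H, μ)` of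
`𝓛₀ : 𝓔₀(H) → L²(H, μ)`. -/
def CovEigenbasis.IsL0 (S : CovEigenbasis ι Q) (μ : Measure H) (f l : H → ℝ) : Prop :=
  MemLp f 2 μ ∧ MemLp l 2 μ ∧ ∃ φ : ℕ → H → ℝ, (∀ n, φ n ∈ expFunctions H) ∧
    Tendsto (fun n => eLpNorm (fun x => φ n x - f x) 2 μ) atTop (𝓝 0) ∧
    Tendsto (fun n => eLpNorm (fun x => S.ouOp (φ n) x - l x) 2 μ) atTop (𝓝 0)

/-- `f ∈ D(L₀)`. -/
def CovEigenbasis.MemDomL0 (S : CovEigenbasis ι Q) (μ : Measure H) (f : H → ℝ) : Prop :=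
  ∃ l, S.IsL0 μ f l

open Classical in
/-- `L₀ f` for `f ∈ D(L₀)` (and `0` for other `f`). -/
noncomputable def CovEigenbasis.L0 (S : CovEigenbasis ι Q) (μ : Measure H) (f : H → ℝ) : H → ℝ :=
  if h : S.MemDomL0 μ f then h.choose else 0

/-- `ψ = L₀ g / |Q^{1/2}Dg|² - ⟨Q^{1/2}D²g Q^{1/2} · Q^{1/2}Dg, Q^{1/2}Dg⟩ / |Q^{1/2}Dg|⁴`. -/
noncomputable def CovEigenbasis.psi (S : CovEigenbasis ι Q) (μ : Measure H) (g : H → ℝ) (x : H) :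
    ℝ :=
  S.L0 μ g x / ‖S.grad12 μ g x‖ ^ 2
    - ⟪S.hess22 μ g x (S.grad12 μ g x), S.grad12 μ g x⟫ / ‖S.grad12 μ g x‖ ^ 4

/-- `ρ₁ = 2 ψ ρ + ⟨Q^{1/2}Dg, Q^{1/2}Dρ⟩ / |Q^{1/2}Dg|²`. -/
noncomputable def CovEigenbasis.rhoOne (S : CovEigenbasis ι Q) (μ : Measure H) (g ρ : H → ℝ)
    (x : H) : ℝ :=
  2 * S.psi μ g x * ρ x + ⟪S.grad12 μ g x, S.grad11 μ ρ x⟫ / ‖S.grad12 μ g x‖ ^ 2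

/-- The integrability condition `ψ ρ ∈ L¹(H, μ)`, `|Q^{1/2}Dρ| / |Q^{1/2}Dg| ∈ L¹(H, μ)`. -/
def CovEigenbasis.RhoCondition (S : CovEigenbasis ι Q) (μ : Measure H) (g ρ : H → ℝ) : Prop :=
  Integrable (fun x => S.psi μ g x * ρ x) μ ∧
    Integrable (fun x => ‖S.grad11 μ ρ x‖ / ‖S.grad12 μ g x‖) μ

/-! ### Functions on the real line -/

/-- `k ∈ L¹(ℝ)` is a density with respect to Lebesgue measure of the finite signed measure on `ℝ`
given by the set function `ν`. -/
def IsDensity (ν : Set ℝ → ℝ) (k : ℝ → ℝ) : Prop :=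
  Integrable k ∧ ∀ I : Set ℝ, MeasurableSet I → ν I = ∫ r in I, k r

/-- `k ∈ W^{1,1}(ℝ)`: `k ∈ L¹(ℝ)` has a weak derivative in `L¹(ℝ)`. -/
def MemW11Real (k : ℝ → ℝ) : Prop :=
  Integrable k ∧ ∃ k' : ℝ → ℝ, Integrable k' ∧
    ∀ η : ℝ → ℝ, ContDiff ℝ ∞ η → HasCompactSupport η →
      ∫ r, k r * deriv η r = - ∫ r, k' r * η r

end GaussSobolev

/-! ### Gaussian integration by parts on the line and on `H`. -/

namespace GaussSobolev

/-! Write `G = Q^{1/2}Dg`. Along the field `G/|G|²` the function `η ∘ g` has derivative `η'(g)`, and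
the Gaussian divergence of this field is `2ψ`. Hence, for `η` bounded with bounded derivative, `∫
η'(g) ρ dμ = -∫ η(g) ρ₁ dμ` with `ρ₁ = 2ψρ + ⟨G, Q^{1/2}Dρ⟩/|G|²` (`integral_deriv_comp_mul`). If
`η` is the primitive of a test function `θ`, Fubini turns the right side into `∫ θ k` with `k(t) =
-∫_{g ≥ t} ρ₁ dμ`, so the image of `ρμ` has density `k`. The same argument applied to `ρ₁` gives a
density `k₁` of the image of `ρ₁μ`, and the identity itself then says that `k' = k₁` weakly. Part
(a) is the case `ρ = 1`, `ρ₁ = 2ψ`.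

The work is in justifying the divergence formula for Sobolev data. For `φ ∈ 𝓔₀(H)` one has `∫ f ·
2𝓛₀φ dμ = -∫ ⟨Q^{1/2}Df, Q^{1/2}Dφ⟩ dμ`, a consequence of Stein's identity in the directions `Q h`.
It is applied to `f = η(φ) χ(r) / (|Q^{1/2}Dφ|² + ε)`, where `r` is bounded and `C¹`, `ε > 0`
removes the zeros of the gradient and `χ` is a truncation. Three limits follow.

In the first, `φ` tends to `g` and `r` to `ρ`. This needs one sequence that converges together with
its gradients, Hessians and images under `𝓛₀`. The energy identity `‖2𝓛₀φ‖² = ‖Q^{1/2}D²φ Q^{1/2}‖²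
+ ‖Q^{1/2}Dφ‖²` (`hasSum_integral_ouOp_sq`) shows that convergence in the graph of `𝓛₀` forces the
other two, and closability identifies the limits with the chosen derivatives of `g`
(`exists_approx_sequence`).

In the second, `ε` tends to `0`. Here `|G|⁻² ∈ L²` pairs with the Hessian and with `L₀g`, both in
`L²`. Since `ρ` is only in `L¹`, this is possible only while `χ(ρ)` is bounded.

In the third, the truncation is removed. By then the two second-order terms have merged into `ψ`, so
that integrability of `ψρ` and of `|Q^{1/2}Dρ|/|G|` suffices. -/

/-- Stein's identity for a centred Gaussian measure on the line. -/
theorem integral_deriv_gaussianReal {v : NNReal} (hv : v ≠ 0) {u u' : ℝ → ℝ}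
    (hu : ∀ t, HasDerivAt u (u' t) t) (h0 : Integrable u (gaussianReal 0 v))
    (h1 : Integrable u' (gaussianReal 0 v)) (h2 : Integrable (fun t => u t * t) (gaussianReal 0 v)) :
    v * ∫ t, u' t ∂(gaussianReal 0 v) = ∫ t, u t * t ∂(gaussianReal 0 v) := by
  have hv' : (v : ℝ) ≠ 0 := by exact_mod_cast hv
  have key : ∀ f : ℝ → ℝ, Integrable f (gaussianReal 0 v) →
      Integrable fun t => gaussianPDFReal 0 v t * f t := by
    intro f hf
    rw [gaussianReal_of_var_ne_zero _ hv, integrable_withDensity_iff_integrable_smul'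
      (measurable_gaussianPDF 0 v) (ae_of_all _ fun _ => gaussianPDF_lt_top)] at hf
    simpa [toReal_gaussianPDF] using hf
  have hd : ∀ t, HasDerivAt (gaussianPDFReal 0 v) (-(t / v) * gaussianPDFReal 0 v t) t := by
    intro t
    have h : HasDerivAt (fun x : ℝ => -(x - 0) ^ 2 / (2 * v)) (-(2 * t) / (2 * v)) t := by
      simpa using ((((hasDerivAt_id t).sub_const 0).pow 2).neg).div_const (2 * (v : ℝ))
    have h' := (h.exp).const_mul (√(2 * Real.pi * v))⁻¹
    rw [gaussianPDFReal_def]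
    refine h'.congr_deriv ?_
    field_simp
  -- The Gaussian density `p` satisfies `p' = -(t/v) p`, so integrating by parts against it produces
  -- the factor `t/v`; integrability of the three products replaces boundary terms.
  have h := integral_mul_deriv_eq_deriv_mul_of_integrable (u := u) (u' := u')
    (v := gaussianPDFReal 0 v) (v' := fun t => -(t / v) * gaussianPDFReal 0 v t)
    (fun t _ => hu t) (fun t _ => hd t)
    (by
      refine ((key _ h2).const_mul (-(v : ℝ)⁻¹)).congr (ae_of_all _ fun t => ?_)
      simp only [Pi.mul_apply]
      ring)
    (by
      refine (key _ h1).congr (ae_of_all _ fun t => ?_)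
      simp only [Pi.mul_apply]
      ring)
    (by
      refine (key _ h0).congr (ae_of_all _ fun t => ?_)
      simp only [Pi.mul_apply]
      ring)
  rw [integral_gaussianReal_eq_integral_smul hv, integral_gaussianReal_eq_integral_smul hv]
  simp only [smul_eq_mul]
  have e1 : ∫ t, gaussianPDFReal 0 v t * u' t = ∫ t, u' t * gaussianPDFReal 0 v t := by
    simp_rw [mul_comm]
  have e2 : ∫ t, gaussianPDFReal 0 v t * (u t * t)
      = -(v * ∫ t, u t * (-(t / v) * gaussianPDFReal 0 v t)) := by
    rw [← integral_const_mul, ← integral_neg]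
    refine integral_congr_ae (ae_of_all _ fun t => ?_)
    simp only
    field_simp
  rw [e1, e2, h]
  ring

namespace CovEigenbasis

variable {H : Type*} [NormedAddCommGroup H] [InnerProductSpace ℝ H]
  {ι : Type*} {Q : H →L[ℝ] H}

/-- `CovEigenbasis` prescribes `Q` on basis vectors only; continuity carries the diagonal form over
to the expansion of an arbitrary vector. Symmetry and positivity of `Q` are then read off from the
coordinates. -/
theorem repr_apply_Q (S : CovEigenbasis ι Q) (x : H) (k : ι) :
    S.e.repr (Q x) k = S.lam k * S.e.repr x k := by
  classical
  have h1 := (S.e.hasSum_repr x).mapL (innerSL ℝ (S.e k) ∘L Q)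
  have h2 : HasSum (fun i => (innerSL ℝ (S.e k) ∘L Q) (S.e.repr x i • S.e i))
      (S.lam k * S.e.repr x k) := by
    convert! hasSum_ite_eq k (S.lam k * S.e.repr x k) using 1
    ext i
    simp only [map_smul, ContinuousLinearMap.comp_apply, S.apply_e, innerSL_apply_apply,
      smul_eq_mul, orthonormal_iff_ite.mp S.e.orthonormal]
    by_cases h : k = i
    · subst h; simp [mul_comm]
    · simp [h, Ne.symm h]
  have h3 := h1.unique h2
  rw [S.e.repr_apply_apply]
  simpa using h3

theorem sqrtQ_sqrtQ (S : CovEigenbasis ι Q) (x : H) : S.sqrtQ (S.sqrtQ x) = Q x := by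
  apply S.e.repr.injective
  ext k
  rw [S.repr_sqrtQ, S.repr_sqrtQ, S.repr_apply_Q, ← mul_assoc,
    Real.mul_self_sqrt (S.lam_pos k).le]

theorem inner_sqrtQ_left (S : CovEigenbasis ι Q) (x y : H) :
    ⟪S.sqrtQ x, y⟫ = ⟪x, S.sqrtQ y⟫ := by
  rw [← S.e.tsum_inner_mul_inner, ← S.e.tsum_inner_mul_inner x]
  refine tsum_congr fun k => ?_
  have h : ∀ z, ⟪S.e k, S.sqrtQ z⟫ = √(S.lam k) * ⟪S.e k, z⟫ := fun z => by
    rw [← S.e.repr_apply_apply, ← S.e.repr_apply_apply, S.repr_sqrtQ]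
  rw [h, real_inner_comm, h, real_inner_comm]
  ring

theorem inner_sqrtQ_sqrtQ (S : CovEigenbasis ι Q) (x y : H) :
    ⟪S.sqrtQ x, S.sqrtQ y⟫ = ⟪Q x, y⟫ := by
  rw [← S.inner_sqrtQ_left, S.sqrtQ_sqrtQ]

theorem inner_Q_left (S : CovEigenbasis ι Q) (x y : H) : ⟪Q x, y⟫ = ⟪x, Q y⟫ := by
  rw [← S.inner_sqrtQ_sqrtQ, S.inner_sqrtQ_left, S.sqrtQ_sqrtQ]

theorem inner_Q_self_pos (S : CovEigenbasis ι Q) {x : H} (hx : x ≠ 0) : 0 < ⟪Q x, x⟫ := by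
  rw [← S.inner_sqrtQ_sqrtQ]
  refine real_inner_self_pos.2 fun h => hx ?_
  apply S.e.repr.injective
  ext k
  have h2 := S.repr_sqrtQ x k
  rw [h] at h2
  have h3 : √(S.lam k) ≠ 0 := (Real.sqrt_pos.2 (S.lam_pos k)).ne'
  simpa [h3, eq_comm] using h2

/-- A summable family has countable support, and here every term is positive. Countability is what
permits exchanging sums with integrals and combining coordinatewise a.e. statements. -/
theorem countable_index (S : CovEigenbasis ι Q) : Countable ι := by
  have h := S.summable_lam.countable_support
  have h2 : Function.support S.lam = Set.univ := by
    ext k; simp [(S.lam_pos k).ne']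
  rw [h2] at h
  exact Set.countable_univ_iff.1 h

/-- The terms are at most `λₖ ‖T‖`. Thus the trace in `ouOp` is a convergent series, which makes
`ouOp` additive despite the default value `0` of `tsum`. -/
theorem summable_inner_Q (S : CovEigenbasis ι Q) (T : H →L[ℝ] H) :
    Summable fun k => ⟪Q (T (S.e k)), S.e k⟫ := by
  refine Summable.of_norm_bounded (S.summable_lam.mul_right ‖T‖) fun k => ?_
  rw [S.inner_Q_left, S.apply_e, inner_smul_right, norm_mul,
    Real.norm_of_nonneg (S.lam_pos k).le]
  refine mul_le_mul_of_nonneg_left ?_ (S.lam_pos k).le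
  refine (norm_inner_le_norm _ _).trans ?_
  simpa [S.e.orthonormal.1 k] using T.le_opNorm (S.e k)

variable [CompleteSpace H] [SecondCountableTopology H] [MeasurableSpace H] [BorelSpace H]

theorem charFun_eq {μ : Measure H} [IsGaussian μ] (hmean : ∫ x, x ∂μ = 0)
    (hcov : ∀ x y : H, covarianceBilin μ x y = ⟪Q x, y⟫) (t : H) :
    charFun μ t = Complex.exp (-((⟪Q t, t⟫ : ℝ) : ℂ) / 2) := by
  rw [IsGaussian.charFun_eq', hcov]
  simp [hmean, neg_div]

/-- A centred Gaussian vector is the sum of its component along `Q h` and of an independent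
remainder. -/
theorem map_prod_gaussianReal_eq (S : CovEigenbasis ι Q) {μ : Measure H} [IsGaussian μ]
    (hmean : ∫ x, x ∂μ = 0) (hcov : ∀ x y : H, covarianceBilin μ x y = ⟪Q x, y⟫)
    {h : H} (hh : h ≠ 0) :
    (μ.prod (gaussianReal 0 ⟪Q h, h⟫.toNNReal)).map
      (fun p : H × ℝ => (p.1 - (⟪p.1, h⟫ / ⟪Q h, h⟫) • Q h) + (p.2 / ⟪Q h, h⟫) • Q h) = μ := by
  have hpos := S.inner_Q_self_pos hh
  set c := ⟪Q h, h⟫ with hc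
  have hmeas : Measurable (fun p : H × ℝ => (p.1 - (⟪p.1, h⟫ / c) • Q h) + (p.2 / c) • Q h) := by
    apply Continuous.measurable
    fun_prop
  have hprob : IsProbabilityMeasure ((μ.prod (gaussianReal 0 c.toNNReal)).map
      (fun p : H × ℝ => (p.1 - (⟪p.1, h⟫ / c) • Q h) + (p.2 / c) • Q h)) :=
    Measure.isProbabilityMeasure_map hmeas.aemeasurable
  refine Measure.ext_of_charFun ?_
  ext y
  rw [charFun_apply, integral_map hmeas.aemeasurable (by fun_prop)]
  -- The exponent is a function of `x` plus a function of `t`, so the characteristic function of the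
  -- image factorises.
  have h1 : ∀ p : H × ℝ, Complex.exp
      ((⟪(p.1 - (⟪p.1, h⟫ / c) • Q h) + (p.2 / c) • Q h, y⟫ : ℝ) * Complex.I)
      = Complex.exp ((⟪p.1, y - (⟪Q h, y⟫ / c) • h⟫ : ℝ) * Complex.I) *
        Complex.exp ((⟪p.2, ⟪Q h, y⟫ / c⟫ : ℝ) * Complex.I) := by
    intro p
    rw [← Complex.exp_add, ← add_mul, ← Complex.ofReal_add]
    congr 3
    simp only [inner_add_left, inner_sub_left, inner_sub_right, inner_smul_left, inner_smul_right,
      RCLike.inner_apply, conj_trivial]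
    ring
  simp_rw [h1]
  rw [integral_prod_mul (fun x : H => Complex.exp ((⟪x, y - (⟪Q h, y⟫ / c) • h⟫ : ℝ) * Complex.I))
    (fun t : ℝ => Complex.exp ((⟪t, ⟪Q h, y⟫ / c⟫ : ℝ) * Complex.I)),
    ← charFun_apply, ← charFun_apply, charFun_gaussianReal, charFun_eq hmean hcov,
    charFun_eq hmean hcov, ← Complex.exp_add]
  congr 1
  -- Removing the component along `Q h` lowers the variance by `⟪Q h, y⟫² / c`, exactly what the
  -- independent variable of variance `c` restores.
  have h2 : ⟪Q (y - (⟪Q h, y⟫ / c) • h), y - (⟪Q h, y⟫ / c) • h⟫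
      = ⟪Q y, y⟫ - ⟪Q h, y⟫ ^ 2 / c := by
    have h3 : ⟪Q y, h⟫ = ⟪Q h, y⟫ := by rw [S.inner_Q_left, real_inner_comm]
    simp only [map_sub, map_smul, inner_sub_left, inner_sub_right, inner_smul_left,
      inner_smul_right, conj_trivial, h3, ← hc]
    field_simp
    ring
  rw [h2]
  simp only [Real.coe_toNNReal _ hpos.le]
  have hc' : (c : ℂ) ≠ 0 := by exact_mod_cast hpos.ne'
  push_cast
  field_simp
  ring

/-- Gaussian integration by parts. -/
theorem integral_fderiv_apply_Q (S : CovEigenbasis ι Q) {μ : Measure H} [IsGaussian μ]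
    (hmean : ∫ x, x ∂μ = 0) (hcov : ∀ x y : H, covarianceBilin μ x y = ⟪Q x, y⟫) (h : H)
    {f : H → ℝ} (hf : Differentiable ℝ f) (h0 : Integrable f μ)
    (h1 : Integrable (fun x => fderiv ℝ f x (Q h)) μ)
    (h2 : Integrable (fun x => f x * ⟪x, h⟫) μ) :
    ∫ x, fderiv ℝ f x (Q h) ∂μ = ∫ x, f x * ⟪x, h⟫ ∂μ := by
  rcases eq_or_ne h 0 with rfl | hh
  · simp
  have hpos := S.inner_Q_self_pos hh
  have hmap := S.map_prod_gaussianReal_eq hmean hcov hh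
  set c := ⟪Q h, h⟫ with hc
  set γ := gaussianReal 0 c.toNNReal with hγ
  set A : H × ℝ → H := fun p => (p.1 - (⟪p.1, h⟫ / c) • Q h) + (p.2 / c) • Q h with hA
  have hmeas : Measurable A := by
    apply Continuous.measurable
    simp only [hA]
    fun_prop
  -- Integrals against `μ` become iterated integrals, the inner one along a line of direction `Q h`
  -- with Gaussian weight.
  have hcomp : ∀ F : H → ℝ, Integrable F μ → Integrable (fun p => F (A p)) (μ.prod γ) ∧
      ∫ x, F x ∂μ = ∫ x, ∫ t, F (A (x, t)) ∂γ ∂μ := by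
    intro F hF
    have hF' : Integrable F ((μ.prod γ).map A) := by rwa [hmap]
    have hi : Integrable (fun p => F (A p)) (μ.prod γ) := hF'.comp_measurable hmeas
    refine ⟨hi, ?_⟩
    rw [← integral_prod _ hi]
    conv_lhs => rw [← hmap]
    exact integral_map hmeas.aemeasurable hF'.aestronglyMeasurable
  obtain ⟨i0, -⟩ := hcomp _ h0
  obtain ⟨i1, e1⟩ := hcomp _ h1
  obtain ⟨i2, e2⟩ := hcomp _ h2
  rw [e1, e2]
  refine integral_congr_ae ?_
  filter_upwards [i0.prod_right_ae, i1.prod_right_ae, i2.prod_right_ae] with x j0 j1 j2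
  -- The coordinate along `h` of the resampled point is `t` itself, so on each line the claim is
  -- Stein's identity in `t`.
  have hin : ∀ t, ⟪A (x, t), h⟫ = t := by
    intro t
    simp only [hA, inner_add_left, inner_sub_left, inner_smul_left, conj_trivial, ← hc]
    field_simp
    ring
  simp only [hin] at j2 ⊢
  have hder : ∀ t, HasDerivAt (fun t => f (A (x, t))) (fderiv ℝ f (A (x, t)) (Q h) * c⁻¹) t := by
    intro t
    have ha : HasDerivAt (fun t => A (x, t)) (c⁻¹ • Q h) t := by
      simp only [hA]
      refine HasDerivAt.const_add _ ?_
      have := ((hasDerivAt_id t).div_const c).smul_const (Q h)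
      simpa using this
    have := (hf (A (x, t))).hasFDerivAt.comp_hasDerivAt t ha
    refine this.congr_deriv ?_
    simp [mul_comm]
  have hv : c.toNNReal ≠ 0 := by simpa using hpos
  -- The chain rule contributes `c⁻¹`, which cancels the variance `c` in Stein's identity.
  have := integral_deriv_gaussianReal hv hder j0 (j1.mul_const _) j2
  rw [integral_mul_const, Real.coe_toNNReal _ hpos.le] at this
  rw [← this, ← hγ]
  field_simp

end CovEigenbasis

end GaussSobolev

/-! ### Growth classes, gradients, and the Ornstein–Uhlenbeck operator on ridge functions. -/

namespace GaussSobolev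

variable {H : Type*} [NormedAddCommGroup H] [InnerProductSpace ℝ H]

/-- `f` is continuously differentiable and grows, as its derivative does, at most linearly. -/
def IsLinGrowthC1 (f : H → ℝ) : Prop :=
  ContDiff ℝ 1 f ∧ ∃ C, ∀ x, |f x| ≤ C * (1 + ‖x‖) ∧ ‖fderiv ℝ f x‖ ≤ C * (1 + ‖x‖)

/-- `f` is continuously differentiable and bounded together with its derivative. -/
def IsBddC1 (f : H → ℝ) : Prop :=
  ContDiff ℝ 1 f ∧ ∃ C, ∀ x, |f x| ≤ C ∧ ‖fderiv ℝ f x‖ ≤ C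

theorem IsBddC1.isLinGrowthC1 {f : H → ℝ} (hf : IsBddC1 f) : IsLinGrowthC1 f := by
  obtain ⟨h, C, hC⟩ := hf
  refine ⟨h, C, fun x => ?_⟩
  have hC0 : 0 ≤ C := (abs_nonneg _).trans (hC x).1
  have : C ≤ C * (1 + ‖x‖) := le_mul_of_one_le_right hC0 (by linarith [norm_nonneg x])
  exact ⟨(hC x).1.trans this, (hC x).2.trans this⟩

theorem IsLinGrowthC1.add {f g : H → ℝ} (hf : IsLinGrowthC1 f) (hg : IsLinGrowthC1 g) :
    IsLinGrowthC1 (f + g) := by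
  obtain ⟨h, C, hC⟩ := hf
  obtain ⟨h', C', hC'⟩ := hg
  refine ⟨h.add h', C + C', fun x => ⟨?_, ?_⟩⟩
  · rw [add_mul]
    exact (abs_add_le _ _).trans (add_le_add (hC x).1 (hC' x).1)
  · rw [add_mul, fderiv_add (h.differentiable one_ne_zero x) (h'.differentiable one_ne_zero x)]
    exact (norm_add_le _ _).trans (add_le_add (hC x).2 (hC' x).2)

theorem IsLinGrowthC1.smul {f : H → ℝ} (hf : IsLinGrowthC1 f) (c : ℝ) :
    IsLinGrowthC1 (c • f) := by
  obtain ⟨h, C, hC⟩ := hf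
  refine ⟨h.const_smul c, |c| * C, fun x => ⟨?_, ?_⟩⟩
  · rw [mul_assoc, Pi.smul_apply, smul_eq_mul, abs_mul]
    exact mul_le_mul_of_nonneg_left (hC x).1 (abs_nonneg _)
  · rw [mul_assoc, fderiv_const_smul (h.differentiable one_ne_zero x), norm_smul,
      Real.norm_eq_abs]
    exact mul_le_mul_of_nonneg_left (hC x).2 (abs_nonneg _)

section Growth

variable [CompleteSpace H] [SecondCountableTopology H] [MeasurableSpace H] [BorelSpace H]

/-- A Gaussian measure has finite second moment. Quadratic growth is all that has to be integrated,
as the integrands below are dominated by products of two functions of linear growth. -/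
theorem integrable_one_add_norm_sq (μ : Measure H) [IsGaussian μ] :
    Integrable (fun x => (1 + ‖x‖) ^ 2) μ := by
  have h := (memLp_const (1 : ℝ) (p := 2) (μ := μ)).add (IsGaussian.memLp_two_id (μ := μ)).norm
  exact h.integrable_sq

theorem integrable_of_quadratic_growth (μ : Measure H) [IsGaussian μ] {f : H → ℝ}
    (hf : Continuous f) {C : ℝ} (hC : ∀ x, |f x| ≤ C * (1 + ‖x‖) ^ 2) : Integrable f μ :=
  ((integrable_one_add_norm_sq μ).const_mul C).mono' hf.aestronglyMeasurable (ae_of_all _ hC)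

theorem integrable_of_linear_growth (μ : Measure H) [IsGaussian μ] {f : H → ℝ}
    (hf : Continuous f) {C : ℝ} (hC : ∀ x, |f x| ≤ C * (1 + ‖x‖)) : Integrable f μ := by
  have hC0 : 0 ≤ C := by simpa using (abs_nonneg _).trans (hC 0)
  refine integrable_of_quadratic_growth μ hf (C := C) fun x => (hC x).trans ?_
  have := norm_nonneg x
  gcongr
  nlinarith

theorem integrable_mul_of_linear_growth (μ : Measure H) [IsGaussian μ] {f g : H → ℝ}
    (hf : Continuous f) (hg : Continuous g) {C D : ℝ} (hC : ∀ x, |f x| ≤ C * (1 + ‖x‖))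
    (hD : ∀ x, |g x| ≤ D * (1 + ‖x‖)) : Integrable (fun x => f x * g x) μ := by
  refine integrable_of_quadratic_growth μ (hf.mul hg) (C := C * D) fun x => ?_
  rw [abs_mul]
  calc |f x| * |g x| ≤ (C * (1 + ‖x‖)) * (D * (1 + ‖x‖)) :=
        mul_le_mul (hC x) (hD x) (abs_nonneg _) ((abs_nonneg _).trans (hC x))
    _ = _ := by ring

end Growth

section Gradient

variable [CompleteSpace H]

theorem gradient_add {f g : H → ℝ} {x : H} (hf : DifferentiableAt ℝ f x)
    (hg : DifferentiableAt ℝ g x) : ∇ (f + g) x = ∇ f x + ∇ g x := by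
  simp [gradient, fderiv_add hf hg]

theorem gradient_const_smul {f : H → ℝ} {x : H} (hf : DifferentiableAt ℝ f x) (c : ℝ) :
    ∇ (c • f) x = c • ∇ f x := by
  simp [gradient, fderiv_const_smul hf]

theorem norm_gradient (f : H → ℝ) (x : H) : ‖∇ f x‖ = ‖fderiv ℝ f x‖ := by
  simp [gradient]

theorem contDiff_gradient {f : H → ℝ} (hf : ContDiff ℝ ∞ f) :
    ContDiff ℝ ∞ fun z => ∇ f z :=
  (InnerProductSpace.toDual ℝ H).symm.contDiff.comp
    (hf.fderiv_right (m := ∞) (by simp))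

theorem continuous_gradient {f : H → ℝ} (hf : ContDiff ℝ 1 f) : Continuous fun z => ∇ f z :=
  (InnerProductSpace.toDual ℝ H).symm.continuous.comp (hf.continuous_fderiv one_ne_zero)

/-- Gradient of a ridge function. -/
theorem hasGradientAt_ridge {θ : ℝ → ℝ} {θ' : ℝ} {h x : H} (hθ : HasDerivAt θ θ' ⟪x, h⟫) :
    HasGradientAt (fun z => θ ⟪z, h⟫) (θ' • h) x := by
  have h1 : HasFDerivAt (fun z => ⟪z, h⟫) (innerSL ℝ h) x := by
    have := (innerSL ℝ h).hasFDerivAt (x := x)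
    refine this.congr_of_eventuallyEq (Eventually.of_forall fun z => ?_)
    simp [real_inner_comm]
  rw [hasGradientAt_iff_hasFDerivAt]
  refine (hθ.comp_hasFDerivAt x h1).congr_fderiv ?_
  ext v
  simp

theorem hasFDerivAt_ridge_smul {θ : ℝ → ℝ} {θ' : ℝ} {h x : H} (hθ : HasDerivAt θ θ' ⟪x, h⟫) :
    HasFDerivAt (fun z => θ ⟪z, h⟫ • h) ((θ' • innerSL ℝ h).smulRight h) x := by
  have h1 := ((hasGradientAt_ridge hθ).hasFDerivAt).smul_const h
  refine h1.congr_fderiv ?_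
  ext v
  simp

end Gradient

namespace CovEigenbasis

variable {ι : Type*} {Q : H →L[ℝ] H} [CompleteSpace H]

theorem inner_grad (S : CovEigenbasis ι Q) (f : H → ℝ) (x v : H) :
    ⟪S.grad f x, v⟫ = fderiv ℝ f x (S.sqrtQ v) := by
  rw [grad, S.inner_sqrtQ_left, inner_gradient_left]

theorem inner_grad_e (S : CovEigenbasis ι Q) (f : H → ℝ) (x : H) (k : ι) :
    ⟪S.grad f x, S.e k⟫ = √(S.lam k) * fderiv ℝ f x (S.e k) := by
  rw [S.inner_grad, S.sqrtQ_apply_e, map_smul, smul_eq_mul]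

theorem norm_grad_le (S : CovEigenbasis ι Q) (f : H → ℝ) (x : H) :
    ‖S.grad f x‖ ≤ ‖S.sqrtQ‖ * ‖fderiv ℝ f x‖ := by
  rw [grad, ← norm_gradient]
  exact S.sqrtQ.le_opNorm _

theorem continuous_grad (S : CovEigenbasis ι Q) {f : H → ℝ} (hf : ContDiff ℝ 1 f) :
    Continuous (S.grad f) :=
  S.sqrtQ.continuous.comp (continuous_gradient hf)

theorem grad_add (S : CovEigenbasis ι Q) {f g : H → ℝ} (hf : Differentiable ℝ f)
    (hg : Differentiable ℝ g) : S.grad (f + g) = S.grad f + S.grad g := by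
  ext x
  simp [grad, gradient_add (hf x) (hg x)]

theorem grad_const_smul (S : CovEigenbasis ι Q) {f : H → ℝ} (hf : Differentiable ℝ f) (c : ℝ) :
    S.grad (c • f) = c • S.grad f := by
  ext x
  simp [grad, gradient_const_smul (hf x)]

theorem ouOp_add (S : CovEigenbasis ι Q) {f g : H → ℝ} (hf : ContDiff ℝ ∞ f)
    (hg : ContDiff ℝ ∞ g) : S.ouOp (f + g) = S.ouOp f + S.ouOp g := by
  have hf1 := hf.differentiable (by simp)
  have hg1 := hg.differentiable (by simp)
  ext x
  have h1 : (fun z => ∇ (f + g) z) = (fun z => ∇ f z) + fun z => ∇ g z := by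
    ext1 z; exact gradient_add (hf1 z) (hg1 z)
  have h2 : fderiv ℝ (fun z => ∇ (f + g) z) x
      = fderiv ℝ (fun z => ∇ f z) x + fderiv ℝ (fun z => ∇ g z) x := by
    rw [h1]
    exact fderiv_add ((contDiff_gradient hf).differentiable (by simp) x)
      ((contDiff_gradient hg).differentiable (by simp) x)
  simp only [ouOp, h2, Pi.add_apply, gradient_add (hf1 x) (hg1 x), add_apply, map_add,
    inner_add_left, inner_add_right]
  rw [(S.summable_inner_Q _).tsum_add (S.summable_inner_Q _)]
  ring

theorem ouOp_const_smul (S : CovEigenbasis ι Q) {f : H → ℝ} (hf : ContDiff ℝ ∞ f) (c : ℝ) :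
    S.ouOp (c • f) = c • S.ouOp f := by
  have hf1 := hf.differentiable (by simp)
  ext x
  have h1 : (fun z => ∇ (c • f) z) = c • fun z => ∇ f z := by
    ext1 z; exact gradient_const_smul (hf1 z) c
  have h2 : fderiv ℝ (fun z => ∇ (c • f) z) x = c • fderiv ℝ (fun z => ∇ f z) x := by
    rw [h1]
    exact fderiv_const_smul ((contDiff_gradient hf).differentiable (by simp) x) c
  simp only [ouOp, h2, Pi.smul_apply, gradient_const_smul (hf1 x), smul_apply, map_smul,
    inner_smul_left, inner_smul_right, conj_trivial, smul_eq_mul, tsum_mul_left]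
  ring

theorem hess_add (S : CovEigenbasis ι Q) {f g : H → ℝ} (hf : ContDiff ℝ ∞ f)
    (hg : ContDiff ℝ ∞ g) : S.hess (f + g) = S.hess f + S.hess g := by
  have hf1 := hf.differentiable (by simp)
  have hg1 := hg.differentiable (by simp)
  ext x : 1
  have h1 : (fun z => ∇ (f + g) z) = (fun z => ∇ f z) + fun z => ∇ g z := by
    ext1 z; exact gradient_add (hf1 z) (hg1 z)
  have h2 : fderiv ℝ (fun z => ∇ (f + g) z) x
      = fderiv ℝ (fun z => ∇ f z) x + fderiv ℝ (fun z => ∇ g z) x := by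
    rw [h1]
    exact fderiv_add ((contDiff_gradient hf).differentiable (by simp) x)
      ((contDiff_gradient hg).differentiable (by simp) x)
  ext v
  simp [hess, h2]

theorem continuous_hess (S : CovEigenbasis ι Q) {f : H → ℝ} (hf : ContDiff ℝ ∞ f) :
    Continuous (S.hess f) := by
  have := (contDiff_gradient hf).continuous_fderiv (by simp)
  exact continuous_const.clm_comp (this.clm_comp continuous_const)

/-- The Ornstein–Uhlenbeck operator on ridge functions. -/
theorem two_mul_ouOp_ridge (S : CovEigenbasis ι Q) {θ θ' θ'' : ℝ → ℝ}
    (h1 : ∀ t, HasDerivAt θ (θ' t) t) (h2 : ∀ t, HasDerivAt θ' (θ'' t) t) (h x : H) :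
    2 * S.ouOp (fun z => θ ⟪z, h⟫) x = ⟪Q h, h⟫ * θ'' ⟪x, h⟫ - ⟪x, h⟫ * θ' ⟪x, h⟫ := by
  have e1 : (fun z => ∇ (fun z => θ ⟪z, h⟫) z) = fun z => θ' ⟪z, h⟫ • h := by
    ext1 z; exact (hasGradientAt_ridge (h1 _)).gradient
  have e2 := (hasFDerivAt_ridge_smul (h := h) (x := x) (h2 _)).fderiv
  -- The second derivative of a ridge function is a multiple of `h ⊗ h`, so Parseval evaluates the
  -- trace.
  have e3 : ∑' k, ⟪Q (fderiv ℝ (fun z => θ' ⟪z, h⟫ • h) x (S.e k)), S.e k⟫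
      = θ'' ⟪x, h⟫ * ⟪Q h, h⟫ := by
    rw [e2, ← S.e.tsum_inner_mul_inner (Q h) h, ← tsum_mul_left]
    refine tsum_congr fun k => ?_
    simp only [ContinuousLinearMap.smulRight_apply, smul_apply, innerSL_apply_apply, map_smul,
      smul_eq_mul, inner_smul_left, conj_trivial]
    rw [real_inner_comm (S.e k) h, real_inner_comm h x]
    ring
  have e4 : ∇ (fun z => θ ⟪z, h⟫) x = θ' ⟪x, h⟫ • h := (hasGradientAt_ridge (h1 _)).gradient
  rw [ouOp, e1, e3, e4, inner_smul_right]
  ring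

variable [SecondCountableTopology H] [MeasurableSpace H] [BorelSpace H]

/-- Gaussian integration by parts in the direction `Q h`, applied to `f · θ'(⟪·, h⟫)`: the product
rule gives `f θ'' ⟪Q h, h⟫` and the pairing of the gradients, and the other side is `f θ' ⟪x, h⟫`.
The terms containing `f` undifferentiated make up `f · 2𝓛₀`. -/
theorem integral_mul_ouOp_ridge (S : CovEigenbasis ι Q) {μ : Measure H} [IsGaussian μ]
    (hmean : ∫ x, x ∂μ = 0) (hcov : ∀ x y : H, covarianceBilin μ x y = ⟪Q x, y⟫)
    {θ θ' θ'' : ℝ → ℝ} (h1 : ∀ t, HasDerivAt θ (θ' t) t) (h2 : ∀ t, HasDerivAt θ' (θ'' t) t)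
    (hc : Continuous θ'') (b1 : ∀ t, |θ' t| ≤ 1) (b2 : ∀ t, |θ'' t| ≤ 1) (h : H) {f : H → ℝ}
    (hf : IsLinGrowthC1 f) :
    ∫ x, f x * (2 * S.ouOp (fun z => θ ⟪z, h⟫) x) ∂μ
      = -∫ x, ⟪S.grad f x, S.grad (fun z => θ ⟪z, h⟫) x⟫ ∂μ := by
  obtain ⟨hfC, C, hC⟩ := hf
  have hfd := hfC.differentiable one_ne_zero
  have hfc := hfC.continuous
  have hC0 : 0 ≤ C := by simpa using (abs_nonneg _).trans (hC 0).1
  have hθ'c : Continuous θ' := continuous_iff_continuousAt.2 fun t => (h2 t).continuousAt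
  have hic : Continuous fun x : H => ⟪x, h⟫ := by fun_prop
  have e1 : ∀ x, ∇ (fun z => θ ⟪z, h⟫) x = θ' ⟪x, h⟫ • h :=
    fun x => (hasGradientAt_ridge (h1 _)).gradient
  have hF : ∀ x, HasFDerivAt (fun x => f x * θ' ⟪x, h⟫)
      (f x • (θ'' ⟪x, h⟫ • innerSL ℝ h) + θ' ⟪x, h⟫ • fderiv ℝ f x) x := by
    intro x
    have h3 := (hasGradientAt_ridge (h := h) (x := x) (h2 _)).hasFDerivAt
    refine ((hfd x).hasFDerivAt.mul h3).congr_fderiv ?_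
    ext v
    simp
  have hfder : ∀ x, fderiv ℝ (fun x => f x * θ' ⟪x, h⟫) x (Q h)
      = f x * θ'' ⟪x, h⟫ * ⟪Q h, h⟫ + ⟪S.grad f x, S.grad (fun z => θ ⟪z, h⟫) x⟫ := by
    intro x
    rw [(hF x).fderiv, S.inner_grad, grad, S.sqrtQ_sqrtQ, e1]
    simp [real_inner_comm, mul_assoc]
  have i3 : Integrable (fun x => f x * θ'' ⟪x, h⟫ * ⟪Q h, h⟫) μ := by
    refine (integrable_of_linear_growth μ (hfc.mul (hc.comp hic)) (C := C)
      fun x => ?_).mul_const _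
    change |f x * θ'' ⟪x, h⟫| ≤ _
    rw [abs_mul]
    exact (mul_le_of_le_one_right (abs_nonneg _) (b2 _)).trans (hC x).1
  have i4 : Integrable (fun x => ⟪S.grad f x, S.grad (fun z => θ ⟪z, h⟫) x⟫) μ := by
    have e5 : ∀ x, ⟪S.grad f x, S.grad (fun z => θ ⟪z, h⟫) x⟫
        = θ' ⟪x, h⟫ * fderiv ℝ f x (Q h) := by
      intro x
      rw [S.inner_grad, grad, S.sqrtQ_sqrtQ, e1]
      simp
    simp_rw [e5]
    refine integrable_of_linear_growth μ (C := C * ‖Q h‖) ?_ fun x => ?_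
    · exact (hθ'c.comp hic).mul ((hfC.continuous_fderiv one_ne_zero).clm_apply continuous_const)
    · rw [abs_mul]
      refine (mul_le_of_le_one_left (abs_nonneg _) (b1 _)).trans ?_
      refine ((fderiv ℝ f x).le_opNorm (Q h)).trans ?_
      rw [mul_right_comm]
      exact mul_le_mul_of_nonneg_right (hC x).2 (norm_nonneg _)
  have i5 : Integrable (fun x => f x * θ' ⟪x, h⟫ * ⟪x, h⟫) μ := by
    refine integrable_mul_of_linear_growth μ (C := C) (D := ‖h‖) (hfc.mul (hθ'c.comp hic)) hic
      (fun x => ?_) fun x => ?_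
    · rw [abs_mul]
      exact (mul_le_of_le_one_right (abs_nonneg _) (b1 _)).trans (hC x).1
    · refine (abs_real_inner_le_norm _ _).trans ?_
      nlinarith [norm_nonneg h, norm_nonneg x]
  have key := S.integral_fderiv_apply_Q hmean hcov h (f := fun x => f x * θ' ⟪x, h⟫)
    (fun x => (hF x).differentiableAt)
    (integrable_of_linear_growth μ (hfc.mul (hθ'c.comp hic)) (C := C) fun x => by
      rw [abs_mul]
      exact (mul_le_of_le_one_right (abs_nonneg _) (b1 _)).trans (hC x).1)
    (by simp_rw [hfder]; exact i3.add i4) i5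
  simp_rw [hfder] at key
  rw [integral_add i3 i4] at key
  have e6 : ∀ x, f x * (2 * S.ouOp (fun z => θ ⟪z, h⟫) x)
      = f x * θ'' ⟪x, h⟫ * ⟪Q h, h⟫ - f x * θ' ⟪x, h⟫ * ⟪x, h⟫ := by
    intro x
    rw [S.two_mul_ouOp_ridge h1 h2]
    ring
  simp_rw [e6]
  rw [integral_sub i3 i5]
  linarith

end CovEigenbasis

end GaussSobolev

/-! ### Calculus on `𝓔₀(H)`: derivatives, commutation, and `𝓛₀` as a divergence. -/

namespace GaussSobolev

variable {H : Type*} [NormedAddCommGroup H] [InnerProductSpace ℝ H]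

/-- Differentiation is a phase shift by `π/2`. With a free phase, the single family `cos (⟪x, h⟫ +
c)` replaces sines and cosines and is stable under differentiation. -/
theorem hasDerivAt_cos_add (c t : ℝ) :
    HasDerivAt (fun t => Real.cos (t + c)) (Real.cos (t + (c + Real.pi / 2))) t := by
  rw [← add_assoc, Real.cos_add_pi_div_two]
  simpa using (Real.hasDerivAt_cos (t + c)).comp_add_const t c

theorem cos_add_mem_expFunctions (h : H) (c : ℝ) :
    (fun x => Real.cos (⟪x, h⟫ + c)) ∈ expFunctions H := by
  have e : (fun x => Real.cos (⟪x, h⟫ + c)) = Real.cos c • (fun x => Real.cos ⟪x, h⟫)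
      - Real.sin c • fun x => Real.sin ⟪x, h⟫ := by
    ext x
    simp [Real.cos_add]
    ring
  rw [e]
  exact sub_mem (Submodule.smul_mem _ _ (Submodule.subset_span (Or.inl ⟨h, rfl⟩)))
    (Submodule.smul_mem _ _ (Submodule.subset_span (Or.inr ⟨h, rfl⟩)))

theorem expFunctions_induction {p : (H → ℝ) → Prop}
    (cos : ∀ (h : H) (c : ℝ), p fun x => Real.cos (⟪x, h⟫ + c))
    (add : ∀ f g, f ∈ expFunctions H → g ∈ expFunctions H → p f → p g → p (f + g))
    (smul : ∀ (a : ℝ) (f), f ∈ expFunctions H → p f → p (a • f))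
    {f : H → ℝ} (hf : f ∈ expFunctions H) : p f := by
  refine Submodule.span_induction (p := fun f _ => p f) ?_ ?_ (fun f g hf hg => add f g hf hg)
    (fun a f hf => smul a f hf) hf
  · rintro f (⟨h, rfl⟩ | ⟨h, rfl⟩)
    · simpa using cos h 0
    · have := cos h (-(Real.pi / 2))
      simpa [← sub_eq_add_neg, Real.cos_sub_pi_div_two] using this
  -- The zero function is a zero multiple of a cosine, so no separate hypothesis is needed for it.
  · have := smul 0 _ (cos_add_mem_expFunctions (0 : H) 0) (cos 0 0)
    rwa [zero_smul] at this

theorem contDiff_of_mem_expFunctions {f : H → ℝ} (hf : f ∈ expFunctions H) : ContDiff ℝ ∞ f := by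
  refine expFunctions_induction (fun h c => ?_) (fun f g _ _ h1 h2 => h1.add h2)
    (fun a f _ h => h.const_smul a) hf
  exact Real.contDiff_cos.comp ((contDiff_id.inner ℝ contDiff_const).add contDiff_const)

theorem differentiable_of_mem_expFunctions {f : H → ℝ} (hf : f ∈ expFunctions H) :
    Differentiable ℝ f :=
  (contDiff_of_mem_expFunctions hf).differentiable (by simp)

variable [CompleteSpace H]

theorem gradient_cos_add (h x : H) (c : ℝ) :
    ∇ (fun x => Real.cos (⟪x, h⟫ + c)) x = Real.cos (⟪x, h⟫ + (c + Real.pi / 2)) • h :=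
  (hasGradientAt_ridge (θ := fun t => Real.cos (t + c)) (hasDerivAt_cos_add c _)).gradient

theorem fderiv_cos_add_apply (h x v : H) (c : ℝ) :
    fderiv ℝ (fun x => Real.cos (⟪x, h⟫ + c)) x v
      = ⟪v, h⟫ * Real.cos (⟪x, h⟫ + (c + Real.pi / 2)) := by
  rw [← inner_gradient_left, gradient_cos_add, inner_smul_left, conj_trivial,
    real_inner_comm v h, mul_comm]

theorem fderiv_gradient_cos_add_apply (h x v : H) (c : ℝ) :
    fderiv ℝ (fun z => ∇ (fun x => Real.cos (⟪x, h⟫ + c)) z) x v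
      = (⟪v, h⟫ * Real.cos (⟪x, h⟫ + (c + Real.pi / 2 + Real.pi / 2))) • h := by
  simp_rw [gradient_cos_add]
  rw [(hasFDerivAt_ridge_smul (θ := fun t => Real.cos (t + (c + Real.pi / 2)))
    (hasDerivAt_cos_add (c + Real.pi / 2) _)).fderiv]
  simp [real_inner_comm, mul_comm]

theorem isBddC1_of_mem_expFunctions {f : H → ℝ} (hf : f ∈ expFunctions H) : IsBddC1 f := by
  refine ⟨(contDiff_of_mem_expFunctions hf).of_le (by simp), ?_⟩
  refine expFunctions_induction (p := fun f => ∃ C, ∀ x, |f x| ≤ C ∧ ‖fderiv ℝ f x‖ ≤ C)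
    (fun h c => ⟨1 + ‖h‖, fun x => ⟨?_, ?_⟩⟩) ?_ ?_ hf
  · exact (Real.abs_cos_le_one _).trans (by linarith [norm_nonneg h])
  · rw [← norm_gradient, gradient_cos_add, norm_smul]
    refine (mul_le_of_le_one_left (norm_nonneg _) (Real.abs_cos_le_one _)).trans ?_
    linarith
  · rintro f g hf hg ⟨C, hC⟩ ⟨D, hD⟩
    refine ⟨C + D, fun x => ⟨?_, ?_⟩⟩
    · exact (abs_add_le _ _).trans (add_le_add (hC x).1 (hD x).1)
    · rw [fderiv_add (differentiable_of_mem_expFunctions hf x)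
        (differentiable_of_mem_expFunctions hg x)]
      exact (norm_add_le _ _).trans (add_le_add (hC x).2 (hD x).2)
  · rintro a f hf ⟨C, hC⟩
    refine ⟨|a| * C, fun x => ⟨?_, ?_⟩⟩
    · rw [Pi.smul_apply, smul_eq_mul, abs_mul]
      exact mul_le_mul_of_nonneg_left (hC x).1 (abs_nonneg _)
    · rw [fderiv_const_smul (differentiable_of_mem_expFunctions hf x), norm_smul,
        Real.norm_eq_abs]
      exact mul_le_mul_of_nonneg_left (hC x).2 (abs_nonneg _)

/-- Differentiating a generator only shifts its phase and multiplies by `⟪v, h⟫`. This stability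
lets first-order statements be applied to the partial derivatives of `φ`, which is how second-order
ones are reached. -/
theorem fderiv_apply_mem_expFunctions {f : H → ℝ} (hf : f ∈ expFunctions H) (v : H) :
    (fun x => fderiv ℝ f x v) ∈ expFunctions H := by
  refine expFunctions_induction (p := fun f => (fun x => fderiv ℝ f x v) ∈ expFunctions H)
    (fun h c => ?_) ?_ ?_ hf
  · simp_rw [fderiv_cos_add_apply]
    exact Submodule.smul_mem _ ⟪v, h⟫ (cos_add_mem_expFunctions h (c + Real.pi / 2))
  · intro f g hf hg h1 h2
    convert! add_mem h1 h2 using 1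
    ext x
    rw [fderiv_add (differentiable_of_mem_expFunctions hf x)
        (differentiable_of_mem_expFunctions hg x)]
    rfl
  · intro a f hf h1
    convert! Submodule.smul_mem _ a h1 using 1
    ext x
    rw [fderiv_const_smul (differentiable_of_mem_expFunctions hf x)]
    rfl

/-- Symmetry of the second derivative, immediate on generators, where both sides are the same
multiple of `h`. It makes each column of the Hessian the gradient of a partial derivative. -/
theorem fderiv_gradient_apply {f : H → ℝ} (hf : f ∈ expFunctions H) (x v : H) :
    fderiv ℝ (fun z => ∇ f z) x v = ∇ (fun y => fderiv ℝ f y v) x := by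
  refine expFunctions_induction (p := fun f => fderiv ℝ (fun z => ∇ f z) x v =
    ∇ (fun y => fderiv ℝ f y v) x) (fun h c => ?_) ?_ ?_ hf
  · rw [fderiv_gradient_cos_add_apply]
    have e : (fun y => fderiv ℝ (fun x => Real.cos (⟪x, h⟫ + c)) y v)
        = ⟪v, h⟫ • fun y => Real.cos (⟪y, h⟫ + (c + Real.pi / 2)) := by
      ext y
      simp [fderiv_cos_add_apply]
    rw [e, gradient_const_smul (differentiable_of_mem_expFunctions
      (cos_add_mem_expFunctions h _) x), gradient_cos_add, smul_smul]
  · intro f g hf hg h1 h2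
    have hf1 := differentiable_of_mem_expFunctions hf
    have hg1 := differentiable_of_mem_expFunctions hg
    have e1 : (fun z => ∇ (f + g) z) = (fun z => ∇ f z) + fun z => ∇ g z := by
      ext1 z; exact gradient_add (hf1 z) (hg1 z)
    have e2 : (fun y => fderiv ℝ (f + g) y v)
        = (fun y => fderiv ℝ f y v) + fun y => fderiv ℝ g y v := by
      ext1 z; rw [fderiv_add (hf1 z) (hg1 z)]; rfl
    rw [e1, e2, gradient_add
      (differentiable_of_mem_expFunctions (fderiv_apply_mem_expFunctions hf v) x)
      (differentiable_of_mem_expFunctions (fderiv_apply_mem_expFunctions hg v) x), ← h1, ← h2,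
      fderiv_add ((contDiff_gradient (contDiff_of_mem_expFunctions hf)).differentiable (by simp) x)
      ((contDiff_gradient (contDiff_of_mem_expFunctions hg)).differentiable (by simp) x)]
    rfl
  · intro a f hf h1
    have hf1 := differentiable_of_mem_expFunctions hf
    have e1 : (fun z => ∇ (a • f) z) = a • (fun z => ∇ f z) := by
      ext1 z; exact gradient_const_smul (hf1 z) a
    have e2 : (fun y => fderiv ℝ (a • f) y v) = a • (fun y => fderiv ℝ f y v) := by
      ext1 z; rw [fderiv_const_smul (hf1 z)]; rfl
    rw [e1, e2, gradient_const_smul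
      (differentiable_of_mem_expFunctions (fderiv_apply_mem_expFunctions hf v) x), ← h1,
      fderiv_const_smul
        ((contDiff_gradient (contDiff_of_mem_expFunctions hf)).differentiable (by simp) x)]
    rfl

namespace CovEigenbasis

variable {ι : Type*} {Q : H →L[ℝ] H}

theorem two_mul_ouOp_cos_add (S : CovEigenbasis ι Q) (h x : H) (c : ℝ) :
    2 * S.ouOp (fun z => Real.cos (⟪z, h⟫ + c)) x
      = ⟪Q h, h⟫ * Real.cos (⟪x, h⟫ + (c + Real.pi / 2 + Real.pi / 2))
        - ⟪x, h⟫ * Real.cos (⟪x, h⟫ + (c + Real.pi / 2)) :=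
  S.two_mul_ouOp_ridge (θ := fun t => Real.cos (t + c)) (hasDerivAt_cos_add c)
    (hasDerivAt_cos_add _) h x

/-- The Ornstein–Uhlenbeck operator maps `𝓔₀(H)` to functions of linear growth, and its commutator
with a directional derivative is the directional derivative. -/
theorem isLinGrowthC1_ouOp (S : CovEigenbasis ι Q) {f : H → ℝ} (hf : f ∈ expFunctions H) :
    IsLinGrowthC1 ((2 : ℝ) • S.ouOp f) ∧ ∀ x v, fderiv ℝ ((2 : ℝ) • S.ouOp f) x v
      = 2 * S.ouOp (fun y => fderiv ℝ f y v) x - fderiv ℝ f x v := by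
  refine expFunctions_induction (p := fun f => IsLinGrowthC1 ((2 : ℝ) • S.ouOp f) ∧
    ∀ x v, fderiv ℝ ((2 : ℝ) • S.ouOp f) x v
      = 2 * S.ouOp (fun y => fderiv ℝ f y v) x - fderiv ℝ f x v) (fun h c => ?_) ?_ ?_ hf
  · set q := ⟪Q h, h⟫ with hq
    have e : (2 : ℝ) • S.ouOp (fun z => Real.cos (⟪z, h⟫ + c)) = fun x =>
        (fun t => q * Real.cos (t + (c + Real.pi / 2 + Real.pi / 2))
          - t * Real.cos (t + (c + Real.pi / 2))) ⟪x, h⟫ := by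
      ext x; exact S.two_mul_ouOp_cos_add h x c
    have hd : ∀ t, HasDerivAt (fun t => q * Real.cos (t + (c + Real.pi / 2 + Real.pi / 2))
          - t * Real.cos (t + (c + Real.pi / 2)))
          (q * Real.cos (t + (c + Real.pi / 2 + Real.pi / 2 + Real.pi / 2))
          - (Real.cos (t + (c + Real.pi / 2))
            + t * Real.cos (t + (c + Real.pi / 2 + Real.pi / 2)))) t := by
      intro t
      have := ((hasDerivAt_cos_add (c + Real.pi / 2 + Real.pi / 2) t).const_mul q).sub
        ((hasDerivAt_id t).mul (hasDerivAt_cos_add (c + Real.pi / 2) t))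
      refine this.congr_deriv ?_
      simp
    have hg := fun x => hasGradientAt_ridge (h := h) (x := x) (hd _)
    have hmul : ∀ a b : ℝ, |a * Real.cos b| ≤ |a| := fun a b => by
      rw [abs_mul]
      exact mul_le_of_le_one_right (abs_nonneg _) (Real.abs_cos_le_one _)
    rw [e]
    -- One constant for both bounds: the first factor controls the one-variable profile and its
    -- derivative, up to `1 + ‖x‖`; the factor `1 + ‖h‖` absorbs the `‖h‖` produced by the gradient.
    refine ⟨⟨?_, (|q| + 1 + ‖h‖) * (1 + ‖h‖), fun x => ?_⟩, fun x v => ?_⟩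
    · have h1 : ContDiff ℝ 1 fun x : H => ⟪x, h⟫ := contDiff_id.inner ℝ contDiff_const
      fun_prop
    · have hi := abs_real_inner_le_norm x h
      have n1 := norm_nonneg x
      have n2 := norm_nonneg h
      have n3 := abs_nonneg q
      constructor
      · refine (abs_sub _ _).trans ((add_le_add (hmul _ _) (hmul _ _)).trans ?_)
        have p1 := mul_nonneg n1 n2
        have p2 := mul_nonneg n3 n1
        have p3 := mul_nonneg n3 n2
        have p4 := mul_nonneg p2 n2
        have p5 := mul_nonneg n2 p1
        nlinarith
      · rw [← norm_gradient, (hg x).gradient, norm_smul, mul_comm, Real.norm_eq_abs,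
          mul_right_comm, mul_comm]
        refine mul_le_mul ?_ (by linarith) n2 (by positivity)
        refine (abs_sub _ _).trans ((add_le_add (hmul _ _) ((abs_add_le _ _).trans
          (add_le_add (Real.abs_cos_le_one _) (hmul _ _)))).trans ?_)
        nlinarith
    · have e2 : (fun y => fderiv ℝ (fun x => Real.cos (⟪x, h⟫ + c)) y v)
          = ⟪v, h⟫ • fun y => Real.cos (⟪y, h⟫ + (c + Real.pi / 2)) := by
        ext y
        simp [fderiv_cos_add_apply]
      rw [e2, S.ouOp_const_smul (contDiff_of_mem_expFunctions (cos_add_mem_expFunctions h _)),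
        Pi.smul_apply, smul_eq_mul, mul_left_comm, S.two_mul_ouOp_cos_add, fderiv_cos_add_apply,
        ← inner_gradient_left, (hg x).gradient, inner_smul_left, conj_trivial, real_inner_comm v h]
      ring
  · rintro f g hf hg ⟨h1, h2⟩ ⟨h3, h4⟩
    have hf1 := differentiable_of_mem_expFunctions hf
    have hg1 := differentiable_of_mem_expFunctions hg
    have e : (2 : ℝ) • S.ouOp (f + g) = (2 : ℝ) • S.ouOp f + (2 : ℝ) • S.ouOp g := by
      rw [S.ouOp_add (contDiff_of_mem_expFunctions hf) (contDiff_of_mem_expFunctions hg), smul_add]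
    rw [e]
    refine ⟨h1.add h3, fun x v => ?_⟩
    have e2 : (fun y => fderiv ℝ (f + g) y v)
        = (fun y => fderiv ℝ f y v) + fun y => fderiv ℝ g y v := by
      ext1 z; rw [fderiv_add (hf1 z) (hg1 z)]; rfl
    rw [e2, S.ouOp_add (contDiff_of_mem_expFunctions (fderiv_apply_mem_expFunctions hf v))
      (contDiff_of_mem_expFunctions (fderiv_apply_mem_expFunctions hg v)),
      fderiv_add (h1.1.differentiable one_ne_zero x) (h3.1.differentiable one_ne_zero x),
      fderiv_add (hf1 x) (hg1 x), add_apply, add_apply, h2, h4, Pi.add_apply]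
    ring
  · rintro a f hf ⟨h1, h2⟩
    have hf1 := differentiable_of_mem_expFunctions hf
    have e : (2 : ℝ) • S.ouOp (a • f) = a • ((2 : ℝ) • S.ouOp f) := by
      rw [S.ouOp_const_smul (contDiff_of_mem_expFunctions hf), smul_comm]
    rw [e]
    refine ⟨h1.smul a, fun x v => ?_⟩
    have e2 : (fun y => fderiv ℝ (a • f) y v) = a • (fun y => fderiv ℝ f y v) := by
      ext1 z; rw [fderiv_const_smul (hf1 z)]; rfl
    rw [e2, S.ouOp_const_smul (contDiff_of_mem_expFunctions (fderiv_apply_mem_expFunctions hf v)),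
      fderiv_const_smul (h1.1.differentiable one_ne_zero x), fderiv_const_smul (hf1 x),
      smul_apply, smul_apply, h2, Pi.smul_apply, smul_eq_mul, smul_eq_mul, smul_eq_mul]
    ring

theorem hess_apply_e (S : CovEigenbasis ι Q) {f : H → ℝ} (hf : f ∈ expFunctions H) (x : H)
    (k : ι) : S.hess f x (S.e k)
      = √(S.lam k) • S.grad (fun y => fderiv ℝ f y (S.e k)) x := by
  simp only [hess, grad, ContinuousLinearMap.comp_apply]
  rw [S.sqrtQ_apply_e, map_smul, map_smul, fderiv_gradient_apply hf]

theorem norm_hess_apply_e_sq (S : CovEigenbasis ι Q) {f : H → ℝ} (hf : f ∈ expFunctions H) (x : H)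
    (k : ι) : ‖S.hess f x (S.e k)‖ ^ 2
      = S.lam k * ‖S.grad (fun y => fderiv ℝ f y (S.e k)) x‖ ^ 2 := by
  rw [S.hess_apply_e hf, norm_smul, mul_pow, Real.norm_of_nonneg (Real.sqrt_nonneg _),
    Real.sq_sqrt (S.lam_pos k).le]

theorem ouOp_sub (S : CovEigenbasis ι Q) {f g : H → ℝ} (hf : ContDiff ℝ ∞ f)
    (hg : ContDiff ℝ ∞ g) : S.ouOp (f - g) = S.ouOp f - S.ouOp g := by
  have := S.ouOp_add (show ContDiff ℝ ∞ (f - g) from hf.sub hg) hg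
  rw [sub_add_cancel] at this
  rw [this, add_sub_cancel_right]

theorem hess_sub (S : CovEigenbasis ι Q) {f g : H → ℝ} (hf : ContDiff ℝ ∞ f)
    (hg : ContDiff ℝ ∞ g) : S.hess (f - g) = S.hess f - S.hess g := by
  have := S.hess_add (show ContDiff ℝ ∞ (f - g) from hf.sub hg) hg
  rw [sub_add_cancel] at this
  rw [this, add_sub_cancel_right]

theorem grad_sub (S : CovEigenbasis ι Q) {f g : H → ℝ} (hf : Differentiable ℝ f)
    (hg : Differentiable ℝ g) : S.grad (f - g) = S.grad f - S.grad g := by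
  have := S.grad_add (show Differentiable ℝ (f - g) from hf.sub hg) hg
  rw [sub_add_cancel] at this
  rw [this, add_sub_cancel_right]

variable [SecondCountableTopology H] [MeasurableSpace H] [BorelSpace H]

/-- Both sides are linear in `φ`, which reduces the identity to ridge functions. Linear growth of
`f` is allowed because the energy identity takes `f = 2𝓛₀φ`, which is unbounded in general. -/
theorem integral_mul_ouOp (S : CovEigenbasis ι Q) {μ : Measure H} [IsGaussian μ]
    (hmean : ∫ x, x ∂μ = 0) (hcov : ∀ x y : H, covarianceBilin μ x y = ⟪Q x, y⟫)
    {f φ : H → ℝ} (hf : IsLinGrowthC1 f) (hφ : φ ∈ expFunctions H) :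
    ∫ x, f x * (2 * S.ouOp φ x) ∂μ = -∫ x, ⟪S.grad f x, S.grad φ x⟫ ∂μ := by
  obtain ⟨hfC, C, hC⟩ := hf
  have i1 : ∀ φ ∈ expFunctions H, Integrable (fun x => f x * (2 * S.ouOp φ x)) μ := by
    intro φ hφ
    obtain ⟨⟨h1, D, hD⟩, -⟩ := S.isLinGrowthC1_ouOp hφ
    exact integrable_mul_of_linear_growth μ hfC.continuous h1.continuous (fun x => (hC x).1)
      fun x => (hD x).1
  have i2 : ∀ φ ∈ expFunctions H, Integrable (fun x => ⟪S.grad f x, S.grad φ x⟫) μ := by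
    intro φ hφ
    obtain ⟨h1, D, hD⟩ := isBddC1_of_mem_expFunctions hφ
    have hD0 : 0 ≤ D := (abs_nonneg _).trans (hD 0).1
    have hC0 : 0 ≤ C := by simpa using (abs_nonneg _).trans (hC 0).1
    refine integrable_of_linear_growth μ ((S.continuous_grad hfC).inner (S.continuous_grad h1))
      (C := ‖S.sqrtQ‖ * C * (‖S.sqrtQ‖ * D)) fun x => ?_
    refine (abs_real_inner_le_norm _ _).trans ?_
    calc ‖S.grad f x‖ * ‖S.grad φ x‖
        ≤ (‖S.sqrtQ‖ * (C * (1 + ‖x‖))) * (‖S.sqrtQ‖ * D) := by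
          refine mul_le_mul ((S.norm_grad_le _ _).trans ?_) ((S.norm_grad_le _ _).trans ?_)
            (norm_nonneg _) (by positivity)
          · exact mul_le_mul_of_nonneg_left (hC x).2 (norm_nonneg _)
          · exact mul_le_mul_of_nonneg_left (hD x).2 (norm_nonneg _)
      _ = _ := by ring
  refine expFunctions_induction (p := fun φ => ∫ x, f x * (2 * S.ouOp φ x) ∂μ
    = -∫ x, ⟪S.grad f x, S.grad φ x⟫ ∂μ) (fun h c => ?_) ?_ ?_ hφ
  · exact S.integral_mul_ouOp_ridge hmean hcov (θ := fun t => Real.cos (t + c))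
      (hasDerivAt_cos_add c) (hasDerivAt_cos_add _) (by fun_prop)
      (fun t => Real.abs_cos_le_one _) (fun t => Real.abs_cos_le_one _) h ⟨hfC, C, hC⟩
  · intro φ φ' hφ hφ' h1 h2
    rw [S.ouOp_add (contDiff_of_mem_expFunctions hφ) (contDiff_of_mem_expFunctions hφ'),
      S.grad_add (differentiable_of_mem_expFunctions hφ) (differentiable_of_mem_expFunctions hφ')]
    simp only [Pi.add_apply, mul_add, inner_add_right]
    rw [integral_add (i1 _ hφ) (i1 _ hφ'), integral_add (i2 _ hφ) (i2 _ hφ'), h1, h2, neg_add]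
  · intro a φ hφ h1
    rw [S.ouOp_const_smul (contDiff_of_mem_expFunctions hφ),
      S.grad_const_smul (differentiable_of_mem_expFunctions hφ)]
    simp only [Pi.smul_apply, inner_smul_right, smul_eq_mul]
    rw [integral_const_mul, ← mul_neg, ← h1, ← integral_const_mul]
    refine integral_congr_ae (ae_of_all _ fun x => ?_)
    ring

end CovEigenbasis

end GaussSobolev

/-! ### `L²` tools and the second-order energy identity. -/

namespace GaussSobolev

section Lp

variable {Ω E : Type*} [MeasurableSpace Ω] [NormedAddCommGroup E] {μ : Measure Ω}

theorem eLpNorm_two_sq (f : Ω → E) : eLpNorm f 2 μ ^ 2 = ∫⁻ x, ‖f x‖ₑ ^ 2 ∂μ := by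
  have := eLpNorm_nnreal_pow_eq_lintegral (f := f) (μ := μ) (p := 2) two_ne_zero
  simpa using this

theorem ennreal_tendsto_zero_of_sq {ι : Type*} {l : Filter ι} {a : ι → ℝ≥0∞}
    (h : Tendsto (fun i => a i ^ 2) l (𝓝 0)) : Tendsto a l (𝓝 0) := by
  have h1 := (ENNReal.continuous_rpow_const (y := 1 / 2)).tendsto 0
  have h2 := h1.comp h
  simp only [one_div, ENNReal.zero_rpow_of_pos (show (0 : ℝ) < 2⁻¹ by norm_num)] at h2
  refine h2.congr fun i => ?_
  rw [Function.comp_apply, ← ENNReal.rpow_natCast, ← ENNReal.rpow_mul]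
  norm_num

theorem lintegral_enorm_sq_eq_ofReal {f : Ω → E} (hf : MemLp f 2 μ) :
    ∫⁻ x, ‖f x‖ₑ ^ 2 ∂μ = ENNReal.ofReal (∫ x, ‖f x‖ ^ 2 ∂μ) := by
  rw [ofReal_integral_eq_lintegral_ofReal (hf.integrable_norm_pow (p := 2) two_ne_zero)
    (ae_of_all _ fun x => by positivity)]
  refine lintegral_congr fun x => ?_
  rw [ENNReal.ofReal_pow (norm_nonneg _), ofReal_norm]

/-- Completeness of `L²`, for sequences of functions. -/
theorem exists_memLp_tendsto_of_cauchy [CompleteSpace E] {f : ℕ → Ω → E}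
    (hf : ∀ n, MemLp (f n) 2 μ)
    (h : Tendsto (fun p : ℕ × ℕ => eLpNorm (fun x => f p.1 x - f p.2 x) 2 μ) atTop (𝓝 0)) :
    ∃ F, MemLp F 2 μ ∧ Tendsto (fun n => eLpNorm (fun x => f n x - F x) 2 μ) atTop (𝓝 0) := by
  have hc : CauchySeq fun n => (hf n).toLp := by
    rw [EMetric.cauchySeq_iff]
    intro ε hε
    obtain ⟨N, hN⟩ := eventually_atTop.1 (h.eventually (gt_mem_nhds hε))
    refine ⟨max N.1 N.2, fun m hm n hn => ?_⟩
    rw [Lp.edist_toLp_toLp]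
    exact hN (m, n) ⟨(le_max_left _ _).trans hm, (le_max_right _ _).trans hn⟩
  obtain ⟨F, hF⟩ := cauchySeq_tendsto_of_complete hc
  refine ⟨F, Lp.memLp F, ?_⟩
  have e : F = (Lp.memLp F).toLp := (Lp.toLp_coeFn F (Lp.memLp F)).symm
  rw [e] at hF
  exact (Lp.tendsto_Lp_iff_tendsto_eLpNorm'' f hf F (Lp.memLp F)).1 hF

/-- Stated along pairs of indices in order to serve twice: with `f = g` it is a Cauchy criterion,
and along the diagonal it compares two approximating sequences in closability arguments. -/
theorem tendsto_eLpNorm_sub_sub {f g : ℕ → Ω → E} {F G : Ω → E} {p : ℝ≥0∞} (hp : 1 ≤ p)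
    (hf : ∀ n, AEStronglyMeasurable (f n) μ) (hg : ∀ n, AEStronglyMeasurable (g n) μ)
    (hF : AEStronglyMeasurable F μ) (hG : AEStronglyMeasurable G μ)
    (h : Tendsto (fun n => eLpNorm (fun x => f n x - F x) p μ) atTop (𝓝 0))
    (h' : Tendsto (fun n => eLpNorm (fun x => g n x - G x) p μ) atTop (𝓝 0)) :
    Tendsto (fun q : ℕ × ℕ => eLpNorm (fun x => (f q.1 x - g q.2 x) - (F x - G x)) p μ) atTop
      (𝓝 0) := by
  have h1 : Tendsto (fun q : ℕ × ℕ => eLpNorm (fun x => f q.1 x - F x) p μ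
      + eLpNorm (fun x => g q.2 x - G x) p μ) atTop (𝓝 0) := by
    rw [← prod_atTop_atTop_eq]
    simpa using (h.comp tendsto_fst).add (h'.comp tendsto_snd)
  refine tendsto_of_tendsto_of_tendsto_of_le_of_le tendsto_const_nhds h1 (fun _ => zero_le)
    fun q => ?_
  have e : (fun x => (f q.1 x - g q.2 x) - (F x - G x))
      = (fun x => f q.1 x - F x) - fun x => g q.2 x - G x := by
    ext x; simp only [Pi.sub_apply]; abel
  simp only [e]
  exact eLpNorm_sub_le ((hf _).sub hF) ((hg _).sub hG) hp

/-- Strong convergence in `L²` implies weak convergence. -/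
theorem tendsto_integral_mul_of_tendsto_eLpNorm_two {a : ℕ → Ω → ℝ} {A b : Ω → ℝ}
    (ha : ∀ n, MemLp (a n) 2 μ) (hA : MemLp A 2 μ) (hb : MemLp b 2 μ)
    (h : Tendsto (fun n => eLpNorm (fun x => a n x - A x) 2 μ) atTop (𝓝 0)) :
    Tendsto (fun n => ∫ x, a n x * b x ∂μ) atTop (𝓝 (∫ x, A x * b x ∂μ)) := by
  refine tendsto_integral_of_L1' (fun x => A x * b x) (hA.1.mul hb.1)
    (Eventually.of_forall fun n => (ha n).integrable_mul hb) ?_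
  have h1 : Tendsto (fun n => eLpNorm (fun x => a n x - A x) 2 μ * eLpNorm b 2 μ) atTop
      (𝓝 0) := by
    simpa using ENNReal.Tendsto.mul_const h (Or.inr hb.2.ne)
  refine tendsto_of_tendsto_of_tendsto_of_le_of_le tendsto_const_nhds h1 (fun _ => zero_le)
    fun n => ?_
  have e : ((fun x => a n x * b x) - fun x => A x * b x) = (fun x => a n x - A x) • b := by
    ext x; simp [sub_mul]
  simp only [e]
  exact eLpNorm_smul_le_mul_eLpNorm hb.1 ((ha n).1.sub hA.1)

end Lp

variable {H : Type*} [NormedAddCommGroup H] [InnerProductSpace ℝ H]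

theorem _root_.HilbertBasis.hasSum_inner_sq {ι : Type*} (b : HilbertBasis ι ℝ H) (x : H) :
    HasSum (fun k => ⟪x, b k⟫ ^ 2) (‖x‖ ^ 2) := by
  have := b.hasSum_inner_mul_inner x x
  rw [real_inner_self_eq_norm_sq] at this
  convert! this using 2 with k
  rw [sq, real_inner_comm x (b k)]

/-- The operator norm is dominated by the Hilbert–Schmidt norm. -/
theorem enorm_sq_le_tsum {ι : Type*} [CompleteSpace H] (b : HilbertBasis ι ℝ H) (A : H →L[ℝ] H) :
    ‖A‖ₑ ^ 2 ≤ ∑' k, ‖A (b k)‖ₑ ^ 2 := by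
  have e : ∀ k, ‖A (b k)‖ₑ ^ 2 = ENNReal.ofReal (‖A (b k)‖ ^ 2) := fun k => by
    rw [ENNReal.ofReal_pow (norm_nonneg _), ofReal_norm]
  by_cases hs : Summable fun k => ‖A (b k)‖ ^ 2
  · simp_rw [e]
    rw [← ENNReal.ofReal_tsum_of_nonneg (fun k => by positivity) hs, ← ofReal_norm,
      ← ENNReal.ofReal_pow (norm_nonneg _)]
    refine ENNReal.ofReal_le_ofReal ?_
    set s := ∑' k, ‖A (b k)‖ ^ 2 with hsdef
    have hs0 : 0 ≤ s := tsum_nonneg fun k => by positivity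
    -- Passing to the adjoint, `‖A* y‖² = ∑ ⟪y, A eₖ⟫²`, and Cauchy–Schwarz applies termwise.
    rw [← Real.le_sqrt (norm_nonneg _) hs0, ← ContinuousLinearMap.adjoint.norm_map A]
    refine ContinuousLinearMap.opNorm_le_bound _ (Real.sqrt_nonneg _) fun y => ?_
    refine (sq_le_sq₀ (norm_nonneg _) (by positivity)).1 ?_
    rw [mul_pow, Real.sq_sqrt hs0, ← (b.hasSum_inner_sq _).tsum_eq, mul_comm, hsdef,
      ← tsum_mul_left]
    refine (b.hasSum_inner_sq _).summable.tsum_le_tsum (fun k => ?_) (hs.mul_left _)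
    rw [ContinuousLinearMap.adjoint_inner_left, ← mul_pow]
    exact sq_le_sq' (by linarith [neg_abs_le ⟪y, A (b k)⟫, abs_real_inner_le_norm y (A (b k))])
      ((le_abs_self _).trans (abs_real_inner_le_norm _ _))
  -- If the squares are not summable in `ℝ`, the extended sum is `⊤` and there is nothing to prove.
  · have : ∑' k, ‖A (b k)‖ₑ ^ 2 = ⊤ := by
      by_contra hne
      apply hs
      have h2 := ENNReal.summable_toReal hne
      refine h2.congr fun k => ?_
      rw [e, ENNReal.toReal_ofReal (by positivity)]
    rw [this]
    exact le_top

theorem eLpNorm_two_sq_le_lintegral_tsum {ι : Type*} [CompleteSpace H] [MeasurableSpace H]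
    (b : HilbertBasis ι ℝ H) (μ : Measure H) (T : H → H →L[ℝ] H) :
    eLpNorm T 2 μ ^ 2 ≤ ∫⁻ x, ∑' k, ‖T x (b k)‖ₑ ^ 2 ∂μ := by
  rw [eLpNorm_two_sq]
  exact lintegral_mono fun x => enorm_sq_le_tsum b (T x)

variable [CompleteSpace H] [SecondCountableTopology H] [MeasurableSpace H] [BorelSpace H]

theorem IsLinGrowthC1.memLp_two {f : H → ℝ} (hf : IsLinGrowthC1 f) (μ : Measure H)
    [IsGaussian μ] : MemLp f 2 μ := by
  obtain ⟨h, C, hC⟩ := hf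
  rw [memLp_two_iff_integrable_sq h.continuous.aestronglyMeasurable]
  simpa [sq] using integrable_mul_of_linear_growth μ h.continuous h.continuous
    (fun x => (hC x).1) fun x => (hC x).1

namespace CovEigenbasis

variable {ι : Type*} {Q : H →L[ℝ] H}

theorem memLp_grad (S : CovEigenbasis ι Q) (μ : Measure H) [IsFiniteMeasure μ] {f : H → ℝ}
    (hf : IsBddC1 f) (p : ℝ≥0∞) : MemLp (S.grad f) p μ := by
  obtain ⟨h, C, hC⟩ := hf
  exact MemLp.of_bound (S.continuous_grad h).aestronglyMeasurable (‖S.sqrtQ‖ * C)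
    (ae_of_all _ fun x => (S.norm_grad_le _ _).trans
      (mul_le_mul_of_nonneg_left (hC x).2 (norm_nonneg _)))

/-- The second-order energy identity for the Ornstein–Uhlenbeck operator. -/
theorem hasSum_integral_ouOp_sq (S : CovEigenbasis ι Q) {μ : Measure H} [IsGaussian μ]
    (hmean : ∫ x, x ∂μ = 0) (hcov : ∀ x y : H, covarianceBilin μ x y = ⟪Q x, y⟫)
    {φ : H → ℝ} (hφ : φ ∈ expFunctions H) :
    HasSum (fun k => S.lam k * (∫ x, ‖S.grad (fun y => fderiv ℝ φ y (S.e k)) x‖ ^ 2 ∂μ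
      + ∫ x, fderiv ℝ φ x (S.e k) ^ 2 ∂μ)) (∫ x, (2 * S.ouOp φ x) ^ 2 ∂μ) := by
  have := S.countable_index
  obtain ⟨hL, hcomm⟩ := S.isLinGrowthC1_ouOp hφ
  obtain ⟨hφ1, D, hD⟩ := isBddC1_of_mem_expFunctions hφ
  have hk := fun k => fderiv_apply_mem_expFunctions hφ (S.e k)
  -- The divergence identity is tested against `2𝓛₀φ` itself.
  have h1 := S.integral_mul_ouOp hmean hcov hL hφ
  have e1 : ∫ x, (2 * S.ouOp φ x) ^ 2 ∂μ
      = -∫ x, ⟪S.grad ((2 : ℝ) • S.ouOp φ) x, S.grad φ x⟫ ∂μ := by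
    rw [← h1]
    refine integral_congr_ae (ae_of_all _ fun x => ?_)
    simp [sq]
  -- In the coordinate `k` the commutation rule turns `∂ₖ(2𝓛₀φ)` into `2𝓛₀(∂ₖφ) - ∂ₖφ`; a second use
  -- of the divergence identity, now for `∂ₖφ`, makes the first term a square.
  have e2 : ∀ x k, ⟪S.grad ((2 : ℝ) • S.ouOp φ) x, S.e k⟫ * ⟪S.e k, S.grad φ x⟫
      = S.lam k * (fderiv ℝ φ x (S.e k) * (2 * S.ouOp (fun y => fderiv ℝ φ y (S.e k)) x)
        - fderiv ℝ φ x (S.e k) ^ 2) := by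
    intro x k
    rw [real_inner_comm _ (S.e k), S.inner_grad_e, S.inner_grad_e, hcomm]
    have := Real.mul_self_sqrt (S.lam_pos k).le
    linear_combination (2 * S.ouOp (fun y => fderiv ℝ φ y (S.e k)) x - fderiv ℝ φ x (S.e k))
      * fderiv ℝ φ x (S.e k) * this
  have i1 : ∀ k, Integrable (fun x => fderiv ℝ φ x (S.e k) *
      (2 * S.ouOp (fun y => fderiv ℝ φ y (S.e k)) x)) μ := fun k =>
    ((isBddC1_of_mem_expFunctions (hk k)).isLinGrowthC1.memLp_two μ).integrable_mul
      ((S.isLinGrowthC1_ouOp (hk k)).1.memLp_two μ)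
  have i2 : ∀ k, Integrable (fun x => fderiv ℝ φ x (S.e k) ^ 2) μ := fun k =>
    ((isBddC1_of_mem_expFunctions (hk k)).isLinGrowthC1.memLp_two μ).integrable_sq
  have e3 : ∀ k, ∫ x, ⟪S.grad ((2 : ℝ) • S.ouOp φ) x, S.e k⟫ * ⟪S.e k, S.grad φ x⟫ ∂μ
      = -(S.lam k * (∫ x, ‖S.grad (fun y => fderiv ℝ φ y (S.e k)) x‖ ^ 2 ∂μ
      + ∫ x, fderiv ℝ φ x (S.e k) ^ 2 ∂μ)) := by
    intro k
    simp_rw [e2]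
    rw [integral_const_mul, integral_sub (i1 k) (i2 k), S.integral_mul_ouOp hmean hcov
      (isBddC1_of_mem_expFunctions (hk k)).isLinGrowthC1 (hk k)]
    simp_rw [real_inner_self_eq_norm_sq]
    ring
  obtain ⟨hL1, C, hC⟩ := hL
  have hC0 : 0 ≤ C := by simpa using (abs_nonneg _).trans (hC 0).1
  have hD0 : 0 ≤ D := (abs_nonneg _).trans (hD 0).1
  -- The weight `λₖ` is summable and the remaining factor integrable, which justifies integrating
  -- the series term by term.
  have b1 : ∀ k x, ‖⟪S.grad ((2 : ℝ) • S.ouOp φ) x, S.e k⟫ * ⟪S.e k, S.grad φ x⟫‖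
      ≤ S.lam k * (C * D * (1 + ‖x‖)) := by
    intro k x
    rw [real_inner_comm _ (S.e k), S.inner_grad_e, S.inner_grad_e]
    have n1 : |fderiv ℝ ((2 : ℝ) • S.ouOp φ) x (S.e k)| ≤ C * (1 + ‖x‖) := by
      have := (fderiv ℝ ((2 : ℝ) • S.ouOp φ) x).le_opNorm (S.e k)
      rw [S.e.orthonormal.1 k, mul_one] at this
      exact this.trans (hC x).2
    have n2 : |fderiv ℝ φ x (S.e k)| ≤ D := by
      have := (fderiv ℝ φ x).le_opNorm (S.e k)
      rw [S.e.orthonormal.1 k, mul_one] at this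
      exact this.trans (hD x).2
    rw [mul_mul_mul_comm, Real.mul_self_sqrt (S.lam_pos k).le, norm_mul,
      Real.norm_of_nonneg (S.lam_pos k).le, norm_mul]
    refine mul_le_mul_of_nonneg_left ?_ (S.lam_pos k).le
    calc _ ≤ C * (1 + ‖x‖) * D := mul_le_mul n1 n2 (abs_nonneg _) (by positivity)
      _ = _ := by ring
  have ci : Integrable (fun x : H => C * D * (1 + ‖x‖)) μ :=
    integrable_of_linear_growth μ (by fun_prop) (C := C * D) fun x => by
      rw [abs_of_nonneg (by positivity)]
  have i3 : ∀ k, Integrable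
      (fun x => ⟪S.grad ((2 : ℝ) • S.ouOp φ) x, S.e k⟫ * ⟪S.e k, S.grad φ x⟫) μ := by
    intro k
    refine (ci.const_mul (S.lam k)).mono' ?_ (ae_of_all _ (b1 k))
    exact (((S.continuous_grad hL1).inner continuous_const).mul
      (continuous_const.inner (S.continuous_grad hφ1))).aestronglyMeasurable
  have h2 := hasSum_integral_of_summable_integral_norm i3
    (Summable.of_nonneg_of_le (fun k => integral_nonneg fun x => norm_nonneg _)
      (fun k => by
        refine (integral_mono (i3 k).norm (ci.const_mul _) (b1 k)).trans_eq ?_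
        exact integral_const_mul _ _)
      (S.summable_lam.mul_right (∫ x, C * D * (1 + ‖x‖) ∂μ)))
  simp_rw [e3, S.e.tsum_inner_mul_inner] at h2
  rw [e1]
  simpa using h2.neg

/-- In the energy identity the terms `λₖ ∫ |Q^{1/2}D∂ₖφ|²` add up to the Hilbert–Schmidt norm of the
Hessian; the first-order terms are nonnegative and are dropped. -/
theorem lintegral_hess_le (S : CovEigenbasis ι Q) {μ : Measure H} [IsGaussian μ]
    (hmean : ∫ x, x ∂μ = 0) (hcov : ∀ x y : H, covarianceBilin μ x y = ⟪Q x, y⟫)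
    {φ : H → ℝ} (hφ : φ ∈ expFunctions H) :
    ∫⁻ x, ∑' k, ‖S.hess φ x (S.e k)‖ₑ ^ 2 ∂μ ≤ eLpNorm ((2 : ℝ) • S.ouOp φ) 2 μ ^ 2 := by
  have := S.countable_index
  have h := S.hasSum_integral_ouOp_sq hmean hcov hφ
  have hk := fun k => fderiv_apply_mem_expFunctions hφ (S.e k)
  rw [eLpNorm_two_sq, lintegral_enorm_sq_eq_ofReal ((S.isLinGrowthC1_ouOp hφ).1.memLp_two μ)]
  have e0 : ∫ x, ‖((2 : ℝ) • S.ouOp φ) x‖ ^ 2 ∂μ = ∫ x, (2 * S.ouOp φ x) ^ 2 ∂μ := by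
    refine integral_congr_ae (ae_of_all _ fun x => ?_)
    simp only [Real.norm_eq_abs, sq_abs, Pi.smul_apply, smul_eq_mul]
  have hc := S.continuous_hess (contDiff_of_mem_expFunctions hφ)
  rw [lintegral_tsum fun k => ((hc.clm_apply continuous_const).measurable.enorm.pow_const
    2).aemeasurable, e0,
    ← h.tsum_eq, ENNReal.ofReal_tsum_of_nonneg (fun k => mul_nonneg (S.lam_pos k).le (by positivity))
      h.summable]
  refine ENNReal.tsum_le_tsum fun k => ?_
  have e1 : ∀ x, ‖S.hess φ x (S.e k)‖ₑ ^ 2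
      = ENNReal.ofReal (S.lam k) * ‖S.grad (fun y => fderiv ℝ φ y (S.e k)) x‖ₑ ^ 2 := by
    intro x
    rw [← ofReal_norm, ← ENNReal.ofReal_pow (norm_nonneg _), S.norm_hess_apply_e_sq hφ,
      ENNReal.ofReal_mul (S.lam_pos k).le, ENNReal.ofReal_pow (norm_nonneg _), ofReal_norm]
  simp_rw [e1]
  rw [lintegral_const_mul' _ _ ENNReal.ofReal_ne_top, lintegral_enorm_sq_eq_ofReal
    (S.memLp_grad μ (isBddC1_of_mem_expFunctions (hk k)) 2),
    ← ENNReal.ofReal_mul (S.lam_pos k).le]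
  refine ENNReal.ofReal_le_ofReal (mul_le_mul_of_nonneg_left ?_ (S.lam_pos k).le)
  exact le_add_of_nonneg_right (by positivity)

/-- The other half of the energy identity: the terms `λₖ ∫ (∂ₖφ)²` add up to the norm of the
gradient, and the second-order ones are dropped. -/
theorem eLpNorm_grad_le (S : CovEigenbasis ι Q) {μ : Measure H} [IsGaussian μ]
    (hmean : ∫ x, x ∂μ = 0) (hcov : ∀ x y : H, covarianceBilin μ x y = ⟪Q x, y⟫)
    {φ : H → ℝ} (hφ : φ ∈ expFunctions H) :
    eLpNorm (S.grad φ) 2 μ ≤ eLpNorm ((2 : ℝ) • S.ouOp φ) 2 μ := by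
  have := S.countable_index
  have h := S.hasSum_integral_ouOp_sq hmean hcov hφ
  have hk := fun k => fderiv_apply_mem_expFunctions hφ (S.e k)
  refine (ENNReal.pow_le_pow_left_iff two_ne_zero).1 ?_
  rw [eLpNorm_two_sq, eLpNorm_two_sq,
    lintegral_enorm_sq_eq_ofReal ((S.isLinGrowthC1_ouOp hφ).1.memLp_two μ)]
  have e0 : ∫ x, ‖((2 : ℝ) • S.ouOp φ) x‖ ^ 2 ∂μ = ∫ x, (2 * S.ouOp φ x) ^ 2 ∂μ := by
    refine integral_congr_ae (ae_of_all _ fun x => ?_)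
    simp only [Real.norm_eq_abs, sq_abs, Pi.smul_apply, smul_eq_mul]
  have e1 : ∀ x, ‖S.grad φ x‖ₑ ^ 2
      = ∑' k, ENNReal.ofReal (S.lam k * fderiv ℝ φ x (S.e k) ^ 2) := by
    intro x
    have h3 := S.e.hasSum_inner_sq (S.grad φ x)
    simp_rw [S.inner_grad_e, mul_pow, Real.sq_sqrt (S.lam_pos _).le] at h3
    rw [← ENNReal.ofReal_tsum_of_nonneg (fun k => mul_nonneg (S.lam_pos k).le (by positivity))
      h3.summable, h3.tsum_eq, ENNReal.ofReal_pow (norm_nonneg _), ofReal_norm]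
  simp_rw [e1]
  rw [lintegral_tsum fun k => by
    have := ((hk k) |> contDiff_of_mem_expFunctions).continuous
    exact (ENNReal.continuous_ofReal.comp
      (continuous_const.mul (this.pow 2))).measurable.aemeasurable, e0,
    ← h.tsum_eq, ENNReal.ofReal_tsum_of_nonneg (fun k => mul_nonneg (S.lam_pos k).le (by positivity))
      h.summable]
  refine ENNReal.tsum_le_tsum fun k => ?_
  have i2 : Integrable (fun x => S.lam k * fderiv ℝ φ x (S.e k) ^ 2) μ :=
    ((isBddC1_of_mem_expFunctions (hk k)).isLinGrowthC1.memLp_two μ).integrable_sq.const_mul _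
  rw [← ofReal_integral_eq_lintegral_ofReal i2
    (ae_of_all _ fun x => mul_nonneg (S.lam_pos k).le (by positivity)), integral_const_mul]
  refine ENNReal.ofReal_le_ofReal (mul_le_mul_of_nonneg_left ?_ (S.lam_pos k).le)
  exact le_add_of_nonneg_left (by positivity)

end CovEigenbasis

end GaussSobolev

/-! ### Closability of the gradient, and the inclusion of `D(L₀)` in `W^{2,2}_0`. -/

namespace GaussSobolev

variable {H : Type*} [NormedAddCommGroup H] [InnerProductSpace ℝ H]

theorem IsBddC1.mul {f g : H → ℝ} (hf : IsBddC1 f) (hg : IsBddC1 g) :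
    IsBddC1 fun x => f x * g x := by
  obtain ⟨h, C, hC⟩ := hf
  obtain ⟨h', C', hC'⟩ := hg
  have hC0 : 0 ≤ C := (abs_nonneg _).trans (hC 0).1
  have hC0' : 0 ≤ C' := (abs_nonneg _).trans (hC' 0).1
  refine ⟨h.mul h', 2 * (C * C'), fun x => ⟨?_, ?_⟩⟩
  · rw [abs_mul]
    have := mul_le_mul (hC x).1 (hC' x).1 (abs_nonneg _) hC0
    nlinarith [mul_nonneg hC0 hC0']
  · rw [fderiv_fun_mul (h.differentiable one_ne_zero x) (h'.differentiable one_ne_zero x)]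
    refine (norm_add_le _ _).trans ?_
    rw [norm_smul, norm_smul, Real.norm_eq_abs, Real.norm_eq_abs]
    have h1 := mul_le_mul (hC x).1 (hC' x).2 (norm_nonneg _) hC0
    have h2 := mul_le_mul (hC' x).1 (hC x).2 (norm_nonneg _) hC0'
    linarith

variable [CompleteSpace H] [SecondCountableTopology H] [MeasurableSpace H] [BorelSpace H]

/-- An integrable function all of whose trigonometric moments vanish is zero. -/
theorem ae_eq_zero_of_integral_cos {μ : Measure H} [IsFiniteMeasure μ] {Z : H → ℝ}
    (hZ : Integrable Z μ) (h : ∀ (y : H) (c : ℝ), ∫ x, Z x * Real.cos (⟪x, y⟫ + c) ∂μ = 0) :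
    Z =ᵐ[μ] 0 := by
  have hfin : ∀ W : H → ℝ, Integrable W μ →
      IsFiniteMeasure (μ.withDensity fun x => ENNReal.ofReal (W x)) :=
    fun W hW => isFiniteMeasure_withDensity_ofReal hW.2
  have f1 := hfin Z hZ
  have f2 := hfin (-Z) hZ.neg
  have hm := hZ.aestronglyMeasurable.aemeasurable
  have hch : ∀ (W : H → ℝ), Integrable W μ → ∀ y : H,
      charFun (μ.withDensity fun x => ENNReal.ofReal (W x)) y
        = ∫ x, ((max (W x) 0 : ℝ) : ℂ) * Complex.exp (⟪x, y⟫ * Complex.I) ∂μ := by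
    intro W hW y
    rw [charFun_apply, integral_withDensity_eq_integral_toReal_smul₀
      hW.aestronglyMeasurable.aemeasurable.ennreal_ofReal
      (ae_of_all _ fun _ => ENNReal.ofReal_lt_top)]
    refine integral_congr_ae (ae_of_all _ fun x => ?_)
    simp [ENNReal.toReal_ofReal']
  have hexp : ∀ (W : H → ℝ), Integrable W μ → ∀ y : H,
      Integrable (fun x => (W x : ℂ) * Complex.exp (⟪x, y⟫ * Complex.I)) μ := by
    intro W hW y
    refine hW.ofReal.mul_bdd (c := 1) (by fun_prop) (ae_of_all _ fun x => ?_)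
    rw [Complex.norm_exp_ofReal_mul_I]
  -- The phases `0` and `-π/2` give the real and the imaginary part of the Fourier transform of `Z
  -- μ`.
  have hex0 : ∀ y : H, ∫ x, (Z x : ℂ) * Complex.exp (⟪x, y⟫ * Complex.I) ∂μ = 0 := by
    intro y
    apply Complex.ext
    · have := integral_re (𝕜 := ℂ) (hexp Z hZ y)
      simp only [RCLike.re_eq_complex_re] at this
      rw [← this, Complex.zero_re, ← h y 0]
      refine integral_congr_ae (ae_of_all _ fun x => ?_)
      simp [Complex.exp_ofReal_mul_I_re]
    · have := integral_im (𝕜 := ℂ) (hexp Z hZ y)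
      simp only [RCLike.im_eq_complex_im] at this
      rw [← this, Complex.zero_im, ← h y (-(Real.pi / 2))]
      refine integral_congr_ae (ae_of_all _ fun x => ?_)
      simp [Complex.exp_ofReal_mul_I_im, ← sub_eq_add_neg, Real.cos_sub_pi_div_two]
  -- `ENNReal.ofReal` keeps the positive part. A vanishing Fourier transform of `Z μ` means that `Z⁺
  -- μ` and `Z⁻ μ` are finite measures with the same characteristic function.
  have heq : μ.withDensity (fun x => ENNReal.ofReal (Z x))
      = μ.withDensity (fun x => ENNReal.ofReal ((-Z) x)) := by
    refine Measure.ext_of_charFun ?_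
    ext y
    rw [hch Z hZ, hch _ hZ.neg, ← sub_eq_zero, ← integral_sub (hexp _ hZ.pos_part y)
      (hexp _ hZ.neg.pos_part y), ← hex0 y]
    refine integral_congr_ae (ae_of_all _ fun x => ?_)
    simp only [Pi.neg_apply]
    rw [← sub_mul, ← Complex.ofReal_sub]
    congr 2
    rcases le_total (Z x) 0 with h | h
    · rw [max_eq_right h, max_eq_left (by linarith)]; ring
    · rw [max_eq_left h, max_eq_right (by linarith)]; ring
  rw [withDensity_eq_iff hm.ennreal_ofReal hm.neg.ennreal_ofReal] at heq
  · filter_upwards [heq] with x hx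
    simp only [Pi.neg_apply, Pi.zero_apply] at hx ⊢
    rcases lt_trichotomy (Z x) 0 with h | h | h
    · rw [ENNReal.ofReal_of_nonpos h.le, eq_comm, ENNReal.ofReal_eq_zero] at hx
      linarith
    · exact h
    · rw [ENNReal.ofReal_of_nonpos (p := -Z x) (by linarith), ENNReal.ofReal_eq_zero] at hx
      linarith
  · exact (lt_of_le_of_lt (lintegral_mono fun x => by
      rw [← ofReal_norm]
      exact ENNReal.ofReal_le_ofReal (le_abs_self _)) hZ.2).ne

namespace CovEigenbasis

variable {ι : Type*} {Q : H →L[ℝ] H}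

theorem integral_fderiv_apply_Q_of_isLinGrowthC1 (S : CovEigenbasis ι Q) {μ : Measure H}
    [IsGaussian μ] (hmean : ∫ x, x ∂μ = 0) (hcov : ∀ x y : H, covarianceBilin μ x y = ⟪Q x, y⟫)
    (h : H) {f : H → ℝ} (hf : IsLinGrowthC1 f) :
    ∫ x, fderiv ℝ f x (Q h) ∂μ = ∫ x, f x * ⟪x, h⟫ ∂μ := by
  obtain ⟨hC, C, hb⟩ := hf
  refine S.integral_fderiv_apply_Q hmean hcov h (hC.differentiable one_ne_zero)
    (integrable_of_linear_growth μ hC.continuous fun x => (hb x).1)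
    (integrable_of_linear_growth μ
      ((hC.continuous_fderiv one_ne_zero).clm_apply continuous_const) (C := C * ‖Q h‖) fun x => ?_)
    (integrable_mul_of_linear_growth μ hC.continuous (by fun_prop) (fun x => (hb x).1)
      (D := ‖h‖) fun x => ?_)
  · refine ((fderiv ℝ f x).le_opNorm (Q h)).trans ?_
    rw [mul_right_comm]
    exact mul_le_mul_of_nonneg_right (hb x).2 (norm_nonneg _)
  · refine (abs_real_inner_le_norm _ _).trans ?_
    nlinarith [norm_nonneg h, norm_nonneg x]

/-- Closability in `L²` of the derivatives `⟪Q^{1/2} D ·, eₖ⟫` on `𝓔₀(H)`. -/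
theorem ae_eq_zero_of_tendsto_inner_grad (S : CovEigenbasis ι Q) {μ : Measure H} [IsGaussian μ]
    (hmean : ∫ x, x ∂μ = 0) (hcov : ∀ x y : H, covarianceBilin μ x y = ⟪Q x, y⟫)
    {u : ℕ → H → ℝ} (hu : ∀ n, u n ∈ expFunctions H) (k : ι)
    {Z : H → ℝ} (hZ : MemLp Z 2 μ)
    (h0 : Tendsto (fun n => eLpNorm (u n) 2 μ) atTop (𝓝 0))
    (h1 : Tendsto (fun n => eLpNorm (fun x => ⟪S.grad (u n) x, S.e k⟫ - Z x) 2 μ) atTop (𝓝 0)) :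
    Z =ᵐ[μ] 0 := by
  refine ae_eq_zero_of_integral_cos (hZ.integrable one_le_two) fun y c => ?_
  set f : H → ℝ := fun x => Real.cos (⟪x, y⟫ + c) with hfdef
  have hf : f ∈ expFunctions H := cos_add_mem_expFunctions y c
  have hfb := isBddC1_of_mem_expFunctions hf
  have hub := fun n => isBddC1_of_mem_expFunctions (hu n)
  have hu2 := fun n => (hub n).isLinGrowthC1.memLp_two μ
  have hf2 := hfb.isLinGrowthC1.memLp_two μ
  have hg2 : ∀ n, MemLp (fun x => ⟪S.grad (u n) x, S.e k⟫) 2 μ :=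
    fun n => (S.memLp_grad μ (hub n) 2).inner_const (S.e k)
  have hDf := (isBddC1_of_mem_expFunctions
    (fderiv_apply_mem_expFunctions hf (S.e k))).isLinGrowthC1.memLp_two μ
  have hfx : MemLp (fun x => f x * ⟪x, S.e k⟫) 2 μ := by
    have hi : MemLp (fun x : H => ⟪x, S.e k⟫) 2 μ :=
      (IsGaussian.memLp_two_id (μ := μ)).inner_const (S.e k)
    refine hi.mono (hf2.1.mul hi.1) (ae_of_all _ fun x => ?_)
    rw [norm_mul]
    exact mul_le_of_le_one_left (norm_nonneg _) (Real.abs_cos_le_one _)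
  have t1 := tendsto_integral_mul_of_tendsto_eLpNorm_two hg2 hZ hf2 h1
  have t2 := tendsto_integral_mul_of_tendsto_eLpNorm_two hu2 (MemLp.zero (μ := μ) (p := 2))
    (hfx.sub (hDf.const_mul (S.lam k))) (by simpa using h0)
  -- The derivative is moved from `u n` to the cosine. The new factor is in `L²`, so the right side
  -- vanishes in the limit with `u n`, while the left side tends to `√λₖ ∫ Z f`.
  have key : ∀ n, √(S.lam k) * ∫ x, ⟪S.grad (u n) x, S.e k⟫ * f x ∂μ
      = ∫ x, u n x * (f x * ⟪x, S.e k⟫ - S.lam k * fderiv ℝ f x (S.e k)) ∂μ := by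
    intro n
    have h3 := S.integral_fderiv_apply_Q_of_isLinGrowthC1 hmean hcov (S.e k)
      ((hub n).mul hfb).isLinGrowthC1
    have e1 : ∀ x, fderiv ℝ (fun x => u n x * f x) x (Q (S.e k))
        = √(S.lam k) * (⟪S.grad (u n) x, S.e k⟫ * f x)
          + u n x * (S.lam k * fderiv ℝ f x (S.e k)) := by
      intro x
      rw [fderiv_fun_mul (differentiable_of_mem_expFunctions (hu n) x)
        (differentiable_of_mem_expFunctions hf x), S.inner_grad_e, S.apply_e]
      simp only [add_apply, smul_apply, map_smul, smul_eq_mul]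
      linear_combination (-(fderiv ℝ (u n) x (S.e k)) * f x) * Real.mul_self_sqrt (S.lam_pos k).le
    have i1 : Integrable (fun x => ⟪S.grad (u n) x, S.e k⟫ * f x) μ := (hg2 n).integrable_mul hf2
    have i2 : Integrable (fun x => u n x * (S.lam k * fderiv ℝ f x (S.e k))) μ :=
      (hu2 n).integrable_mul (hDf.const_mul _)
    have i3 : Integrable (fun x => u n x * (f x * ⟪x, S.e k⟫)) μ := (hu2 n).integrable_mul hfx
    simp_rw [e1] at h3
    rw [integral_add (i1.const_mul _) i2, integral_const_mul] at h3
    simp_rw [mul_sub]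
    rw [integral_sub i3 i2]
    simp_rw [← mul_assoc (u n _)] at h3 ⊢
    linarith
  have t3 := t1.const_mul √(S.lam k)
  simp_rw [key] at t3
  have h4 := tendsto_nhds_unique t3 t2
  simp only [Pi.zero_apply, zero_mul, integral_zero, mul_eq_zero] at h4
  exact h4.resolve_left (Real.sqrt_pos.2 (S.lam_pos k)).ne'

theorem memLp_hess (S : CovEigenbasis ι Q) {μ : Measure H} [IsGaussian μ]
    (hmean : ∫ x, x ∂μ = 0) (hcov : ∀ x y : H, covarianceBilin μ x y = ⟪Q x, y⟫)
    {φ : H → ℝ} (hφ : φ ∈ expFunctions H) : MemLp (S.hess φ) 2 μ := by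
  refine ⟨(S.continuous_hess (contDiff_of_mem_expFunctions hφ)).aestronglyMeasurable, ?_⟩
  have h1 := (eLpNorm_two_sq_le_lintegral_tsum S.e μ (S.hess φ)).trans (S.lintegral_hess_le hmean hcov hφ)
  exact ((ENNReal.pow_le_pow_left_iff two_ne_zero).1 h1).trans_lt
    ((S.isLinGrowthC1_ouOp hφ).1.memLp_two μ).2

/-- `IsSobolevHess` asks only measurability of `T`; square integrability follows since `T` is at
finite distance from a smooth Hessian. -/
theorem memLp_of_tendsto_eLpNorm_hess (S : CovEigenbasis ι Q) {μ : Measure H} [IsGaussian μ]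
    (hmean : ∫ x, x ∂μ = 0) (hcov : ∀ x y : H, covarianceBilin μ x y = ⟪Q x, y⟫)
    {φ : ℕ → H → ℝ} (hφ : ∀ n, φ n ∈ expFunctions H) {T : H → H →L[ℝ] H}
    (hT : AEStronglyMeasurable T μ)
    (h : Tendsto (fun n => eLpNorm (fun x => S.hess (φ n) x - T x) 2 μ) atTop (𝓝 0)) :
    MemLp T 2 μ := by
  obtain ⟨n, hn⟩ := (h.eventually (gt_mem_nhds ENNReal.zero_lt_top)).exists
  have h1 : MemLp (fun x => S.hess (φ n) x - T x) 2 μ :=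
    ⟨(S.memLp_hess hmean hcov (hφ n)).1.sub hT, hn⟩
  have h2 := (S.memLp_hess hmean hcov (hφ n)).sub h1
  refine h2.ae_eq (ae_of_all _ fun x => ?_)
  simp

theorem tendsto_eLpNorm_hess (S : CovEigenbasis ι Q) {μ : Measure H} {φ : ℕ → H → ℝ}
    {T : H → H →L[ℝ] H}
    (h : Tendsto (fun n => ∫⁻ x, ∑' k, ‖(S.hess (φ n) x - T x) (S.e k)‖ₑ ^ 2 ∂μ) atTop (𝓝 0)) :
    Tendsto (fun n => eLpNorm (fun x => S.hess (φ n) x - T x) 2 μ) atTop (𝓝 0) :=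
  ennreal_tendsto_zero_of_sq (tendsto_of_tendsto_of_tendsto_of_le_of_le tendsto_const_nhds h
    (fun _ => zero_le) fun n => eLpNorm_two_sq_le_lintegral_tsum S.e μ fun x => S.hess (φ n) x - T x)

section Domain

variable {μ : Measure H} {φ : ℕ → H → ℝ} {l : H → ℝ}

/-- The Cauchy property of `𝓛₀ φₙ`, written for the differences `φₙ - φₘ`, to which the two energy
bounds apply. -/
theorem tendsto_eLpNorm_two_smul_ouOp_sub (S : CovEigenbasis ι Q)
    (hφ : ∀ n, φ n ∈ expFunctions H) (hl : MemLp l 2 μ)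
    (h : Tendsto (fun n => eLpNorm (fun x => S.ouOp (φ n) x - l x) 2 μ) atTop (𝓝 0)) :
    Tendsto (fun q : ℕ × ℕ => eLpNorm ((2 : ℝ) • S.ouOp (φ q.1 - φ q.2)) 2 μ) atTop (𝓝 0) := by
  have hm : ∀ n, AEStronglyMeasurable (S.ouOp (φ n)) μ := fun n => by
    have := ((S.isLinGrowthC1_ouOp (hφ n)).1.1.continuous.aestronglyMeasurable
      (μ := μ)).const_smul (2⁻¹ : ℝ)
    simpa [smul_smul] using this
  have h1 := tendsto_eLpNorm_sub_sub one_le_two hm hm hl.1 hl.1 h h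
  have h2 : Tendsto (fun q : ℕ × ℕ => ‖(2 : ℝ)‖ₑ * eLpNorm (fun x =>
      (S.ouOp (φ q.1) x - S.ouOp (φ q.2) x) - (l x - l x)) 2 μ) atTop (𝓝 0) := by
    simpa using ENNReal.Tendsto.const_mul h1 (Or.inr (by simp : ‖(2 : ℝ)‖ₑ ≠ ⊤))
  refine h2.congr fun q => ?_
  rw [eLpNorm_const_smul, S.ouOp_sub (contDiff_of_mem_expFunctions (hφ _))
    (contDiff_of_mem_expFunctions (hφ _))]
  congr 2
  ext x
  simp

/-- `D(L₀) ⊂ W^{1,2}_0`. -/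
theorem exists_tendsto_grad (S : CovEigenbasis ι Q) [IsGaussian μ]
    (hmean : ∫ x, x ∂μ = 0) (hcov : ∀ x y : H, covarianceBilin μ x y = ⟪Q x, y⟫)
    (hφ : ∀ n, φ n ∈ expFunctions H) (hl : MemLp l 2 μ)
    (h : Tendsto (fun n => eLpNorm (fun x => S.ouOp (φ n) x - l x) 2 μ) atTop (𝓝 0)) :
    ∃ F, MemLp F 2 μ ∧
      Tendsto (fun n => eLpNorm (fun x => S.grad (φ n) x - F x) 2 μ) atTop (𝓝 0) := by
  refine exists_memLp_tendsto_of_cauchy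
    (fun n => S.memLp_grad μ (isBddC1_of_mem_expFunctions (hφ n)) 2) ?_
  refine tendsto_of_tendsto_of_tendsto_of_le_of_le tendsto_const_nhds
    (S.tendsto_eLpNorm_two_smul_ouOp_sub hφ hl h) (fun _ => zero_le) fun q => ?_
  have := S.eLpNorm_grad_le hmean hcov (sub_mem (hφ q.1) (hφ q.2))
  rwa [S.grad_sub (differentiable_of_mem_expFunctions (hφ _))
    (differentiable_of_mem_expFunctions (hφ _))] at this

/-- `D(L₀) ⊂ W^{2,2}_0`. -/
theorem exists_tendsto_hess (S : CovEigenbasis ι Q) [IsGaussian μ]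
    (hmean : ∫ x, x ∂μ = 0) (hcov : ∀ x y : H, covarianceBilin μ x y = ⟪Q x, y⟫)
    (hφ : ∀ n, φ n ∈ expFunctions H) (hl : MemLp l 2 μ)
    (h : Tendsto (fun n => eLpNorm (fun x => S.ouOp (φ n) x - l x) 2 μ) atTop (𝓝 0)) :
    ∃ T : H → H →L[ℝ] H, AEStronglyMeasurable T μ ∧
      Tendsto (fun n => ∫⁻ x, ∑' k, ‖(S.hess (φ n) x - T x) (S.e k)‖ₑ ^ 2 ∂μ) atTop (𝓝 0) := by
  have := S.countable_index
  have hc : Tendsto (fun q : ℕ × ℕ => ∫⁻ x, ∑' k,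
      ‖(S.hess (φ q.1) x - S.hess (φ q.2) x) (S.e k)‖ₑ ^ 2 ∂μ) atTop (𝓝 0) := by
    have h1 := ENNReal.Tendsto.pow (n := 2) (S.tendsto_eLpNorm_two_smul_ouOp_sub hφ hl h)
    rw [zero_pow two_ne_zero] at h1
    refine tendsto_of_tendsto_of_tendsto_of_le_of_le tendsto_const_nhds h1
      (fun _ => zero_le) fun q => ?_
    have := S.lintegral_hess_le hmean hcov (sub_mem (hφ q.1) (hφ q.2))
    rwa [S.hess_sub (contDiff_of_mem_expFunctions (hφ _))
      (contDiff_of_mem_expFunctions (hφ _))] at this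
  -- The limit is found first in the weaker operator norm. Fatou's lemma along an a.e. convergent
  -- subsequence then upgrades the convergence to the Hilbert–Schmidt norm.
  obtain ⟨T, hT, hlim⟩ := exists_memLp_tendsto_of_cauchy
    (fun n => S.memLp_hess hmean hcov (hφ n)) (ennreal_tendsto_zero_of_sq
    (tendsto_of_tendsto_of_tendsto_of_le_of_le tendsto_const_nhds hc
    (fun _ => zero_le) fun q => eLpNorm_two_sq_le_lintegral_tsum S.e μ
      fun x => S.hess (φ q.1) x - S.hess (φ q.2) x))
  refine ⟨T, hT.1, ?_⟩
  obtain ⟨ns, hns, hae⟩ := (tendstoInMeasure_of_tendsto_eLpNorm two_ne_zero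
    (fun n => (S.memLp_hess hmean hcov (hφ n)).1) hT.1 hlim).exists_seq_tendsto_ae
  have hmeas : ∀ n m k, Measurable fun x => ‖(S.hess (φ n) x - S.hess (φ m) x) (S.e k)‖ₑ ^ 2 :=
    fun n m k => (((S.continuous_hess (contDiff_of_mem_expFunctions (hφ n))).sub
      (S.continuous_hess (contDiff_of_mem_expFunctions (hφ m)))).clm_apply
        continuous_const).measurable.enorm.pow_const 2
  have hmT : ∀ n k, AEMeasurable (fun x => ‖(S.hess (φ n) x - T x) (S.e k)‖ₑ ^ 2) μ := by
    intro n k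
    have := ((S.memLp_hess hmean hcov (hφ n)).1.sub hT.1).apply_continuousLinearMap (S.e k)
    exact this.enorm.pow_const 2
  rw [ENNReal.tendsto_nhds_zero] at hc ⊢
  intro ε hε
  obtain ⟨N, hN⟩ := eventually_atTop.1 (hc ε hε)
  refine eventually_atTop.2 ⟨N.1, fun n hn => ?_⟩
  -- Only finite partial sums of the Hilbert–Schmidt series are continuous for the operator norm, so
  -- the bound is proved for each of them, uniformly.
  rw [lintegral_tsum (hmT n), ENNReal.tsum_eq_iSup_sum]
  refine iSup_le fun s => ?_
  rw [← lintegral_finsetSum' _ fun k _ => hmT n k]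
  have e1 : ∀ᵐ x ∂μ, ∑ k ∈ s, ‖(S.hess (φ n) x - T x) (S.e k)‖ₑ ^ 2
      = liminf (fun j => ∑ k ∈ s, ‖(S.hess (φ n) x - S.hess (φ (ns j)) x) (S.e k)‖ₑ ^ 2) atTop := by
    filter_upwards [hae] with x hx
    refine (Tendsto.liminf_eq ?_).symm
    refine tendsto_finsetSum _ fun k _ => ?_
    have h1 : Tendsto (fun j => (S.hess (φ n) x - S.hess (φ (ns j)) x) (S.e k)) atTop
        (𝓝 ((S.hess (φ n) x - T x) (S.e k))) :=
      ((ContinuousLinearMap.apply ℝ H (S.e k)).continuous.tendsto _).comp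
        (tendsto_const_nhds.sub hx)
    exact ENNReal.Tendsto.pow h1.enorm
  rw [lintegral_congr_ae e1]
  refine (lintegral_liminf_le fun j => Finset.measurable_fun_sum _ fun k _ =>
    hmeas n (ns j) k).trans ?_
  refine (liminf_le_liminf (v := fun _ => ε) ?_).trans_eq (liminf_const _)
  filter_upwards [hns.tendsto_atTop.eventually_ge_atTop N.2] with j hj
  refine (lintegral_mono fun x => ?_).trans (hN (n, ns j) ⟨hn, hj⟩)
  exact ENNReal.sum_le_tsum s

end Domain

end CovEigenbasis

end GaussSobolev

/-! ### Uniqueness of weak derivatives, and a common approximating sequence. -/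

namespace GaussSobolev

theorem tendsto_eLpNorm_congr_limit {Ω E : Type*} [MeasurableSpace Ω] [NormedAddCommGroup E]
    {μ : Measure Ω} {f : ℕ → Ω → E} {F G : Ω → E} {p : ℝ≥0∞} (hFG : F =ᵐ[μ] G)
    (h : Tendsto (fun n => eLpNorm (fun x => f n x - F x) p μ) atTop (𝓝 0)) :
    Tendsto (fun n => eLpNorm (fun x => f n x - G x) p μ) atTop (𝓝 0) := by
  refine h.congr fun n => eLpNorm_congr_ae ?_
  filter_upwards [hFG] with x hx
  rw [hx]

theorem tendsto_eLpNorm_of_norm_le {Ω E F : Type*} [MeasurableSpace Ω] [NormedAddCommGroup E]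
    [NormedAddCommGroup F] {μ : Measure Ω} {f : ℕ → Ω → E} {g : ℕ → Ω → F} {p : ℝ≥0∞}
    (hfg : ∀ n x, ‖g n x‖ ≤ ‖f n x‖)
    (h : Tendsto (fun n => eLpNorm (f n) p μ) atTop (𝓝 0)) :
    Tendsto (fun n => eLpNorm (g n) p μ) atTop (𝓝 0) :=
  tendsto_of_tendsto_of_tendsto_of_le_of_le tendsto_const_nhds h (fun _ => zero_le)
    fun n => eLpNorm_mono (hfg n)

variable {H : Type*} [NormedAddCommGroup H] [InnerProductSpace ℝ H] [CompleteSpace H]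
  [SecondCountableTopology H] [MeasurableSpace H] [BorelSpace H]

namespace CovEigenbasis

variable {ι : Type*} {Q : H →L[ℝ] H} {μ : Measure H} [IsGaussian μ]

/-- Closability of `Q^{1/2} D` on `𝓔₀(H)` in `L²`. -/
theorem ae_eq_of_tendsto_grad (S : CovEigenbasis ι Q) (hmean : ∫ x, x ∂μ = 0)
    (hcov : ∀ x y : H, covarianceBilin μ x y = ⟪Q x, y⟫) {φ ψ : ℕ → H → ℝ}
    (hφ : ∀ n, φ n ∈ expFunctions H) (hψ : ∀ n, ψ n ∈ expFunctions H) {g : H → ℝ}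
    (hg : MemLp g 2 μ) {F G : H → H} (hF : MemLp F 2 μ) (hG : MemLp G 2 μ)
    (h1 : Tendsto (fun n => eLpNorm (fun x => φ n x - g x) 2 μ) atTop (𝓝 0))
    (h2 : Tendsto (fun n => eLpNorm (fun x => ψ n x - g x) 2 μ) atTop (𝓝 0))
    (h3 : Tendsto (fun n => eLpNorm (fun x => S.grad (φ n) x - F x) 2 μ) atTop (𝓝 0))
    (h4 : Tendsto (fun n => eLpNorm (fun x => S.grad (ψ n) x - G x) 2 μ) atTop (𝓝 0)) :
    F =ᵐ[μ] G := by
  have := S.countable_index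
  have m1 : ∀ {φ : ℕ → H → ℝ}, (∀ n, φ n ∈ expFunctions H) → ∀ n,
      AEStronglyMeasurable (φ n) μ := fun hφ n =>
    (contDiff_of_mem_expFunctions (hφ n)).continuous.aestronglyMeasurable
  have m2 : ∀ {φ : ℕ → H → ℝ}, (∀ n, φ n ∈ expFunctions H) → ∀ n,
      AEStronglyMeasurable (S.grad (φ n)) μ := fun hφ n =>
    (S.memLp_grad μ (isBddC1_of_mem_expFunctions (hφ n)) 2).1
  have t1 := (tendsto_eLpNorm_sub_sub one_le_two (m1 hφ) (m1 hψ) hg.1 hg.1 h1 h2).comp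
    tendsto_atTop_diagonal
  have t2 := (tendsto_eLpNorm_sub_sub one_le_two (m2 hφ) (m2 hψ) hF.1 hG.1 h3 h4).comp
    tendsto_atTop_diagonal
  have key : ∀ k, (fun x => ⟪F x - G x, S.e k⟫) =ᵐ[μ] 0 := by
    intro k
    refine S.ae_eq_zero_of_tendsto_inner_grad hmean hcov (u := fun n => φ n - ψ n)
      (fun n => sub_mem (hφ n) (hψ n)) k ((hF.sub hG).inner_const (S.e k)) ?_ ?_
    · refine t1.congr fun n => ?_
      simp only [Function.comp_apply, sub_self, sub_zero]
      rfl
    · refine tendsto_eLpNorm_of_norm_le (fun n x => ?_) t2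
      rw [S.grad_sub (differentiable_of_mem_expFunctions (hφ _))
        (differentiable_of_mem_expFunctions (hψ _)), ← inner_sub_left]
      refine (norm_inner_le_norm _ _).trans ?_
      rw [S.e.orthonormal.1 k, mul_one]
      rfl
  filter_upwards [ae_all_iff.2 key] with x hx
  rw [← sub_eq_zero]
  apply S.e.repr.injective
  ext k
  rw [S.e.repr_apply_apply, real_inner_comm]
  simpa using hx k

/-- Closability of the second derivative on `𝓔₀(H)` in `L²`. -/
theorem ae_eq_of_tendsto_hess (S : CovEigenbasis ι Q) (hmean : ∫ x, x ∂μ = 0)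
    (hcov : ∀ x y : H, covarianceBilin μ x y = ⟪Q x, y⟫) {φ ψ : ℕ → H → ℝ}
    (hφ : ∀ n, φ n ∈ expFunctions H) (hψ : ∀ n, ψ n ∈ expFunctions H) {F : H → H}
    (hF : MemLp F 2 μ) {T U : H → H →L[ℝ] H} (hT : MemLp T 2 μ) (hU : MemLp U 2 μ)
    (h1 : Tendsto (fun n => eLpNorm (fun x => S.grad (φ n) x - F x) 2 μ) atTop (𝓝 0))
    (h2 : Tendsto (fun n => eLpNorm (fun x => S.grad (ψ n) x - F x) 2 μ) atTop (𝓝 0))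
    (h3 : Tendsto (fun n => eLpNorm (fun x => S.hess (φ n) x - T x) 2 μ) atTop (𝓝 0))
    (h4 : Tendsto (fun n => eLpNorm (fun x => S.hess (ψ n) x - U x) 2 μ) atTop (𝓝 0)) :
    T =ᵐ[μ] U := by
  have := S.countable_index
  have m1 : ∀ {φ : ℕ → H → ℝ}, (∀ n, φ n ∈ expFunctions H) → ∀ n,
      AEStronglyMeasurable (S.hess (φ n)) μ := fun hφ n => (S.memLp_hess hmean hcov (hφ n)).1
  have m2 : ∀ {φ : ℕ → H → ℝ}, (∀ n, φ n ∈ expFunctions H) → ∀ n,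
      AEStronglyMeasurable (S.grad (φ n)) μ := fun hφ n =>
    (S.memLp_grad μ (isBddC1_of_mem_expFunctions (hφ n)) 2).1
  have t1 := (tendsto_eLpNorm_sub_sub one_le_two (m2 hφ) (m2 hψ) hF.1 hF.1 h1 h2).comp
    tendsto_atTop_diagonal
  have t2 := (tendsto_eLpNorm_sub_sub one_le_two (m1 hφ) (m1 hψ) hT.1 hU.1 h3 h4).comp
    tendsto_atTop_diagonal
  have key : ∀ k j, (fun x => ⟪(T x - U x) (S.e k), S.e j⟫) =ᵐ[μ] 0 := by
    intro k j
    have hw := fun n => sub_mem (hφ n) (hψ n)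
    have hTU : MemLp (fun x => (T x - U x) (S.e k)) 2 μ := by
      refine (hT.sub hU).mono ((hT.1.sub hU.1).apply_continuousLinearMap (S.e k))
        (ae_of_all _ fun x => ?_)
      have := (T x - U x).le_opNorm (S.e k)
      rwa [S.e.orthonormal.1 k, mul_one] at this
    -- First-order closability is applied to `√λₖ ∂ₖ(φₙ - ψₙ)`. This is a component of the
    -- difference of the gradients, hence tends to `0`, and its own gradient is a column of the
    -- difference of the Hessians.
    refine S.ae_eq_zero_of_tendsto_inner_grad hmean hcov
      (u := fun n => √(S.lam k) • fun x => fderiv ℝ (φ n - ψ n) x (S.e k))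
      (fun n => Submodule.smul_mem _ _ (fderiv_apply_mem_expFunctions (hw n) _)) j
      (hTU.inner_const (S.e j)) ?_ ?_
    · refine tendsto_eLpNorm_of_norm_le (fun n x => ?_) t1
      rw [Pi.smul_apply, smul_eq_mul, ← S.inner_grad_e,
        S.grad_sub (differentiable_of_mem_expFunctions (hφ _))
        (differentiable_of_mem_expFunctions (hψ _))]
      refine (norm_inner_le_norm _ _).trans ?_
      rw [S.e.orthonormal.1 k, mul_one]
      simp
    · refine tendsto_eLpNorm_of_norm_le (fun n x => ?_) t2
      have e1 : S.grad (√(S.lam k) • fun x => fderiv ℝ (φ n - ψ n) x (S.e k)) x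
          = (S.hess (φ n) x - S.hess (ψ n) x) (S.e k) := by
        have e0 := S.hess_apply_e (hw n) x k
        rw [S.hess_sub (contDiff_of_mem_expFunctions (hφ _))
          (contDiff_of_mem_expFunctions (hψ _))] at e0
        rw [S.grad_const_smul (differentiable_of_mem_expFunctions
          (fderiv_apply_mem_expFunctions (hw n) _)), Pi.smul_apply]
        exact e0.symm
      rw [e1, ← inner_sub_left, ← sub_apply]
      refine (norm_inner_le_norm _ _).trans ?_
      rw [S.e.orthonormal.1 j, mul_one]
      have := (S.hess (φ n) x - S.hess (ψ n) x - (T x - U x)).le_opNorm (S.e k)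
      rwa [S.e.orthonormal.1 k, mul_one] at this
  have key' : ∀ᵐ x ∂μ, ∀ k j, ⟪(T x - U x) (S.e k), S.e j⟫ = 0 :=
    ae_all_iff.2 fun k => ae_all_iff.2 fun j => key k j
  filter_upwards [key'] with x hx
  rw [← sub_eq_zero]
  refine ContinuousLinearMap.ext_on
    (Submodule.dense_iff_topologicalClosure_eq_top.2 S.e.dense_span) ?_
  rintro _ ⟨k, rfl⟩
  apply S.e.repr.injective
  ext j
  rw [S.e.repr_apply_apply, real_inner_comm, hx k j]
  simp

/-- For `g ∈ D(L₀)`, one sequence in `𝓔₀(H)` approximates `g`, its first two derivatives and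
`L₀ g`. -/
theorem exists_approx_sequence (S : CovEigenbasis ι Q) (hmean : ∫ x, x ∂μ = 0)
    (hcov : ∀ x y : H, covarianceBilin μ x y = ⟪Q x, y⟫) {g : H → ℝ} (hg : S.MemDomL0 μ g)
    (hW : S.MemW12 μ g) :
    (MemLp g 2 μ ∧ MemLp (S.grad12 μ g) 2 μ ∧ MemLp (S.hess22 μ g) 2 μ ∧ MemLp (S.L0 μ g) 2 μ) ∧
    ∃ φ : ℕ → H → ℝ, (∀ n, φ n ∈ expFunctions H) ∧
      Tendsto (fun n => eLpNorm (fun x => φ n x - g x) 2 μ) atTop (𝓝 0) ∧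
      Tendsto (fun n => eLpNorm (fun x => S.grad (φ n) x - S.grad12 μ g x) 2 μ) atTop (𝓝 0) ∧
      Tendsto (fun n => eLpNorm (fun x => S.hess (φ n) x - S.hess22 μ g x) 2 μ) atTop (𝓝 0) ∧
      Tendsto (fun n => eLpNorm (fun x => S.ouOp (φ n) x - S.L0 μ g x) 2 μ) atTop (𝓝 0) := by
  have hL : S.IsL0 μ g (S.L0 μ g) := by
    rw [L0, dif_pos hg]
    exact hg.choose_spec
  have hG : S.IsSobolevGrad μ (expFunctions H) 2 g (S.grad12 μ g) := by
    rw [grad12, dif_pos hW]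
    exact hW.choose_spec
  -- The choices of `L₀ g`, of the gradient and of the Hessian come with three unrelated sequences
  -- `φ`, `ψ`, `χ`. The energy bounds make `φ` converge in every sense, and closability matches its
  -- limits with those of `ψ` and `χ`.
  obtain ⟨mg, ml, φ, hφ, hφg, hφl⟩ := hL
  obtain ⟨-, mG, ψ, hψ, hψg, hψG⟩ := hG
  obtain ⟨F, mF, hφF⟩ := S.exists_tendsto_grad hmean hcov hφ ml hφl
  obtain ⟨T, mT, hφT⟩ := S.exists_tendsto_hess hmean hcov hφ ml hφl
  have hT : ∃ T, S.IsSobolevHess μ g T := ⟨T, mg, mT, F, mF, φ, hφ, hφg, hφF, hφT⟩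
  have hU : S.IsSobolevHess μ g (S.hess22 μ g) := by
    rw [hess22, dif_pos hT]
    exact hT.choose_spec
  obtain ⟨-, mU, F', mF', χ, hχ, hχg, hχF, hχU⟩ := hU
  have hφT' := S.tendsto_eLpNorm_hess hφT
  have hχU' := S.tendsto_eLpNorm_hess hχU
  have mT' := S.memLp_of_tendsto_eLpNorm_hess hmean hcov hφ mT hφT'
  have mU' := S.memLp_of_tendsto_eLpNorm_hess hmean hcov hχ mU hχU'
  have eG := S.ae_eq_of_tendsto_grad hmean hcov hφ hψ mg mF mG hφg hψg hφF hψG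
  have eF := S.ae_eq_of_tendsto_grad hmean hcov hχ hφ mg mF' mF hχg hφg hχF hφF
  have eT := S.ae_eq_of_tendsto_hess hmean hcov hφ hχ mF mT' mU' hφF
    (tendsto_eLpNorm_congr_limit eF hχF) hφT' hχU'
  exact ⟨⟨mg, mG, mU', ml⟩, φ, hφ, hφg, tendsto_eLpNorm_congr_limit eG hφF,
    tendsto_eLpNorm_congr_limit eT hφT', hφl⟩

end CovEigenbasis

end GaussSobolev

/-! ### Convergence tools and bounds for the regularised integrand. -/

namespace GaussSobolev

section DominatedConvergence

variable {Ω E : Type*} [MeasurableSpace Ω] [NormedAddCommGroup E] {μ : Measure Ω}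

/-- Dominated convergence with a bound perturbed by an `L¹`-null sequence. -/
theorem tendsto_integral_of_dominated_add {F : ℕ → Ω → ℝ} {f Y : Ω → ℝ} {D : ℕ → Ω → ℝ}
    (hF : ∀ n, AEStronglyMeasurable (F n) μ) (hY : Integrable Y μ) (hD : ∀ n, Integrable (D n) μ)
    (hFD : ∀ n x, |F n x| ≤ Y x + D n x) (hf : ∀ x, |f x| ≤ Y x) (hD0 : ∀ n x, 0 ≤ D n x)
    (hlim : Tendsto (fun n => ∫ x, D n x ∂μ) atTop (𝓝 0))
    (hae : ∀ᵐ x ∂μ, Tendsto (fun n => F n x) atTop (𝓝 (f x))) :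
    Tendsto (fun n => ∫ x, F n x ∂μ) atTop (𝓝 (∫ x, f x ∂μ)) := by
  -- Clipping to `[-Y, Y]` leaves a sequence dominated by `Y`; the part cut off is at most `D n`,
  -- whose integral tends to `0`.
  set F' : ℕ → Ω → ℝ := fun n x => max (-Y x) (min (F n x) (Y x)) with hF'
  have hY0 : ∀ x, 0 ≤ Y x := fun x => (abs_nonneg _).trans (hf x)
  have hb : ∀ n x, |F' n x| ≤ Y x := fun n x =>
    abs_le.2 ⟨le_max_left _ _, max_le (by linarith [hY0 x]) (min_le_right _ _)⟩
  have hdiff : ∀ n x, |F n x - F' n x| ≤ D n x := by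
    intro n x
    have h1 := abs_le.1 (hFD n x)
    have h2 := hD0 n x
    have h3 := hY0 x
    simp only [hF']
    rcases le_total (F n x) (Y x) with h4 | h4
    · rw [min_eq_left h4]
      rcases le_total (-Y x) (F n x) with h5 | h5
      · rw [max_eq_right h5]; simpa using h2
      · rw [max_eq_left h5, abs_le]; constructor <;> linarith
    · rw [min_eq_right h4, max_eq_right (by linarith), abs_le]; constructor <;> linarith
  have hm : ∀ n, AEStronglyMeasurable (F' n) μ := fun n => by
    have := (hY.1.aemeasurable.neg.max ((hF n).aemeasurable.min hY.1.aemeasurable))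
    exact this.aestronglyMeasurable
  have i1 : ∀ n, Integrable (F' n) μ := fun n => hY.mono' (hm n) (ae_of_all _ (hb n))
  have i2 : ∀ n, Integrable (fun x => F n x - F' n x) μ :=
    fun n => (hD n).mono' ((hF n).sub (hm n)) (ae_of_all _ (hdiff n))
  have t1 : Tendsto (fun n => ∫ x, F' n x ∂μ) atTop (𝓝 (∫ x, f x ∂μ)) := by
    refine tendsto_integral_of_dominated_convergence Y hm hY (fun n => ae_of_all _ (hb n)) ?_
    filter_upwards [hae] with x hx
    have h := (tendsto_const_nhds (x := -Y x)).max (hx.min (tendsto_const_nhds (x := Y x)))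
    have h1 := abs_le.1 (hf x)
    rwa [min_eq_left h1.2, max_eq_right h1.1] at h
  have t2 : Tendsto (fun n => ∫ x, (F n x - F' n x) ∂μ) atTop (𝓝 0) := by
    refine squeeze_zero_norm (fun n => ?_) hlim
    exact norm_integral_le_of_norm_le (hD n) (ae_of_all _ (hdiff n))
  have t3 := t2.add t1
  rw [zero_add] at t3
  refine t3.congr fun n => ?_
  rw [← integral_add (i2 n) (i1 n)]
  simp

theorem tendsto_integral_norm_of_eLpNorm [IsProbabilityMeasure μ] {p : ℝ≥0∞} (hp : 1 ≤ p)
    {f : ℕ → Ω → E} (hf : ∀ n, MemLp (f n) p μ)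
    (h : Tendsto (fun n => eLpNorm (f n) p μ) atTop (𝓝 0)) :
    Tendsto (fun n => ∫ x, ‖f n x‖ ∂μ) atTop (𝓝 0) := by
  have h1 : Tendsto (fun n => eLpNorm (f n) 1 μ) atTop (𝓝 0) :=
    tendsto_of_tendsto_of_tendsto_of_le_of_le tendsto_const_nhds h (fun _ => zero_le)
      fun n => eLpNorm_le_eLpNorm_of_exponent_le hp (hf n).1
  have h2 := (ENNReal.tendsto_toReal ENNReal.zero_ne_top).comp h1
  rw [ENNReal.toReal_zero] at h2
  refine h2.congr fun n => ?_
  rw [Function.comp_apply, eLpNorm_one_eq_lintegral_enorm,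
    ← ofReal_integral_norm_eq_lintegral_enorm ((hf n).integrable hp),
    ENNReal.toReal_ofReal (by positivity)]

/-- One step of an iterated extraction: the limits already obtained are kept as a tuple `U`, so that
repeated use gives a single subsequence along which all data converge. -/
theorem exists_subseq_tendsto_ae_prodMk {X : Type*} [TopologicalSpace X] {p : ℝ≥0∞} (hp : p ≠ 0)
    {f : ℕ → Ω → E} {F : Ω → E} (hf : ∀ n, AEStronglyMeasurable (f n) μ)
    (hF : AEStronglyMeasurable F μ)
    (h : Tendsto (fun n => eLpNorm (fun x => f n x - F x) p μ) atTop (𝓝 0)) {u : ℕ → Ω → X}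
    {U : Ω → X} (hu : ∃ ns : ℕ → ℕ, StrictMono ns ∧
      ∀ᵐ x ∂μ, Tendsto (fun j => u (ns j) x) atTop (𝓝 (U x))) :
    ∃ ns : ℕ → ℕ, StrictMono ns ∧
      ∀ᵐ x ∂μ, Tendsto (fun j => (u (ns j) x, f (ns j) x)) atTop (𝓝 (U x, F x)) := by
  obtain ⟨ns, hns, hux⟩ := hu
  obtain ⟨ms, hms, hfx⟩ := (tendstoInMeasure_of_tendsto_eLpNorm hp (fun n => hf (ns n)) hF
    (h.comp hns.tendsto_atTop)).exists_seq_tendsto_ae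
  refine ⟨ns ∘ ms, hns.comp hms, ?_⟩
  filter_upwards [hux, hfx] with x h1 h2
  exact (h1.comp hms.tendsto_atTop).prodMk_nhds h2

end DominatedConvergence

section Integrand

variable {H : Type*} [NormedAddCommGroup H] [InnerProductSpace ℝ H]

/-- The integrand of the regularised integration by parts formula along a gradient. -/
noncomputable def ibpIntegrand (η χ : ℝ → ℝ) (ε s t : ℝ) (a b : H) (A : H →L[ℝ] H) (o : ℝ) : ℝ :=
  deriv η s * χ t * (‖a‖ ^ 2 / (‖a‖ ^ 2 + ε)) + η s * deriv χ t * (⟪b, a⟫ / (‖a‖ ^ 2 + ε))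
    - 2 * (η s * χ t * (⟪A a, a⟫ / (‖a‖ ^ 2 + ε) ^ 2))
    + 2 * (η s * χ t * (o / (‖a‖ ^ 2 + ε)))

variable {η χ : ℝ → ℝ} {B N : ℝ}

theorem continuous_ibpIntegrand (hη : ContDiff ℝ 1 η) (hχ : ContDiff ℝ 1 χ) {ε : ℝ} (hε : 0 < ε)
    {X : Type*} [TopologicalSpace X] {s t o : X → ℝ} {a b : X → H} {A : X → H →L[ℝ] H}
    (hs : Continuous s) (ht : Continuous t) (ho : Continuous o) (ha : Continuous a)
    (hb : Continuous b) (hA : Continuous A) :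
    Continuous fun x => ibpIntegrand η χ ε (s x) (t x) (a x) (b x) (A x) (o x) := by
  have h1 := hη.continuous
  have h2 := hχ.continuous
  have h3 := hη.continuous_deriv le_rfl
  have h4 := hχ.continuous_deriv le_rfl
  have h5 : ∀ x, ‖a x‖ ^ 2 + ε ≠ 0 := fun x => by positivity
  have h6 : ∀ x, (‖a x‖ ^ 2 + ε) ^ 2 ≠ 0 := fun x => by positivity
  have h7 : Continuous fun x => ‖a x‖ ^ 2 + ε := by fun_prop
  have h8 : Continuous fun x => ⟪A x (a x), a x⟫ := (hA.clm_apply ha).inner ha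
  have h9 : Continuous fun x => ⟪b x, a x⟫ := hb.inner ha
  unfold ibpIntegrand
  exact ((((h3.comp hs).mul (h2.comp ht)).mul ((ha.norm.pow 2).div h7 h5)).add
    (((h1.comp hs).mul (h4.comp ht)).mul (h9.div h7 h5))).sub
    (continuous_const.mul (((h1.comp hs).mul (h2.comp ht)).mul (h8.div (h7.pow 2) h6))) |>.add
    (continuous_const.mul (((h1.comp hs).mul (h2.comp ht)).mul (ho.div h7 h5)))

/-- For fixed `ε` the denominators absorb every power of `a`, leaving a bound linear in `b`, `A` and
`o`. Hence convergence in `L¹` of these three quantities, with a.e. convergence of everything, is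
enough to pass to the limit. -/
theorem abs_ibpIntegrand_le (hB : ∀ s, |η s| ≤ B) (hB' : ∀ s, |deriv η s| ≤ B)
    (hN : ∀ t, |χ t| ≤ N) (hN' : ∀ t, |deriv χ t| ≤ 1) {ε : ℝ} (hε : 0 < ε) (s t : ℝ) (a b : H)
    (A : H →L[ℝ] H) (o : ℝ) :
    |ibpIntegrand η χ ε s t a b A o|
      ≤ (B * N + B * (1 + ε⁻¹) + 2 * (B * N * ε⁻¹)) * (1 + ‖b‖ + ‖A‖ + |o|) := by
  have hB0 : 0 ≤ B := (abs_nonneg _).trans (hB 0)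
  have hN0 : 0 ≤ N := (abs_nonneg _).trans (hN 0)
  have hε' : 0 < ε⁻¹ := inv_pos.2 hε
  set w := ‖a‖ ^ 2 with hw
  have hw0 : 0 ≤ w := by positivity
  have q1 : |w / (w + ε)| ≤ 1 := by
    rw [abs_of_nonneg (by positivity)]
    exact div_le_one_of_le₀ (by linarith) (by positivity)
  have q0 : (w + ε)⁻¹ ≤ ε⁻¹ := inv_anti₀ hε (by linarith)
  have q2 : |⟪b, a⟫ / (w + ε)| ≤ (1 + ε⁻¹) * ‖b‖ := by
    rw [abs_div, abs_of_pos (show 0 < w + ε by positivity), div_le_iff₀ (by positivity)]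
    refine (abs_real_inner_le_norm _ _).trans ?_
    rw [mul_comm (1 + ε⁻¹), mul_assoc]
    refine mul_le_mul_of_nonneg_left ?_ (norm_nonneg _)
    have : (1 + ε⁻¹) * (w + ε) = w + ε + ε⁻¹ * w + 1 := by field_simp; ring
    rw [this]
    have : 0 ≤ ε⁻¹ * w := by positivity
    -- The claim is `‖a‖ ≤ (1 + ε⁻¹)(‖a‖² + ε)`; already `‖a‖ ≤ ‖a‖² + 1`.
    nlinarith [sq_nonneg (‖a‖ - 1)]
  have q3 : |⟪A a, a⟫ / (w + ε) ^ 2| ≤ ε⁻¹ * ‖A‖ := by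
    rw [abs_div, abs_of_pos (show 0 < (w + ε) ^ 2 by positivity), div_le_iff₀ (by positivity)]
    have h1 : |⟪A a, a⟫| ≤ ‖A‖ * w := by
      refine (abs_real_inner_le_norm _ _).trans ?_
      rw [hw, sq, ← mul_assoc]
      exact mul_le_mul_of_nonneg_right (A.le_opNorm a) (norm_nonneg _)
    refine h1.trans ?_
    rw [mul_comm ε⁻¹, mul_assoc]
    refine mul_le_mul_of_nonneg_left ?_ (norm_nonneg _)
    have : ε⁻¹ * (w + ε) ^ 2 = ε⁻¹ * w ^ 2 + 2 * w + ε := by field_simp; ring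
    rw [this]
    have : 0 ≤ ε⁻¹ * w ^ 2 := by positivity
    linarith
  have q4 : |o / (w + ε)| ≤ ε⁻¹ * |o| := by
    rw [abs_div, abs_of_pos (show 0 < w + ε by positivity), div_eq_inv_mul]
    exact mul_le_mul_of_nonneg_right q0 (abs_nonneg _)
  have p1 : |deriv η s * χ t * (w / (w + ε))| ≤ B * N := by
    rw [abs_mul, abs_mul]
    calc _ ≤ B * N * 1 := mul_le_mul (mul_le_mul (hB' s) (hN t) (abs_nonneg _) hB0) q1
          (abs_nonneg _) (by positivity)
      _ = _ := mul_one _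
  have p2 : |η s * deriv χ t * (⟪b, a⟫ / (w + ε))| ≤ B * ((1 + ε⁻¹) * ‖b‖) := by
    rw [abs_mul, abs_mul]
    calc _ ≤ B * 1 * ((1 + ε⁻¹) * ‖b‖) := mul_le_mul (mul_le_mul (hB s) (hN' t) (abs_nonneg _) hB0)
          q2 (abs_nonneg _) (by positivity)
      _ = _ := by ring
  have p3 : |η s * χ t * (⟪A a, a⟫ / (w + ε) ^ 2)| ≤ B * N * (ε⁻¹ * ‖A‖) := by
    rw [abs_mul, abs_mul]
    exact mul_le_mul (mul_le_mul (hB s) (hN t) (abs_nonneg _) hB0) q3 (abs_nonneg _) (by positivity)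
  have p4 : |η s * χ t * (o / (w + ε))| ≤ B * N * (ε⁻¹ * |o|) := by
    rw [abs_mul, abs_mul]
    exact mul_le_mul (mul_le_mul (hB s) (hN t) (abs_nonneg _) hB0) q4 (abs_nonneg _) (by positivity)
  have hsum : |ibpIntegrand η χ ε s t a b A o| ≤ B * N + B * ((1 + ε⁻¹) * ‖b‖)
      + 2 * (B * N * (ε⁻¹ * ‖A‖)) + 2 * (B * N * (ε⁻¹ * |o|)) := by
    rw [ibpIntegrand]
    rw [abs_le] at p1 p2 p3 p4 ⊢
    constructor <;> linarith
  refine hsum.trans ?_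
  have n1 : 0 ≤ B * N := by positivity
  have n2 : 0 ≤ B * (1 + ε⁻¹) := by positivity
  have n3 : 0 ≤ B * N * ε⁻¹ := by positivity
  have m1 := norm_nonneg b
  have m2 := norm_nonneg A
  have m3 := abs_nonneg o
  have r1 := mul_nonneg n1 m1
  have r2 := mul_nonneg n1 m2
  have r3 := mul_nonneg n1 m3
  have r4 := mul_nonneg n2 m2
  have r5 := mul_nonneg n2 m3
  have r6 := mul_nonneg n3 m1
  nlinarith

/-- A bound of the integrand which is uniform in the regularisation parameter. -/
theorem abs_ibpIntegrand_le_of_ne_zero (hB : ∀ s, |η s| ≤ B) (hB' : ∀ s, |deriv η s| ≤ B)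
    (hN : ∀ t, |χ t| ≤ N) (hN' : ∀ t, |deriv χ t| ≤ 1) {ε : ℝ} (hε : 0 ≤ ε) (s t : ℝ) {a : H}
    (ha : a ≠ 0) (b : H) (A : H →L[ℝ] H) (o : ℝ) :
    |ibpIntegrand η χ ε s t a b A o|
      ≤ B * N + B * (‖b‖ / ‖a‖) + 2 * (B * N * (‖A‖ * (‖a‖⁻¹) ^ 2))
        + 2 * (B * N * (|o| * (‖a‖⁻¹) ^ 2)) := by
  have hB0 : 0 ≤ B := (abs_nonneg _).trans (hB 0)
  have hN0 : 0 ≤ N := (abs_nonneg _).trans (hN 0)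
  have ha' : 0 < ‖a‖ := norm_pos_iff.2 ha
  have q1 : |‖a‖ ^ 2 / (‖a‖ ^ 2 + ε)| ≤ 1 := by
    rw [abs_of_nonneg (by positivity)]
    exact div_le_one_of_le₀ (by linarith) (by positivity)
  have q2 : |⟪b, a⟫ / (‖a‖ ^ 2 + ε)| ≤ ‖b‖ / ‖a‖ := by
    rw [abs_div, abs_of_pos (show 0 < ‖a‖ ^ 2 + ε by positivity)]
    calc |⟪b, a⟫| / (‖a‖ ^ 2 + ε) ≤ (‖b‖ * ‖a‖) / ‖a‖ ^ 2 :=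
          div_le_div₀ (by positivity) (abs_real_inner_le_norm _ _) (by positivity) (by linarith)
      _ = _ := by field_simp
  have q3 : |⟪A a, a⟫ / (‖a‖ ^ 2 + ε) ^ 2| ≤ ‖A‖ * (‖a‖⁻¹) ^ 2 := by
    rw [abs_div, abs_of_pos (show 0 < (‖a‖ ^ 2 + ε) ^ 2 by positivity)]
    calc |⟪A a, a⟫| / (‖a‖ ^ 2 + ε) ^ 2 ≤ (‖A‖ * ‖a‖ * ‖a‖) / (‖a‖ ^ 2) ^ 2 := by
          refine div_le_div₀ (by positivity) ((abs_real_inner_le_norm _ _).trans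
            (mul_le_mul_of_nonneg_right (A.le_opNorm a) (norm_nonneg _))) (by positivity) ?_
          gcongr
          linarith
      _ = _ := by field_simp
  have q4 : |o / (‖a‖ ^ 2 + ε)| ≤ |o| * (‖a‖⁻¹) ^ 2 := by
    rw [abs_div, abs_of_pos (show 0 < ‖a‖ ^ 2 + ε by positivity)]
    calc |o| / (‖a‖ ^ 2 + ε) ≤ |o| / ‖a‖ ^ 2 :=
          div_le_div_of_nonneg_left (abs_nonneg _) (by positivity) (by linarith)
      _ = _ := by field_simp
  have p1 : |deriv η s * χ t * (‖a‖ ^ 2 / (‖a‖ ^ 2 + ε))| ≤ B * N := by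
    rw [abs_mul, abs_mul]
    calc _ ≤ B * N * 1 := mul_le_mul (mul_le_mul (hB' s) (hN t) (abs_nonneg _) hB0) q1
          (abs_nonneg _) (by positivity)
      _ = _ := mul_one _
  have p2 : |η s * deriv χ t * (⟪b, a⟫ / (‖a‖ ^ 2 + ε))| ≤ B * (‖b‖ / ‖a‖) := by
    rw [abs_mul, abs_mul]
    calc _ ≤ B * 1 * (‖b‖ / ‖a‖) := mul_le_mul (mul_le_mul (hB s) (hN' t) (abs_nonneg _) hB0)
          q2 (abs_nonneg _) (by positivity)
      _ = _ := by ring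
  have p3 : |η s * χ t * (⟪A a, a⟫ / (‖a‖ ^ 2 + ε) ^ 2)| ≤ B * N * (‖A‖ * (‖a‖⁻¹) ^ 2) := by
    rw [abs_mul, abs_mul]
    exact mul_le_mul (mul_le_mul (hB s) (hN t) (abs_nonneg _) hB0) q3 (abs_nonneg _) (by positivity)
  have p4 : |η s * χ t * (o / (‖a‖ ^ 2 + ε))| ≤ B * N * (|o| * (‖a‖⁻¹) ^ 2) := by
    rw [abs_mul, abs_mul]
    exact mul_le_mul (mul_le_mul (hB s) (hN t) (abs_nonneg _) hB0) q4 (abs_nonneg _) (by positivity)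
  rw [ibpIntegrand]
  rw [abs_le] at p1 p2 p3 p4 ⊢
  constructor <;> linarith

theorem tendsto_ibpIntegrand_zero (s t : ℝ) {a : H} (ha : a ≠ 0) (b : H) (A : H →L[ℝ] H) (o : ℝ)
    {e : ℕ → ℝ} (he : Tendsto e atTop (𝓝 0)) :
    Tendsto (fun j => ibpIntegrand η χ (e j) s t a b A o) atTop
      (𝓝 (ibpIntegrand η χ 0 s t a b A o)) := by
  have ha' : ‖a‖ ^ 2 + 0 ≠ 0 := by
    have := norm_pos_iff.2 ha
    positivity
  have h : Tendsto (fun j => ‖a‖ ^ 2 + e j) atTop (𝓝 (‖a‖ ^ 2 + 0)) := he.const_add _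
  exact ((((tendsto_const_nhds.div h ha').const_mul _).add
    ((tendsto_const_nhds.div h ha').const_mul _)).sub
    (((tendsto_const_nhds.div (h.pow 2) (pow_ne_zero 2 ha')).const_mul _).const_mul _)).add
    (((tendsto_const_nhds.div h ha').const_mul _).const_mul _)

end Integrand

end GaussSobolev

/-! ### Integration by parts along the regularised gradient field. -/

namespace GaussSobolev

variable {H : Type*} [NormedAddCommGroup H] [InnerProductSpace ℝ H]

theorem IsBddC1.comp_real {f : H → ℝ} (hf : IsBddC1 f) {η : ℝ → ℝ} (hη : ContDiff ℝ 1 η) {B : ℝ}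
    (hB : ∀ s, |η s| ≤ B) {B' : ℝ} (hB' : ∀ s, |deriv η s| ≤ B') : IsBddC1 fun x => η (f x) := by
  obtain ⟨h, C, hC⟩ := hf
  have hB0 : 0 ≤ B := (abs_nonneg _).trans (hB 0)
  have hB0' : 0 ≤ B' := (abs_nonneg _).trans (hB' 0)
  have hC0 : 0 ≤ C := (abs_nonneg _).trans (hC 0).1
  refine ⟨hη.comp h, B + B' * C, fun x => ⟨(hB _).trans (by nlinarith), ?_⟩⟩
  have h1 := (hη.differentiable one_ne_zero (f x)).hasDerivAt.comp_hasFDerivAt x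
    (h.differentiable one_ne_zero x).hasFDerivAt
  have h2 : fderiv ℝ (fun x => η (f x)) x = deriv η (f x) • fderiv ℝ f x := h1.fderiv
  rw [h2, norm_smul]
  have := mul_le_mul (hB' (f x)) (hC x).2 (norm_nonneg _) hB0'
  rw [Real.norm_eq_abs]
  linarith

variable [CompleteSpace H]

theorem exists_norm_fderiv_gradient_le {f : H → ℝ} (hf : f ∈ expFunctions H) :
    ∃ C, ∀ x, ‖fderiv ℝ (fun z => ∇ f z) x‖ ≤ C := by
  refine expFunctions_induction (p := fun f => ∃ C, ∀ x, ‖fderiv ℝ (fun z => ∇ f z) x‖ ≤ C)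
    (fun h c => ⟨‖h‖ * ‖h‖, fun x => ?_⟩) ?_ ?_ hf
  · refine ContinuousLinearMap.opNorm_le_bound _ (by positivity) fun v => ?_
    rw [fderiv_gradient_cos_add_apply, norm_smul, norm_mul]
    have h1 := norm_inner_le_norm (𝕜 := ℝ) v h
    have h2 : ‖Real.cos (⟪x, h⟫ + (c + Real.pi / 2 + Real.pi / 2))‖ ≤ 1 := Real.abs_cos_le_one _
    calc _ ≤ ‖v‖ * ‖h‖ * 1 * ‖h‖ := by gcongr
      _ = _ := by ring
  · rintro f g hf hg ⟨C, hC⟩ ⟨D, hD⟩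
    refine ⟨C + D, fun x => ?_⟩
    have e1 : (fun z => ∇ (f + g) z) = (fun z => ∇ f z) + fun z => ∇ g z := by
      ext1 z
      exact gradient_add (differentiable_of_mem_expFunctions hf z)
        (differentiable_of_mem_expFunctions hg z)
    rw [e1, fderiv_add
      ((contDiff_gradient (contDiff_of_mem_expFunctions hf)).differentiable (by simp) x)
      ((contDiff_gradient (contDiff_of_mem_expFunctions hg)).differentiable (by simp) x)]
    exact (norm_add_le _ _).trans (add_le_add (hC x) (hD x))
  · rintro a f hf ⟨C, hC⟩
    refine ⟨|a| * C, fun x => ?_⟩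
    have e1 : (fun z => ∇ (a • f) z) = a • (fun z => ∇ f z) := by
      ext1 z; exact gradient_const_smul (differentiable_of_mem_expFunctions hf z) a
    rw [e1, fderiv_const_smul
      ((contDiff_gradient (contDiff_of_mem_expFunctions hf)).differentiable (by simp) x),
      norm_smul, Real.norm_eq_abs]
    exact mul_le_mul_of_nonneg_left (hC x) (abs_nonneg _)

namespace CovEigenbasis

variable {ι : Type*} {Q : H →L[ℝ] H}

theorem hasFDerivAt_grad (S : CovEigenbasis ι Q) {f : H → ℝ} (hf : ContDiff ℝ ∞ f) (x : H) :
    HasFDerivAt (S.grad f) (S.sqrtQ ∘L fderiv ℝ (fun z => ∇ f z) x) x :=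
  S.sqrtQ.hasFDerivAt.comp x
    ((contDiff_gradient hf).differentiable (by simp) x).hasFDerivAt

theorem hasFDerivAt_inv_norm_grad_sq (S : CovEigenbasis ι Q) {f : H → ℝ} (hf : ContDiff ℝ ∞ f)
    {ε : ℝ} (hε : 0 < ε) (x : H) :
    HasFDerivAt (fun x => (‖S.grad f x‖ ^ 2 + ε)⁻¹)
      (-((‖S.grad f x‖ ^ 2 + ε) ^ 2)⁻¹ • ((2 : ℝ) • (innerSL ℝ (S.grad f x)).comp
        (S.sqrtQ ∘L fderiv ℝ (fun z => ∇ f z) x))) x := by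
  have h1 := ((S.hasFDerivAt_grad hf x).norm_sq).add_const ε
  have h2 : ‖S.grad f x‖ ^ 2 + ε ≠ 0 := by positivity
  have h3 := (hasDerivAt_inv h2).comp_hasFDerivAt x h1
  refine h3.congr_fderiv ?_
  ext v
  simp

/-- The shift by `ε` keeps the denominator away from `0`, and functions in `𝓔₀(H)` have bounded
first and second derivatives. The reciprocal is thus an admissible multiplier; `2K/ε²` bounds its
derivative. -/
theorem isBddC1_inv_norm_grad_sq (S : CovEigenbasis ι Q) {f : H → ℝ} (hf : f ∈ expFunctions H)
    {ε : ℝ} (hε : 0 < ε) : IsBddC1 fun x => (‖S.grad f x‖ ^ 2 + ε)⁻¹ := by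
  have hs := contDiff_of_mem_expFunctions hf
  obtain ⟨-, C, hC⟩ := isBddC1_of_mem_expFunctions hf
  obtain ⟨D, hD⟩ := exists_norm_fderiv_gradient_le hf
  have hC0 : 0 ≤ C := (abs_nonneg _).trans (hC 0).1
  have hD0 : 0 ≤ D := (norm_nonneg _).trans (hD 0)
  have hg : ContDiff ℝ 1 (S.grad f) :=
    S.sqrtQ.contDiff.comp ((contDiff_gradient hs).of_le (by simp))
  have hpos : ∀ x, 0 < ‖S.grad f x‖ ^ 2 + ε := fun x => by positivity
  have hle : ∀ x, ε ≤ ‖S.grad f x‖ ^ 2 + ε := fun x => by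
    have := sq_nonneg ‖S.grad f x‖
    linarith
  set K := ‖S.sqrtQ‖ * C * (‖S.sqrtQ‖ * D) with hK
  have hK0 : 0 ≤ K := by positivity
  refine ⟨((hg.norm_sq ℝ).add contDiff_const).inv fun x => (hpos x).ne',
    ε⁻¹ + (ε ^ 2)⁻¹ * (2 * K), fun x => ⟨?_, ?_⟩⟩
  · rw [abs_of_pos (inv_pos.2 (hpos x))]
    have : (‖S.grad f x‖ ^ 2 + ε)⁻¹ ≤ ε⁻¹ := inv_anti₀ hε (hle x)
    have : 0 ≤ (ε ^ 2)⁻¹ * (2 * K) := by positivity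
    linarith
  · rw [(S.hasFDerivAt_inv_norm_grad_sq hs hε x).fderiv, norm_smul, norm_smul, norm_neg,
      Real.norm_of_nonneg (by positivity : (0 : ℝ) ≤ 2),
      Real.norm_of_nonneg (by positivity : 0 ≤ ((‖S.grad f x‖ ^ 2 + ε) ^ 2)⁻¹)]
    have h1 : ((‖S.grad f x‖ ^ 2 + ε) ^ 2)⁻¹ ≤ (ε ^ 2)⁻¹ :=
      inv_anti₀ (by positivity) (pow_le_pow_left₀ hε.le (hle x) 2)
    have h2 : ‖(innerSL ℝ (S.grad f x)).comp (S.sqrtQ ∘L fderiv ℝ (fun z => ∇ f z) x)‖ ≤ K := by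
      refine (ContinuousLinearMap.opNorm_comp_le _ _).trans ?_
      rw [innerSL_apply_norm]
      refine mul_le_mul ((S.norm_grad_le f x).trans
        (mul_le_mul_of_nonneg_left (hC x).2 (norm_nonneg _)))
        ((ContinuousLinearMap.opNorm_comp_le _ _).trans
          (mul_le_mul_of_nonneg_left (hD x) (norm_nonneg _))) (norm_nonneg _) (by positivity)
    have h3 : 0 ≤ ε⁻¹ := by positivity
    have h4 : ((‖S.grad f x‖ ^ 2 + ε) ^ 2)⁻¹ * (2 * ‖(innerSL ℝ (S.grad f x)).comp
        (S.sqrtQ ∘L fderiv ℝ (fun z => ∇ f z) x)‖) ≤ (ε ^ 2)⁻¹ * (2 * K) := by gcongr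
    linarith

variable [SecondCountableTopology H] [MeasurableSpace H] [BorelSpace H]
  {μ : Measure H} [IsGaussian μ] {η χ : ℝ → ℝ} {B N : ℝ}

/-- Regularised integration by parts along the gradient of a function in `𝓔₀(H)`. -/
theorem integral_ibpIntegrand_eq_zero (S : CovEigenbasis ι Q) (hmean : ∫ x, x ∂μ = 0)
    (hcov : ∀ x y : H, covarianceBilin μ x y = ⟪Q x, y⟫)
    (hη : ContDiff ℝ 1 η) (hχ : ContDiff ℝ 1 χ) (hB : ∀ s, |η s| ≤ B)
    (hB' : ∀ s, |deriv η s| ≤ B) (hN : ∀ t, |χ t| ≤ N) (hN' : ∀ t, |deriv χ t| ≤ 1)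
    {ε : ℝ} (hε : 0 < ε) {φ r : H → ℝ} (hφ : φ ∈ expFunctions H) (hr : IsBddC1 r) :
    ∫ x, ibpIntegrand η χ ε (φ x) (r x) (S.grad φ x) (S.grad r x) (S.hess φ x) (S.ouOp φ x) ∂μ
      = 0 := by
  have hs := contDiff_of_mem_expFunctions hφ
  have hφb := isBddC1_of_mem_expFunctions hφ
  -- The test function is `η(φ) χ(r) / (|Q^{1/2}Dφ|² + ε)`.
  have hf := ((hφb.comp_real hη hB hB').mul (hr.comp_real hχ hN hN')).mul
    (S.isBddC1_inv_norm_grad_sq hφ hε)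
  have key := S.integral_mul_ouOp hmean hcov hf.isLinGrowthC1 hφ
  have i1 : Integrable (fun x => η (φ x) * χ (r x) * (‖S.grad φ x‖ ^ 2 + ε)⁻¹
      * (2 * S.ouOp φ x)) μ :=
    (hf.isLinGrowthC1.memLp_two μ).integrable_mul ((S.isLinGrowthC1_ouOp hφ).1.memLp_two μ)
  have i2 : Integrable (fun x => ⟪S.grad (fun x => η (φ x) * χ (r x) *
      (‖S.grad φ x‖ ^ 2 + ε)⁻¹) x, S.grad φ x⟫) μ := by
    refine ((S.memLp_grad μ hf 2).norm.integrable_mul (S.memLp_grad μ hφb 2).norm).mono'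
      ((S.continuous_grad hf.1).inner (S.continuous_grad hφb.1)).aestronglyMeasurable
      (ae_of_all _ fun x => norm_inner_le_norm _ _)
  rw [eq_neg_iff_add_eq_zero, ← integral_add i1 i2] at key
  rw [← key]
  refine integral_congr_ae (ae_of_all _ fun x => ?_)
  have hη1 := (hη.differentiable one_ne_zero (φ x)).hasDerivAt.comp_hasFDerivAt x
    (hφb.1.differentiable one_ne_zero x).hasFDerivAt
  have hχ1 := (hχ.differentiable one_ne_zero (r x)).hasDerivAt.comp_hasFDerivAt x
    (hr.1.differentiable one_ne_zero x).hasFDerivAt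
  have hd := (hη1.mul hχ1).mul (S.hasFDerivAt_inv_norm_grad_sq hs hε x)
  have hd2 : fderiv ℝ (fun x => η (φ x) * χ (r x) * (‖S.grad φ x‖ ^ 2 + ε)⁻¹) x = _ := hd.fderiv
  -- Differentiating the three factors along `Q^{1/2}` applied to the gradient of `φ` produces the
  -- first three terms of the integrand; the fourth is the one with `𝓛₀φ`.
  have e1 : fderiv ℝ φ x (S.sqrtQ (S.grad φ x)) = ‖S.grad φ x‖ ^ 2 := by
    rw [← S.inner_grad, real_inner_self_eq_norm_sq]
  have e2 : fderiv ℝ r x (S.sqrtQ (S.grad φ x)) = ⟪S.grad r x, S.grad φ x⟫ := by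
    rw [← S.inner_grad]
  have e3 : ⟪S.grad φ x, S.sqrtQ (fderiv ℝ (fun z => ∇ φ z) x (S.sqrtQ (S.grad φ x)))⟫
      = ⟪S.hess φ x (S.grad φ x), S.grad φ x⟫ := by
    rw [real_inner_comm]
    rfl
  simp only
  rw [S.inner_grad, hd2]
  simp only [add_apply, smul_apply, ContinuousLinearMap.comp_apply, smul_eq_mul,
    innerSL_apply_apply, Pi.mul_apply, Function.comp_apply, e1, e2, e3, ibpIntegrand]
  have h2 : ‖S.grad φ x‖ ^ 2 + ε ≠ 0 := by positivity
  field_simp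
  ring

/-- Regularised integration by parts in Sobolev spaces. -/
theorem integral_ibpIntegrand_eq_zero_of_tendsto (S : CovEigenbasis ι Q) (hmean : ∫ x, x ∂μ = 0)
    (hcov : ∀ x y : H, covarianceBilin μ x y = ⟪Q x, y⟫)
    (hη : ContDiff ℝ 1 η) (hχ : ContDiff ℝ 1 χ) (hB : ∀ s, |η s| ≤ B)
    (hB' : ∀ s, |deriv η s| ≤ B) (hN : ∀ t, |χ t| ≤ N) (hN' : ∀ t, |deriv χ t| ≤ 1)
    {ε : ℝ} (hε : 0 < ε) {g : H → ℝ} (hg : S.MemDomL0 μ g) (hW : S.MemW12 μ g)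
    {ρ : H → ℝ} {R : H → H} (hρ : S.IsSobolevGrad μ {f | IsBddC1 f} 1 ρ R) :
    ∫ x, ibpIntegrand η χ ε (g x) (ρ x) (S.grad12 μ g x) (R x) (S.hess22 μ g x) (S.L0 μ g x) ∂μ
      = 0 := by
  obtain ⟨⟨mg, mG, mT, ml⟩, φ, hφ, c1, c2, c3, c4⟩ := S.exists_approx_sequence hmean hcov hg hW
  obtain ⟨mρ, mR, r, hr, c5, c6⟩ := hρ
  have hr' : ∀ n, IsBddC1 (r n) := hr
  have cφ := fun n => contDiff_of_mem_expFunctions (hφ n)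
  have kφ := fun n => (cφ n).continuous
  have kG := fun n => S.continuous_grad ((cφ n).of_le (by simp) : ContDiff ℝ 1 (φ n))
  have kT := fun n => S.continuous_hess (cφ n)
  have kl : ∀ n, Continuous (S.ouOp (φ n)) := fun n => by
    have := ((S.isLinGrowthC1_ouOp (hφ n)).1.1.continuous).const_smul (2⁻¹ : ℝ)
    simpa [smul_smul] using this
  have kr := fun n => (hr' n).1.continuous
  have kR := fun n => S.continuous_grad (hr' n).1
  -- Successive extractions give a.e. convergence of all six arguments of the integrand along one
  -- subsequence.
  have q1 := (tendstoInMeasure_of_tendsto_eLpNorm two_ne_zero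
    (fun n => (kφ n).aestronglyMeasurable) mg.1 c1).exists_seq_tendsto_ae
  have q2 := exists_subseq_tendsto_ae_prodMk two_ne_zero
    (fun n => (kG n).aestronglyMeasurable) mG.1 c2 (u := φ) (U := g) q1
  have q3 := exists_subseq_tendsto_ae_prodMk two_ne_zero
    (fun n => (kT n).aestronglyMeasurable) mT.1 c3
    (u := fun n x => (φ n x, S.grad (φ n) x)) (U := fun x => (g x, S.grad12 μ g x)) q2
  have q4 := exists_subseq_tendsto_ae_prodMk two_ne_zero
    (fun n => (kl n).aestronglyMeasurable) ml.1 c4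
    (u := fun n x => ((φ n x, S.grad (φ n) x), S.hess (φ n) x))
    (U := fun x => ((g x, S.grad12 μ g x), S.hess22 μ g x)) q3
  have q5 := exists_subseq_tendsto_ae_prodMk one_ne_zero
    (fun n => (kr n).aestronglyMeasurable) mρ.1 c5
    (u := fun n x => (((φ n x, S.grad (φ n) x), S.hess (φ n) x), S.ouOp (φ n) x))
    (U := fun x => (((g x, S.grad12 μ g x), S.hess22 μ g x), S.L0 μ g x)) q4
  obtain ⟨ns, sns, hae⟩ := exists_subseq_tendsto_ae_prodMk one_ne_zero
    (fun n => (kR n).aestronglyMeasurable) mR.1 c6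
    (u := fun n x => ((((φ n x, S.grad (φ n) x), S.hess (φ n) x), S.ouOp (φ n) x), r n x))
    (U := fun x => ((((g x, S.grad12 μ g x), S.hess22 μ g x), S.L0 μ g x), ρ x)) q5
  set M := B * N + B * (1 + ε⁻¹) + 2 * (B * N * ε⁻¹) with hM
  have hM0 : 0 ≤ M := by
    have hB0 : 0 ≤ B := (abs_nonneg _).trans (hB 0)
    have hN0 : 0 ≤ N := (abs_nonneg _).trans (hN 0)
    positivity
  have dR : ∀ n, MemLp (fun x => S.grad (r n) x - R x) 1 μ :=
    fun n => (S.memLp_grad μ (hr' n) 1).sub mR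
  have dT : ∀ n, MemLp (fun x => S.hess (φ n) x - S.hess22 μ g x) 2 μ :=
    fun n => (S.memLp_hess hmean hcov (hφ n)).sub mT
  have dl : ∀ n, MemLp (fun x => S.ouOp (φ n) x - S.L0 μ g x) 2 μ := fun n => by
    have := ((S.isLinGrowthC1_ouOp (hφ n)).1.memLp_two μ).const_smul (2⁻¹ : ℝ)
    rw [smul_smul, inv_mul_cancel₀ two_ne_zero, one_smul] at this
    exact this.sub ml
  -- By the triangle inequality the integrand is bounded by a fixed integrable function plus `M`
  -- times the approximation errors, which tend to `0` in `L¹`.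
  have lim : Tendsto (fun n => ∫ x, M * (‖S.grad (r n) x - R x‖ + ‖S.hess (φ n) x - S.hess22 μ g x‖
      + ‖S.ouOp (φ n) x - S.L0 μ g x‖) ∂μ) atTop (𝓝 0) := by
    have := (((tendsto_integral_norm_of_eLpNorm le_rfl dR c6).add
      (tendsto_integral_norm_of_eLpNorm one_le_two dT c3)).add
      (tendsto_integral_norm_of_eLpNorm one_le_two dl c4)).const_mul M
    simp only [add_zero, mul_zero] at this
    refine this.congr fun n => ?_
    have j1 := ((dR n).integrable le_rfl).norm
    have j2 := ((dT n).integrable one_le_two).norm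
    have j3 := ((dl n).integrable one_le_two).norm
    have j12 : Integrable (fun x => ‖S.grad (r n) x - R x‖
      + ‖S.hess (φ n) x - S.hess22 μ g x‖) μ := j1.add j2
    rw [integral_const_mul, integral_add j12 j3, integral_add j1 j2]
  have iY : Integrable (fun x => M * (1 + ‖R x‖ + ‖S.hess22 μ g x‖ + |S.L0 μ g x|)) μ := by
    have j1 := (mR.integrable le_rfl).norm
    have j2 := (mT.integrable one_le_two).norm
    have j3 := (ml.integrable one_le_two).norm
    exact ((((integrable_const 1).add j1).add j2).add j3).const_mul M
  have iD : ∀ n, Integrable (fun x => M * (‖S.grad (r n) x - R x‖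
      + ‖S.hess (φ n) x - S.hess22 μ g x‖ + ‖S.ouOp (φ n) x - S.L0 μ g x‖)) μ := fun n => by
    have j1 := ((dR n).integrable le_rfl).norm
    have j2 := ((dT n).integrable one_le_two).norm
    have j3 := ((dl n).integrable one_le_two).norm
    exact ((j1.add j2).add j3).const_mul M
  have mF : ∀ n, AEStronglyMeasurable (fun x => ibpIntegrand η χ ε (φ n x) (r n x)
      (S.grad (φ n) x) (S.grad (r n) x) (S.hess (φ n) x) (S.ouOp (φ n) x)) μ := fun n =>
    (continuous_ibpIntegrand hη hχ hε (kφ n) (kr n) (kl n) (kG n) (kR n)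
      (kT n)).aestronglyMeasurable
  have bF : ∀ n x, |ibpIntegrand η χ ε (φ n x) (r n x)
      (S.grad (φ n) x) (S.grad (r n) x) (S.hess (φ n) x) (S.ouOp (φ n) x)|
      ≤ M * (1 + ‖R x‖ + ‖S.hess22 μ g x‖ + |S.L0 μ g x|) + M * (‖S.grad (r n) x - R x‖
      + ‖S.hess (φ n) x - S.hess22 μ g x‖ + ‖S.ouOp (φ n) x - S.L0 μ g x‖) := by
    intro n x
    refine (abs_ibpIntegrand_le hB hB' hN hN' hε _ _ _ _ _ _).trans ?_
    rw [← hM, ← mul_add]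
    refine mul_le_mul_of_nonneg_left ?_ hM0
    have k1 := norm_le_insert' (S.grad (r n) x) (R x)
    have k2 := norm_le_insert' (S.hess (φ n) x) (S.hess22 μ g x)
    have k3 := norm_le_insert' (S.ouOp (φ n) x) (S.L0 μ g x)
    simp only [Real.norm_eq_abs] at k3 ⊢
    linarith
  have tF : ∀ᵐ x ∂μ, Tendsto (fun j => ibpIntegrand η χ ε (φ (ns j) x) (r (ns j) x)
      (S.grad (φ (ns j)) x) (S.grad (r (ns j)) x) (S.hess (φ (ns j)) x) (S.ouOp (φ (ns j)) x))
      atTop (𝓝 (ibpIntegrand η χ ε (g x) (ρ x) (S.grad12 μ g x) (R x) (S.hess22 μ g x)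
        (S.L0 μ g x))) := by
    filter_upwards [hae] with x hx
    have hc : Continuous fun p : ((((ℝ × H) × (H →L[ℝ] H)) × ℝ) × ℝ) × H =>
        ibpIntegrand η χ ε p.1.1.1.1.1 p.1.2 p.1.1.1.1.2 p.2 p.1.1.1.2 p.1.1.2 :=
      continuous_ibpIntegrand hη hχ hε (by fun_prop) (by fun_prop) (by fun_prop) (by fun_prop)
        (by fun_prop) (by fun_prop)
    have h := (hc.tendsto ((((((g x, S.grad12 μ g x), S.hess22 μ g x), S.L0 μ g x), ρ x), R x))).comp hx
    exact h
  have main := tendsto_integral_of_dominated_add (fun j => mF (ns j)) iY (fun j => iD (ns j))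
    (fun j x => bF (ns j) x) (fun x => abs_ibpIntegrand_le hB hB' hN hN' hε _ _ _ _ _ _)
    (fun j x => by positivity) (lim.comp sns.tendsto_atTop) tF
  refine tendsto_nhds_unique main ?_
  refine tendsto_const_nhds.congr fun j => ?_
  exact (S.integral_ibpIntegrand_eq_zero hmean hcov hη hχ hB hB' hN hN' hε (hφ _) (hr' _)).symm

end CovEigenbasis

end GaussSobolev

/-! ### Removal of the regularisation and of the truncation. -/

namespace GaussSobolev

section Truncation

/-- A smooth bounded truncation of the identity of `ℝ` at height `a`. -/
noncomputable def arctanTrunc (a t : ℝ) : ℝ := a * Real.arctan (t / a)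

variable {a : ℝ}

theorem contDiff_arctanTrunc (a : ℝ) : ContDiff ℝ 1 (arctanTrunc a) :=
  contDiff_const.mul (Real.contDiff_arctan.comp (contDiff_id.div_const a))

theorem hasDerivAt_arctanTrunc (ha : 0 < a) (t : ℝ) :
    HasDerivAt (arctanTrunc a) (1 / (1 + (t / a) ^ 2)) t := by
  have h := (((hasDerivAt_id t).div_const a).arctan).const_mul a
  refine h.congr_deriv ?_
  simp only [id]
  field_simp

theorem abs_arctanTrunc_le (ha : 0 < a) (t : ℝ) : |arctanTrunc a t| ≤ a * (Real.pi / 2) := by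
  rw [arctanTrunc, abs_mul, abs_of_pos ha]
  refine mul_le_mul_of_nonneg_left (abs_le.2 ⟨?_, ?_⟩) ha.le
  · exact (Real.neg_pi_div_two_lt_arctan _).le
  · exact (Real.arctan_lt_pi_div_two _).le

theorem abs_deriv_arctanTrunc_le (ha : 0 < a) (t : ℝ) : |deriv (arctanTrunc a) t| ≤ 1 := by
  rw [(hasDerivAt_arctanTrunc ha t).deriv, abs_of_nonneg (by positivity)]
  exact div_le_one_of_le₀ (by nlinarith [sq_nonneg (t / a)]) (by positivity)

theorem abs_arctanTrunc_le_abs (ha : 0 < a) (t : ℝ) : |arctanTrunc a t| ≤ |t| := by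
  have h := Convex.norm_image_sub_le_of_norm_deriv_le (f := arctanTrunc a) (C := 1) (s := Set.univ)
    (fun x _ => (hasDerivAt_arctanTrunc ha x).differentiableAt)
    (fun x _ => abs_deriv_arctanTrunc_le ha x) convex_univ (Set.mem_univ 0) (Set.mem_univ t)
  simpa [arctanTrunc] using h

theorem tendsto_deriv_arctanTrunc (t : ℝ) :
    Tendsto (fun n : ℕ => deriv (arctanTrunc ((n : ℝ) + 1)) t) atTop (𝓝 1) := by
  have h0 : Tendsto (fun n : ℕ => t / ((n : ℝ) + 1)) atTop (𝓝 0) :=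
    tendsto_const_nhds.div_atTop (tendsto_atTop_add_const_right _ _ tendsto_natCast_atTop_atTop)
  have h1 : Tendsto (fun n : ℕ => 1 / (1 + (t / ((n : ℝ) + 1)) ^ 2)) atTop
      (𝓝 (1 / (1 + 0 ^ 2))) :=
    tendsto_const_nhds.div ((h0.pow 2).const_add 1) (by norm_num)
  rw [show (1 : ℝ) / (1 + 0 ^ 2) = 1 by norm_num] at h1
  exact h1.congr fun n => ((hasDerivAt_arctanTrunc (by positivity) t).deriv).symm

theorem tendsto_arctanTrunc (t : ℝ) :
    Tendsto (fun n : ℕ => arctanTrunc ((n : ℝ) + 1) t) atTop (𝓝 t) := by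
  rcases eq_or_ne t 0 with rfl | ht
  · simp [arctanTrunc]
  have h0 : Tendsto (fun n : ℕ => t / ((n : ℝ) + 1)) atTop (𝓝[≠] 0) := by
    refine tendsto_nhdsWithin_iff.2 ⟨tendsto_const_nhds.div_atTop
      (tendsto_atTop_add_const_right _ _ tendsto_natCast_atTop_atTop), .of_forall fun n => ?_⟩
    exact div_ne_zero ht (by positivity)
  -- With `s = t/a`, the truncation is `t · arctan s / s`, and the slope of `arctan` at `0` is `1`.
  have h1 := (hasDerivAt_iff_tendsto_slope_zero.1 (Real.hasDerivAt_arctan 0)).comp h0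
  have h2 := h1.mul_const t
  simp only [Function.comp_def, zero_add, Real.arctan_zero, sub_zero, smul_eq_mul] at h2
  norm_num at h2
  refine h2.congr fun n => ?_
  rw [arctanTrunc]
  field_simp

end Truncation

variable {H : Type*} [NormedAddCommGroup H] [InnerProductSpace ℝ H]
  {ι : Type*} {Q : H →L[ℝ] H} [CompleteSpace H] [MeasurableSpace H] [BorelSpace H]
  [SecondCountableTopology H] {μ : Measure H} [IsGaussian μ]

namespace CovEigenbasis

variable {g : H → ℝ}

/-- Outside `W^{1,2}_0` the gradient `grad12` is `0` by convention; its inverse in `ℝ≥0∞` is `⊤`,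
and the integral is then infinite. -/
theorem memW12_of_lintegral_inv_lt_top (S : CovEigenbasis ι Q)
    (hinv : ∫⁻ x, (‖S.grad12 μ g x‖ₑ⁻¹) ^ 4 ∂μ < ⊤) : S.MemW12 μ g := by
  by_contra h
  simp [grad12, dif_neg h] at hinv

theorem ae_grad12_ne_zero (S : CovEigenbasis ι Q) (hm : AEStronglyMeasurable (S.grad12 μ g) μ)
    (hinv : ∫⁻ x, (‖S.grad12 μ g x‖ₑ⁻¹) ^ 4 ∂μ < ⊤) : ∀ᵐ x ∂μ, S.grad12 μ g x ≠ 0 := by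
  filter_upwards [ae_lt_top' (hm.enorm.inv.pow_const 4) hinv.ne] with x hx h0
  simp [h0] at hx

theorem memLp_inv_norm_grad12_sq (S : CovEigenbasis ι Q)
    (hm : AEStronglyMeasurable (S.grad12 μ g) μ)
    (hinv : ∫⁻ x, (‖S.grad12 μ g x‖ₑ⁻¹) ^ 4 ∂μ < ⊤) :
    MemLp (fun x => (‖S.grad12 μ g x‖⁻¹) ^ 2) 2 μ := by
  have hm' : AEStronglyMeasurable (fun x => (‖S.grad12 μ g x‖⁻¹) ^ 2) μ :=
    (hm.norm.aemeasurable.inv.pow_const 2).aestronglyMeasurable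
  refine ⟨hm', ?_⟩
  rw [eLpNorm_lt_top_iff_lintegral_rpow_enorm_lt_top (by norm_num) (by norm_num)]
  refine lt_of_le_of_lt (lintegral_mono_ae ?_) hinv
  -- The real inverse of `0` is `0` and the extended one is `⊤`; the two agree where the gradient
  -- does not vanish, which is almost everywhere.
  filter_upwards [S.ae_grad12_ne_zero hm hinv] with x hx
  have : ‖(‖S.grad12 μ g x‖⁻¹) ^ 2‖ₑ = (‖S.grad12 μ g x‖ₑ⁻¹) ^ 2 := by
    rw [enorm_pow, enorm_inv (by simpa using hx), enorm_norm]
  rw [this]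
  simp only [ENNReal.toReal_ofNat]
  rw [show (2 : ℝ) = ((2 : ℕ) : ℝ) by norm_num, ENNReal.rpow_natCast, ← pow_mul]

/-- Integration by parts along `Q^{1/2} D g / |Q^{1/2} D g|²`, truncated in `ρ`. -/
theorem integral_ibpIntegrand_zero_eq_zero (S : CovEigenbasis ι Q) (hmean : ∫ x, x ∂μ = 0)
    (hcov : ∀ x y : H, covarianceBilin μ x y = ⟪Q x, y⟫) {η χ : ℝ → ℝ} {B N : ℝ}
    (hη : ContDiff ℝ 1 η) (hχ : ContDiff ℝ 1 χ) (hB : ∀ s, |η s| ≤ B)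
    (hB' : ∀ s, |deriv η s| ≤ B) (hN : ∀ t, |χ t| ≤ N) (hN' : ∀ t, |deriv χ t| ≤ 1)
    (hg : S.MemDomL0 μ g) (hinv : ∫⁻ x, (‖S.grad12 μ g x‖ₑ⁻¹) ^ 4 ∂μ < ⊤)
    {ρ : H → ℝ} {R : H → H} (hρ : S.IsSobolevGrad μ {f | IsBddC1 f} 1 ρ R)
    (hR : Integrable (fun x => ‖R x‖ / ‖S.grad12 μ g x‖) μ) :
    ∫ x, ibpIntegrand η χ 0 (g x) (ρ x) (S.grad12 μ g x) (R x) (S.hess22 μ g x) (S.L0 μ g x) ∂μ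
      = 0 := by
  have hW := S.memW12_of_lintegral_inv_lt_top hinv
  obtain ⟨⟨mg, mG, mT, ml⟩, -⟩ := S.exists_approx_sequence hmean hcov hg hW
  have hne := S.ae_grad12_ne_zero mG.1 hinv
  have hw := S.memLp_inv_norm_grad12_sq mG.1 hinv
  -- This is where the exponent `4` enters: `|Q^{1/2}Dg|⁻²` is in `L²` and pairs with the Hessian
  -- and with `L₀ g`.
  have iT : Integrable (fun x => ‖S.hess22 μ g x‖ * (‖S.grad12 μ g x‖⁻¹) ^ 2) μ :=
    mT.norm.integrable_mul hw
  have il : Integrable (fun x => |S.L0 μ g x| * (‖S.grad12 μ g x‖⁻¹) ^ 2) μ :=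
    ml.norm.integrable_mul hw
  have hpos : ∀ j : ℕ, 0 < 1 / ((j : ℝ) + 1) := fun j => by positivity
  have lim := tendsto_integral_of_dominated_convergence
    (F := fun (j : ℕ) x => ibpIntegrand η χ (1 / ((j : ℝ) + 1)) (g x) (ρ x) (S.grad12 μ g x) (R x)
      (S.hess22 μ g x) (S.L0 μ g x))
    (f := fun x => ibpIntegrand η χ 0 (g x) (ρ x) (S.grad12 μ g x) (R x) (S.hess22 μ g x)
      (S.L0 μ g x)) (μ := μ)
    (fun x => B * N + B * (‖R x‖ / ‖S.grad12 μ g x‖)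
      + 2 * (B * N * (‖S.hess22 μ g x‖ * (‖S.grad12 μ g x‖⁻¹) ^ 2))
      + 2 * (B * N * (|S.L0 μ g x| * (‖S.grad12 μ g x‖⁻¹) ^ 2)))
    (fun j => by
      have hc : Continuous fun p : ((((ℝ × H) × (H →L[ℝ] H)) × ℝ) × ℝ) × H =>
          ibpIntegrand η χ (1 / ((j : ℝ) + 1)) p.1.1.1.1.1 p.1.2 p.1.1.1.1.2 p.2 p.1.1.1.2
            p.1.1.2 :=
        continuous_ibpIntegrand hη hχ (hpos j) (by fun_prop) (by fun_prop) (by fun_prop)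
          (by fun_prop) (by fun_prop) (by fun_prop)
      have h := hc.comp_aestronglyMeasurable
        (((((mg.1.prodMk mG.1).prodMk mT.1).prodMk ml.1).prodMk hρ.1.1).prodMk hρ.2.1.1)
      exact h)
    ((((integrable_const _).add (hR.const_mul _)).add ((iT.const_mul _).const_mul _)).add
      ((il.const_mul _).const_mul _))
    (fun j => by
      filter_upwards [hne] with x hx
      exact abs_ibpIntegrand_le_of_ne_zero hB hB' hN hN' (hpos j).le _ _ hx _ _ _)
    (by
      filter_upwards [hne] with x hx
      exact tendsto_ibpIntegrand_zero _ _ hx _ _ _ tendsto_one_div_add_atTop_nhds_zero_nat)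
  refine tendsto_nhds_unique lim (tendsto_const_nhds.congr fun j => ?_)
  exact (S.integral_ibpIntegrand_eq_zero_of_tendsto hmean hcov hη hχ hB hB' hN hN' (hpos j) hg hW
    hρ).symm

/-- Without regularisation the Hessian term and the `L₀ g` term combine into `2ψ`. From here on only
the combination `ψ` has to be integrable against `ρ`. -/
theorem ibpIntegrand_zero_eq (S : CovEigenbasis ι Q) (η χ : ℝ → ℝ) (ρ : ℝ) (R : H) {x : H}
    (hx : S.grad12 μ g x ≠ 0) :
    ibpIntegrand η χ 0 (g x) ρ (S.grad12 μ g x) R (S.hess22 μ g x) (S.L0 μ g x)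
      = deriv η (g x) * χ ρ + η (g x) * (2 * S.psi μ g x * χ ρ
        + deriv χ ρ * (⟪S.grad12 μ g x, R⟫ / ‖S.grad12 μ g x‖ ^ 2)) := by
  have h : ‖S.grad12 μ g x‖ ≠ 0 := by simpa using hx
  rw [ibpIntegrand, psi, add_zero, real_inner_comm R]
  field_simp
  ring

theorem abs_inner_grad12_div_le (S : CovEigenbasis ι Q) (R : H) (x : H) :
    |⟪S.grad12 μ g x, R⟫ / ‖S.grad12 μ g x‖ ^ 2| ≤ ‖R‖ / ‖S.grad12 μ g x‖ := by
  rcases eq_or_ne (S.grad12 μ g x) 0 with h | h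
  · simp [h]
  have h' : 0 < ‖S.grad12 μ g x‖ := norm_pos_iff.2 h
  rw [abs_div, abs_of_pos (by positivity : 0 < ‖S.grad12 μ g x‖ ^ 2),
    div_le_div_iff₀ (by positivity) h']
  have := mul_le_mul_of_nonneg_right (abs_real_inner_le_norm (S.grad12 μ g x) R) h'.le
  nlinarith

theorem integrable_inner_grad12_div (S : CovEigenbasis ι Q) {R : H → H}
    (mG : AEStronglyMeasurable (S.grad12 μ g) μ) (mR : AEStronglyMeasurable R μ)
    (hR : Integrable (fun x => ‖R x‖ / ‖S.grad12 μ g x‖) μ) :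
    Integrable (fun x => ⟪S.grad12 μ g x, R x⟫ / ‖S.grad12 μ g x‖ ^ 2) μ :=
  hR.mono' ((mG.inner mR).div₀ (mG.norm.pow 2))
    (ae_of_all _ fun x => S.abs_inner_grad12_div_le (R x) x)

/-- Integration by parts along `Q^{1/2} D g / |Q^{1/2} D g|²`. -/
theorem integral_deriv_comp_mul (S : CovEigenbasis ι Q) (hmean : ∫ x, x ∂μ = 0)
    (hcov : ∀ x y : H, covarianceBilin μ x y = ⟪Q x, y⟫) {η : ℝ → ℝ} {B : ℝ}
    (hη : ContDiff ℝ 1 η) (hB : ∀ s, |η s| ≤ B) (hB' : ∀ s, |deriv η s| ≤ B)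
    (hg : S.MemDomL0 μ g) (hinv : ∫⁻ x, (‖S.grad12 μ g x‖ₑ⁻¹) ^ 4 ∂μ < ⊤)
    {ρ : H → ℝ} {R : H → H} (hρ : S.IsSobolevGrad μ {f | IsBddC1 f} 1 ρ R)
    (hψ : Integrable (fun x => S.psi μ g x * ρ x) μ)
    (hR : Integrable (fun x => ‖R x‖ / ‖S.grad12 μ g x‖) μ) :
    ∫ x, deriv η (g x) * ρ x ∂μ = - ∫ x, η (g x) * (2 * S.psi μ g x * ρ x
      + ⟪S.grad12 μ g x, R x⟫ / ‖S.grad12 μ g x‖ ^ 2) ∂μ := by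
  have hW := S.memW12_of_lintegral_inv_lt_top hinv
  obtain ⟨⟨mg, mG, mT, ml⟩, -⟩ := S.exists_approx_sequence hmean hcov hg hW
  have hne := S.ae_grad12_ne_zero mG.1 hinv
  have hB0 : 0 ≤ B := (abs_nonneg _).trans (hB 0)
  have iρ : Integrable ρ μ := hρ.1.integrable le_rfl
  have iq := S.integrable_inner_grad12_div mG.1 hρ.2.1.1 hR
  have mq := iq.1
  have mψ : AEStronglyMeasurable (S.psi μ g) μ := by
    have h1 : AEStronglyMeasurable (fun x => S.hess22 μ g x (S.grad12 μ g x)) μ := by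
      have hc : Continuous fun p : (H →L[ℝ] H) × H => p.1 p.2 := by fun_prop
      exact hc.comp_aestronglyMeasurable (mT.1.prodMk mG.1)
    exact (ml.1.div₀ (mG.1.norm.pow 2)).sub ((h1.inner mG.1).div₀ (mG.1.norm.pow 4))
  have mη : AEStronglyMeasurable (fun x => η (g x)) μ :=
    hη.continuous.comp_aestronglyMeasurable mg.1
  have mη' : AEStronglyMeasurable (fun x => deriv η (g x)) μ :=
    (hη.continuous_deriv le_rfl).comp_aestronglyMeasurable mg.1
  have i1 : Integrable (fun x => deriv η (g x) * ρ x) μ :=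
    iρ.bdd_mul mη' (ae_of_all _ fun x => hB' (g x))
  have iψ : Integrable (fun x => 2 * S.psi μ g x * ρ x) μ := by
    refine (hψ.const_mul 2).congr (ae_of_all _ fun x => ?_)
    simp only
    ring
  have i2 : Integrable (fun x => η (g x) * (2 * S.psi μ g x * ρ x
      + ⟪S.grad12 μ g x, R x⟫ / ‖S.grad12 μ g x‖ ^ 2)) μ :=
    (iψ.add iq).bdd_mul mη (ae_of_all _ fun x => hB (g x))
  rw [eq_neg_iff_add_eq_zero, ← integral_add i1 i2]
  have key : ∀ n : ℕ, ∫ x, (deriv η (g x) * arctanTrunc ((n : ℝ) + 1) (ρ x)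
      + η (g x) * (2 * S.psi μ g x * arctanTrunc ((n : ℝ) + 1) (ρ x)
        + deriv (arctanTrunc ((n : ℝ) + 1)) (ρ x)
          * (⟪S.grad12 μ g x, R x⟫ / ‖S.grad12 μ g x‖ ^ 2))) ∂μ = 0 := by
    intro n
    have hn : 0 < (n : ℝ) + 1 := by positivity
    rw [← S.integral_ibpIntegrand_zero_eq_zero hmean hcov hη (contDiff_arctanTrunc ((n : ℝ) + 1))
      hB hB' (abs_arctanTrunc_le hn) (abs_deriv_arctanTrunc_le hn) hg hinv hρ hR]
    refine integral_congr_ae ?_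
    filter_upwards [hne] with x hx
    exact (S.ibpIntegrand_zero_eq _ _ _ _ hx).symm
  -- The truncations satisfy `|χₙ(t)| ≤ |t|` and `|χₙ'| ≤ 1`, so `ρ`, `ψρ` and `|R|/|Q^{1/2}Dg|`
  -- dominate.
  have lim := tendsto_integral_of_dominated_convergence
    (F := fun (n : ℕ) x => deriv η (g x) * arctanTrunc ((n : ℝ) + 1) (ρ x)
      + η (g x) * (2 * S.psi μ g x * arctanTrunc ((n : ℝ) + 1) (ρ x)
        + deriv (arctanTrunc ((n : ℝ) + 1)) (ρ x)
          * (⟪S.grad12 μ g x, R x⟫ / ‖S.grad12 μ g x‖ ^ 2)))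
    (f := fun x => deriv η (g x) * ρ x + η (g x) * (2 * S.psi μ g x * ρ x
      + ⟪S.grad12 μ g x, R x⟫ / ‖S.grad12 μ g x‖ ^ 2)) (μ := μ)
    (fun x => B * |ρ x| + B * (2 * |S.psi μ g x * ρ x| + ‖R x‖ / ‖S.grad12 μ g x‖))
    (fun n => by
      have h1 := (contDiff_arctanTrunc ((n : ℝ) + 1)).continuous.comp_aestronglyMeasurable hρ.1.1
      have h2 := ((contDiff_arctanTrunc ((n : ℝ) + 1)).continuous_deriv
        le_rfl).comp_aestronglyMeasurable hρ.1.1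
      exact (mη'.mul h1).add (mη.mul (((mψ.const_mul 2).mul h1).add (h2.mul mq))))
    ((iρ.abs.const_mul B).add (((hψ.abs.const_mul 2).add hR).const_mul B))
    (fun n => ae_of_all _ fun x => by
      have hn : 0 < (n : ℝ) + 1 := by positivity
      have b1 := abs_arctanTrunc_le_abs hn (ρ x)
      have b2 := abs_deriv_arctanTrunc_le hn (ρ x)
      rw [Real.norm_eq_abs]
      refine (abs_add_le _ _).trans (add_le_add ?_ ?_)
      · rw [abs_mul]
        exact mul_le_mul (hB' _) b1 (abs_nonneg _) hB0
      · rw [abs_mul]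
        refine mul_le_mul (hB _) ((abs_add_le _ _).trans (add_le_add ?_ ?_)) (abs_nonneg _) hB0
        · rw [abs_mul, abs_mul, abs_mul, abs_two, mul_assoc]
          gcongr
        · rw [abs_mul]
          exact (mul_le_mul b2 (S.abs_inner_grad12_div_le (R x) x) (abs_nonneg _) zero_le_one).trans (one_mul _).le)
    (ae_of_all _ fun x => by
      have h1 := tendsto_arctanTrunc (ρ x)
      have h2 := tendsto_deriv_arctanTrunc (ρ x)
      have h3 := (h1.const_mul (deriv η (g x))).add (((h1.const_mul (2 * S.psi μ g x)).add
        (h2.mul_const (⟪S.grad12 μ g x, R x⟫ / ‖S.grad12 μ g x‖ ^ 2))).const_mul (η (g x)))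
      rw [one_mul] at h3
      exact h3)
  exact tendsto_nhds_unique lim (tendsto_const_nhds.congr fun n => (key n).symm)

end CovEigenbasis

end GaussSobolev

/-! ### Densities of signed image measures on the real line. -/

namespace GaussSobolev

section RealLine

variable {Ω : Type*} [MeasurableSpace Ω] {μ : Measure Ω}

theorem integral_withDensity_ofReal {f : Ω → ℝ} (hf : AEMeasurable f μ) (φ : Ω → ℝ) :
    ∫ x, φ x ∂(μ.withDensity fun x => ENNReal.ofReal (f x)) = ∫ x, max (f x) 0 * φ x ∂μ := by
  rw [integral_withDensity_eq_integral_toReal_smul₀ hf.ennreal_ofReal (by simp)]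
  simp [ENNReal.toReal_ofReal']

theorem isLocallyFiniteMeasure_withDensity_ofReal {k : ℝ → ℝ} {C : ℝ}
    (hC : ∀ᵐ r, k r ≤ C) :
    IsLocallyFiniteMeasure (volume.withDensity fun r => ENNReal.ofReal (k r)) := by
  refine ⟨fun x => ⟨Set.Ioo (x - 1) (x + 1), Ioo_mem_nhds (by linarith) (by linarith), ?_⟩⟩
  rw [withDensity_apply' _ _]
  calc ∫⁻ r in Set.Ioo (x - 1) (x + 1), ENNReal.ofReal (k r)
      ≤ ∫⁻ _ in Set.Ioo (x - 1) (x + 1), ENNReal.ofReal C :=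
        lintegral_mono_ae (ae_restrict_of_ae (hC.mono fun r hr => ENNReal.ofReal_le_ofReal hr))
    _ < ⊤ := by
        rw [setLIntegral_const]
        exact ENNReal.mul_lt_top ENNReal.ofReal_lt_top (by simp)

/-- A signed image measure which acts on compactly supported functions as a bounded function `k`
has density `k`, and `k` is integrable. -/
theorem integrable_and_setIntegral_eq_of_integral_comp_mul [IsFiniteMeasure μ] {g ρ : Ω → ℝ}
    (hg : AEMeasurable g μ) (hρ : Integrable ρ μ) {k : ℝ → ℝ} (hk : Measurable k) {C : ℝ}
    (hC : ∀ᵐ r, |k r| ≤ C)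
    (h : ∀ θ : ℝ → ℝ, Continuous θ → HasCompactSupport θ →
      ∫ x, θ (g x) * ρ x ∂μ = ∫ r, θ r * k r) :
    Integrable k ∧ ∀ I, MeasurableSet I → ∫ x in g ⁻¹' I, ρ x ∂μ = ∫ r in I, k r := by
  have hac : ∀ f : Ω → ℝ≥0∞, AEMeasurable g (μ.withDensity f) := fun f =>
    hg.mono_ac (withDensity_absolutelyContinuous _ _)
  set νp := (μ.withDensity fun x => ENNReal.ofReal (ρ x)).map g with hνp
  set νm := (μ.withDensity fun x => ENNReal.ofReal (-ρ x)).map g with hνm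
  set κp := volume.withDensity fun r => ENNReal.ofReal (k r) with hκp
  set κm := volume.withDensity fun r => ENNReal.ofReal (-k r) with hκm
  have : IsFiniteMeasure (μ.withDensity fun x => ENNReal.ofReal (ρ x)) :=
    isFiniteMeasure_withDensity_ofReal hρ.2
  have : IsFiniteMeasure (μ.withDensity fun x => ENNReal.ofReal (-ρ x)) :=
    isFiniteMeasure_withDensity_ofReal hρ.neg.2
  have : IsLocallyFiniteMeasure κp :=
    isLocallyFiniteMeasure_withDensity_ofReal (hC.mono fun r hr => (le_abs_self _).trans hr)
  have : IsLocallyFiniteMeasure κm :=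
    isLocallyFiniteMeasure_withDensity_ofReal (hC.mono fun r hr => (neg_le_abs _).trans hr)
  have hcl : LocallyIntegrable k := by
    rw [locallyIntegrable_iff]
    intro K hK
    have : IsFiniteMeasure (volume.restrict K) := ⟨by simpa using hK.measure_lt_top⟩
    exact Integrable.of_bound hk.aestronglyMeasurable C (ae_restrict_of_ae hC)
  have hadd : ∀ (ν κ : Measure ℝ) [IsFiniteMeasure ν] [IsLocallyFiniteMeasure κ],
      (ν + κ).Regular := fun ν κ _ _ => by
    have : IsLocallyFiniteMeasure (ν + κ) := ⟨fun x => by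
      obtain ⟨s, hs, hsκ⟩ := κ.finiteAt_nhds x
      exact ⟨s, hs, ENNReal.add_lt_top.2 ⟨measure_lt_top ν s, hsκ⟩⟩⟩
    infer_instance
  have : (νp + κm).Regular := hadd _ _
  have : (νm + κp).Regular := hadd _ _
  -- As `k` is not yet known to be integrable, the identity of signed measures is rearranged into
  -- one between positive locally finite measures, which are determined by compactly supported
  -- continuous functions.
  have heq : νp + κm = νm + κp := by
    refine Measure.ext_of_integral_eq_on_compactlySupported fun θ => ?_
    have hθ : Continuous θ := θ.continuous
    have hθc := θ.hasCompactSupport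
    have int : ∀ (ν : Measure ℝ) [IsLocallyFiniteMeasure ν], Integrable θ ν := fun ν _ =>
      hθ.integrable_of_hasCompactSupport hθc
    obtain ⟨M, hM⟩ := hθc.exists_bound_of_continuous hθ
    rw [integral_add_measure (int _) (int _), integral_add_measure (int _) (int _), hνp, hνm, hκp, hκm,
      integral_map (hac _) hθ.aestronglyMeasurable, integral_map (hac _) hθ.aestronglyMeasurable,
      integral_withDensity_ofReal hρ.aemeasurable,
      integral_withDensity_ofReal (f := fun x => -ρ x) hρ.aemeasurable.neg,
      integral_withDensity_ofReal hk.aemeasurable,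
      integral_withDensity_ofReal (f := fun r => -k r) hk.neg.aemeasurable]
    have mθ : AEStronglyMeasurable (fun x => θ (g x)) μ :=
      hθ.aestronglyMeasurable.comp_aemeasurable hg
    have i1 : Integrable (fun x => max (ρ x) 0 * θ (g x)) μ :=
      hρ.pos_part.mul_bdd mθ (ae_of_all _ fun x => hM (g x))
    have i2 : Integrable (fun x => max (-ρ x) 0 * θ (g x)) μ :=
      hρ.neg_part.mul_bdd mθ (ae_of_all _ fun x => hM (g x))
    have i0 : Integrable (fun r => θ r * k r) :=
      hcl.integrable_smul_left_of_hasCompactSupport hθ hθc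
    have i3 : Integrable (fun r => max (k r) 0 * θ r) := by
      refine i0.norm.mono' ((hk.max measurable_const).mul hθ.measurable).aestronglyMeasurable
        (ae_of_all _ fun r => ?_)
      rw [norm_mul, norm_mul, mul_comm]
      refine mul_le_mul_of_nonneg_left ?_ (norm_nonneg _)
      rw [Real.norm_eq_abs, Real.norm_eq_abs, abs_of_nonneg (le_max_right _ _)]
      exact max_le (le_abs_self _) (abs_nonneg _)
    have i4 : Integrable (fun r => max (-k r) 0 * θ r) := by
      refine i0.norm.mono' ((hk.neg.max measurable_const).mul hθ.measurable).aestronglyMeasurable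
        (ae_of_all _ fun r => ?_)
      rw [norm_mul, norm_mul, mul_comm]
      refine mul_le_mul_of_nonneg_left ?_ (norm_nonneg _)
      rw [Real.norm_eq_abs, Real.norm_eq_abs, abs_of_nonneg (le_max_right _ _)]
      exact max_le (neg_le_abs _) (abs_nonneg _)
    have hpm : ∀ y z : ℝ, max y 0 * z - max (-y) 0 * z = z * y := fun y z => by
      rcases le_total 0 y with hy | hy
      · rw [max_eq_left hy, max_eq_right (by linarith)]; ring
      · rw [max_eq_right hy, max_eq_left (by linarith)]; ring
    have e1 := integral_sub i1 i2
    have e2 := integral_sub i3 i4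
    simp only [hpm] at e1 e2
    have := h θ hθ hθc
    linarith
  have hset : ∀ I, MeasurableSet I → (∫⁻ x in g ⁻¹' I, ENNReal.ofReal (ρ x) ∂μ)
      + ∫⁻ r in I, ENNReal.ofReal (-k r) = (∫⁻ x in g ⁻¹' I, ENNReal.ofReal (-ρ x) ∂μ)
      + ∫⁻ r in I, ENNReal.ofReal (k r) := fun I hI => by
    have := congrArg (fun m => m I) heq
    simpa only [Measure.add_apply, hνp, hνm, hκp, hκm, Measure.map_apply_of_aemeasurable (hac _) hI,
      withDensity_apply' _ _] using this
  have hlt : ∀ {f : Ω → ℝ}, Integrable f μ → ∀ A : Set Ω,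
      ∫⁻ x in A, ENNReal.ofReal (f x) ∂μ < ⊤ := fun {f} hf A =>
    (setLIntegral_le_lintegral _ _).trans_lt hf.lintegral_lt_top
  -- On `{k > 0}` the measure `κm` vanishes, so `κp` is dominated there by the finite measure `νp`.
  -- The negative part is treated symmetrically.
  have hkp : ∫⁻ r, ENNReal.ofReal (k r) < ⊤ := by
    have h1 := hset {r | 0 < k r} (measurableSet_lt measurable_const hk)
    have h2 : ∫⁻ r in {r | 0 < k r}, ENNReal.ofReal (-k r) = 0 := by
      rw [setLIntegral_congr_fun (measurableSet_lt measurable_const hk)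
        (g := fun _ => 0) fun r hr => ENNReal.ofReal_of_nonpos (by simpa using le_of_lt hr)]
      simp
    have h3 : ∫⁻ r, ENNReal.ofReal (k r) = ∫⁻ r in {r | 0 < k r}, ENNReal.ofReal (k r) := by
      rw [setLIntegral_eq_of_support_subset]
      intro r hr
      simpa using hr
    rw [h3]
    rw [h2, add_zero] at h1
    exact (le_add_self.trans h1.ge).trans_lt (hlt hρ _)
  have hkm : ∫⁻ r, ENNReal.ofReal (-k r) < ⊤ := by
    have h1 := hset {r | k r < 0} (measurableSet_lt hk measurable_const)
    have h2 : ∫⁻ r in {r | k r < 0}, ENNReal.ofReal (k r) = 0 := by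
      rw [setLIntegral_congr_fun (measurableSet_lt hk measurable_const)
        (g := fun _ => 0) fun r hr => ENNReal.ofReal_of_nonpos (le_of_lt hr)]
      simp
    have h3 : ∫⁻ r, ENNReal.ofReal (-k r) = ∫⁻ r in {r | k r < 0}, ENNReal.ofReal (-k r) := by
      rw [setLIntegral_eq_of_support_subset]
      intro r hr
      simpa using hr
    rw [h3]
    rw [h2, add_zero] at h1
    exact (le_add_self.trans h1.le).trans_lt (hlt hρ.neg _)
  have hki : Integrable k := by
    refine ⟨hk.aestronglyMeasurable, ?_⟩
    have : ∀ r, ‖k r‖ₑ ≤ ENNReal.ofReal (k r) + ENNReal.ofReal (-k r) := fun r => by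
      rcases le_total 0 (k r) with hr | hr
      · rw [Real.enorm_of_nonneg hr]
        exact le_self_add
      · rw [← enorm_neg, Real.enorm_of_nonneg (by linarith)]
        exact le_add_self
    refine (lintegral_mono this).trans_lt ?_
    rw [lintegral_add_left hk.ennreal_ofReal]
    exact ENNReal.add_lt_top.2 ⟨hkp, hkm⟩
  refine ⟨hki, fun I hI => ?_⟩
  rw [integral_eq_lintegral_pos_part_sub_lintegral_neg_part hρ.integrableOn,
    integral_eq_lintegral_pos_part_sub_lintegral_neg_part hki.integrableOn]
  have h1 := congrArg ENNReal.toReal (hset I hI)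
  have h2 : ∫⁻ x in g ⁻¹' I, ENNReal.ofReal (-ρ x) ∂μ < ⊤ := hlt hρ.neg _
  rw [ENNReal.toReal_add (hlt hρ _).ne ((setLIntegral_le_lintegral _ _).trans_lt hkm).ne,
    ENNReal.toReal_add h2.ne ((setLIntegral_le_lintegral _ _).trans_lt hkp).ne] at h1
  linarith

theorem hasDerivAt_setIntegral_Iic {θ : ℝ → ℝ} (hθ : Continuous θ) (hi : Integrable θ) (s : ℝ) :
    HasDerivAt (fun s => ∫ t in Set.Iic s, θ t) (θ s) s := by
  have h1 := (intervalIntegral.integral_hasDerivAt_right (hθ.intervalIntegrable 0 s)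
    hθ.aestronglyMeasurable.stronglyMeasurableAtFilter hθ.continuousAt).add_const
    (∫ t in Set.Iic 0, θ t)
  refine h1.congr_of_eventuallyEq (.of_forall fun u => ?_)
  have := intervalIntegral.integral_Iic_sub_Iic (a := 0) (b := u) hi.integrableOn hi.integrableOn
  simp only
  linarith

/-- If `ρ₁` is the divergence of `ρ` along `g` then the signed image measure of `ρ` has a
density. -/
theorem exists_density_of_integral_deriv_comp_mul [IsFiniteMeasure μ] {g ρ ρ₁ : Ω → ℝ}
    (hg : AEMeasurable g μ) (hρ : Integrable ρ μ) (hρ₁ : Integrable ρ₁ μ)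
    (h : ∀ (η : ℝ → ℝ) (B : ℝ), ContDiff ℝ 1 η → (∀ s, |η s| ≤ B) → (∀ s, |deriv η s| ≤ B) →
      ∫ x, deriv η (g x) * ρ x ∂μ = - ∫ x, η (g x) * ρ₁ x ∂μ) :
    ∃ k : ℝ → ℝ, Integrable k ∧
      (∀ I, MeasurableSet I → ∫ x in g ⁻¹' I, ρ x ∂μ = ∫ r in I, k r) ∧
      ∀ θ : ℝ → ℝ, Continuous θ → HasCompactSupport θ →
        ∫ x, θ (g x) * ρ x ∂μ = ∫ r, θ r * k r := by
  -- `F t x` equals `ρ₁ x` when `t ≤ g x` and `0` otherwise. The candidate density is `k₀(t) = -∫_{g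
  -- ≥ t} ρ₁ dμ`, bounded by the `L¹` norm of `ρ₁`.
  set F : ℝ → Ω → ℝ := fun t x => {p : ℝ × Ω | p.1 ≤ g p.2}.indicator (fun p => ρ₁ p.2) (t, x)
    with hF
  have hS : NullMeasurableSet {p : ℝ × Ω | p.1 ≤ g p.2} (volume.prod μ) :=
    nullMeasurableSet_le measurable_fst.aemeasurable
      (hg.comp_quasiMeasurePreserving Measure.quasiMeasurePreserving_snd)
  have hFm : AEStronglyMeasurable (Function.uncurry F) (volume.prod μ) :=
    (hρ₁.1.comp_snd).indicator₀ hS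
  have hFb : ∀ t x, ‖F t x‖ ≤ ‖ρ₁ x‖ := fun t x => norm_indicator_le_norm_self _ _
  set k₀ : ℝ → ℝ := fun t => - ∫ x, F t x ∂μ with hk₀
  have mk₀ : AEStronglyMeasurable k₀ := (hFm.integral_prod_right').neg
  have bk₀ : ∀ t, |k₀ t| ≤ ∫ x, ‖ρ₁ x‖ ∂μ := fun t => by
    rw [hk₀, abs_neg]
    exact norm_integral_le_of_norm_le hρ₁.norm (ae_of_all _ (hFb t))
  have test : ∀ θ : ℝ → ℝ, Continuous θ → HasCompactSupport θ →
      ∫ x, θ (g x) * ρ x ∂μ = ∫ r, θ r * k₀ r := by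
    intro θ hθ hθc
    have iθ : Integrable θ := hθ.integrable_of_hasCompactSupport hθc
    obtain ⟨M, hM⟩ := hθc.exists_bound_of_continuous hθ
    -- The hypothesis is used with the primitive of `θ` from `-∞`: bounded since `θ` is integrable,
    -- though in general not compactly supported.
    set η : ℝ → ℝ := fun s => ∫ t in Set.Iic s, θ t with hη
    have dη := hasDerivAt_setIntegral_Iic hθ iθ
    have dη' : deriv η = θ := funext fun s => (dη s).deriv
    have cη : ContDiff ℝ 1 η :=
      contDiff_one_iff_deriv.2 ⟨fun s => (dη s).differentiableAt, by rwa [dη']⟩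
    have bη : ∀ s, |η s| ≤ ∫ t, ‖θ t‖ := fun s =>
      (norm_integral_le_integral_norm _).trans
        (setIntegral_le_integral iθ.norm (ae_of_all _ fun t => norm_nonneg _))
    have h1 := h η (max (∫ t, ‖θ t‖) M) cη (fun s => (bη s).trans (le_max_left _ _))
      (fun s => by rw [dη']; exact (hM s).trans (le_max_right _ _))
    rw [dη'] at h1
    rw [h1]
    have hint : Integrable (Function.uncurry fun t x => θ t * F t x) (volume.prod μ) := by
      refine (iθ.norm.mul_prod hρ₁.norm).mono' ((hθ.aestronglyMeasurable.comp_fst).mul hFm)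
        (ae_of_all _ fun p => ?_)
      simp only [Function.uncurry, norm_mul]
      exact mul_le_mul_of_nonneg_left (hFb _ _) (norm_nonneg _)
    have h2 := integral_integral_swap hint
    have h3 : ∀ x, ∫ t, θ t * F t x = η (g x) * ρ₁ x := fun x => by
      rw [hη]
      simp only
      rw [← integral_indicator measurableSet_Iic, ← integral_mul_const]
      refine integral_congr_ae (ae_of_all _ fun t => ?_)
      by_cases ht : t ≤ g x <;> simp [hF, ht]
    simp only [h3] at h2
    rw [← h2, ← integral_neg]
    refine integral_congr_ae (ae_of_all _ fun t => ?_)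
    simp only [hk₀]
    rw [integral_const_mul]
    ring
  -- `k₀` is only a.e. strongly measurable; a measurable representative takes its place.
  have test' : ∀ θ : ℝ → ℝ, Continuous θ → HasCompactSupport θ →
      ∫ x, θ (g x) * ρ x ∂μ = ∫ r, θ r * mk₀.mk k₀ r := fun θ hθ hθc => by
    rw [test θ hθ hθc]
    refine integral_congr_ae ?_
    filter_upwards [mk₀.ae_eq_mk] with r hr
    rw [hr]
  have hC : ∀ᵐ r, |mk₀.mk k₀ r| ≤ ∫ x, ‖ρ₁ x‖ ∂μ := by
    filter_upwards [mk₀.ae_eq_mk] with r hr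
    rw [← hr]
    exact bk₀ r
  obtain ⟨h1, h2⟩ := integrable_and_setIntegral_eq_of_integral_comp_mul hg hρ
    mk₀.stronglyMeasurable_mk.measurable hC test'
  exact ⟨_, h1, h2, test'⟩

/-- Two successive divergences along `g` give a density in `W^{1,1}(ℝ)`. -/
theorem exists_isDensity_memW11Real [IsFiniteMeasure μ] {g ρ ρ₁ ρ₂ : Ω → ℝ}
    (hg : AEMeasurable g μ) (hρ : Integrable ρ μ) (hρ₁ : Integrable ρ₁ μ) (hρ₂ : Integrable ρ₂ μ)
    (h : ∀ (η : ℝ → ℝ) (B : ℝ), ContDiff ℝ 1 η → (∀ s, |η s| ≤ B) → (∀ s, |deriv η s| ≤ B) →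
      ∫ x, deriv η (g x) * ρ x ∂μ = - ∫ x, η (g x) * ρ₁ x ∂μ)
    (h₁ : ∀ (η : ℝ → ℝ) (B : ℝ), ContDiff ℝ 1 η → (∀ s, |η s| ≤ B) → (∀ s, |deriv η s| ≤ B) →
      ∫ x, deriv η (g x) * ρ₁ x ∂μ = - ∫ x, η (g x) * ρ₂ x ∂μ) :
    ∃ k : ℝ → ℝ, IsDensity (fun I => ∫ x in g ⁻¹' I, ρ x ∂μ) k ∧ MemW11Real k := by
  obtain ⟨k, ik, dk, tk⟩ := exists_density_of_integral_deriv_comp_mul hg hρ hρ₁ h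
  obtain ⟨k₁, ik₁, -, tk₁⟩ := exists_density_of_integral_deriv_comp_mul hg hρ₁ hρ₂ h₁
  -- The weak derivative of `k` is the density `k₁` of the image of `ρ₁`: the hypothesis `h` is
  -- rewritten through both densities.
  refine ⟨k, ⟨ik, dk⟩, ik, k₁, ik₁, fun η hη hηc => ?_⟩
  have hη1 : ContDiff ℝ 1 η := hη.of_le (by simp)
  have hd := hη1.continuous_deriv le_rfl
  obtain ⟨B, hB⟩ := hηc.exists_bound_of_continuous hη.continuous
  obtain ⟨B', hB'⟩ := hηc.deriv.exists_bound_of_continuous hd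
  have e1 := h η (max B B') hη1 (fun s => (hB s).trans (le_max_left _ _))
    (fun s => (hB' s).trans (le_max_right _ _))
  rw [tk _ hd hηc.deriv, tk₁ _ hη.continuous hηc] at e1
  simpa only [mul_comm] using e1

end RealLine

end GaussSobolev

/-! ### The Sobolev classes in terms of bounded `C¹` approximants, and the conclusion. -/

namespace GaussSobolev

variable {H : Type*} [NormedAddCommGroup H] [InnerProductSpace ℝ H]

theorem isBddC1_of_mem_cylFunctions {f : H → ℝ} (hf : f ∈ cylFunctions H) : IsBddC1 f := by
  obtain ⟨n, y, u, hu, hb, rfl⟩ := hf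
  obtain ⟨C₀, h₀⟩ := hb 0
  obtain ⟨C₁, h₁⟩ := hb 1
  set L : H →L[ℝ] (Fin n → ℝ) := ContinuousLinearMap.pi fun i => innerSL ℝ (y i) with hL
  have hLe : (fun x => u fun i => ⟪x, y i⟫) = u ∘ L := by
    ext x
    simp only [Function.comp_apply, hL]
    congr 1
    ext i
    simp [real_inner_comm]
  have hC₁ : 0 ≤ C₁ := (norm_nonneg _).trans (h₁ 0)
  rw [hLe]
  refine ⟨(hu.of_le (by simp)).comp L.contDiff, max C₀ (C₁ * ‖L‖), fun x => ⟨?_, ?_⟩⟩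
  · refine le_max_of_le_left ?_
    have := h₀ (L x)
    rwa [norm_iteratedFDeriv_zero] at this
  · refine le_max_of_le_right ?_
    rw [fderiv_comp x (hu.differentiable (by simp) _) L.differentiableAt, L.fderiv]
    have := h₁ (L x)
    rw [norm_iteratedFDeriv_one] at this
    exact (ContinuousLinearMap.opNorm_comp_le _ _).trans
      (mul_le_mul_of_nonneg_right this (norm_nonneg _))

variable {ι : Type*} {Q : H →L[ℝ] H} [CompleteSpace H] [MeasurableSpace H] {μ : Measure H}

namespace CovEigenbasis

/-- Integration by parts holds for every limit `R` of gradients of bounded `C¹` functions. Enlarging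
the class of approximants therefore costs nothing, and it makes closability in `L¹` and the choice
in `grad11` irrelevant. -/
theorem isSobolevGrad_grad11 (S : CovEigenbasis ι Q) {ρ : H → ℝ} (hρ : S.MemW11 μ ρ) :
    S.IsSobolevGrad μ {f | IsBddC1 f} 1 ρ (S.grad11 μ ρ) := by
  rw [grad11, dif_pos hρ]
  obtain ⟨h1, h2, φ, hφ, h3⟩ := hρ.choose_spec
  exact ⟨h1, h2, φ, fun n => isBddC1_of_mem_cylFunctions (hφ n), h3⟩

/-- For part (a), where `ρ = 1` and the constant sequence approximates. -/
theorem isSobolevGrad_one (S : CovEigenbasis ι Q) [IsFiniteMeasure μ] :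
    S.IsSobolevGrad μ {f | IsBddC1 f} 1 (fun _ => 1) (fun _ => 0) := by
  refine ⟨memLp_const _, memLp_const _, fun _ _ => 1, fun _ => ⟨contDiff_const, 1, fun x => ?_⟩,
    ?_, ?_⟩
  · simp
  · simp
  · simp [grad, gradient]

variable [BorelSpace H] [SecondCountableTopology H]

/-- On a probability space `L²` convergence implies `L¹` convergence, and `𝓔₀(H)` consists of
bounded `C¹` functions. This carries `ρ₁ = 2ψ` of part (a) from the `W^{1,2}_0` setting to the one
of part (b). -/
theorem IsSobolevGrad.const_mul_of_expFunctions {S : CovEigenbasis ι Q} [IsProbabilityMeasure μ]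
    {f : H → ℝ} {F : H → H} (h : S.IsSobolevGrad μ (expFunctions H) 2 f F) (c : ℝ) :
    S.IsSobolevGrad μ {f | IsBddC1 f} 1 (fun x => c * f x) (fun x => c • F x) := by
  obtain ⟨mf, mF, φ, hφ, h1, h2⟩ := h
  refine ⟨(mf.const_mul c).mono_exponent one_le_two, (mF.const_smul c).mono_exponent one_le_two,
    fun n => c • φ n, fun n => isBddC1_of_mem_expFunctions (Submodule.smul_mem _ c (hφ n)), ?_, ?_⟩
  · have hm : ∀ n, AEStronglyMeasurable (fun x => φ n x - f x) μ := fun n =>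
      (contDiff_of_mem_expFunctions (hφ n)).continuous.aestronglyMeasurable.sub mf.1
    have h3 : Tendsto (fun n => ‖c‖ₑ * eLpNorm (fun x => φ n x - f x) 2 μ) atTop (𝓝 0) := by
      simpa using ENNReal.Tendsto.const_mul h1 (Or.inr enorm_ne_top)
    refine tendsto_of_tendsto_of_tendsto_of_le_of_le tendsto_const_nhds h3 (fun _ => zero_le)
      fun n => ?_
    have e : (fun x => (c • φ n) x - c * f x) = c • fun x => φ n x - f x := by
      ext x
      simp [mul_sub]
    simp only
    rw [e, eLpNorm_const_smul]
    gcongr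
    exact eLpNorm_le_eLpNorm_of_exponent_le one_le_two (hm n)
  · have hm : ∀ n, AEStronglyMeasurable (fun x => S.grad (φ n) x - F x) μ := fun n =>
      (S.continuous_grad (isBddC1_of_mem_expFunctions (hφ n)).1).aestronglyMeasurable.sub mF.1
    have h3 : Tendsto (fun n => ‖c‖ₑ * eLpNorm (fun x => S.grad (φ n) x - F x) 2 μ) atTop
        (𝓝 0) := by
      simpa using ENNReal.Tendsto.const_mul h2 (Or.inr enorm_ne_top)
    refine tendsto_of_tendsto_of_tendsto_of_le_of_le tendsto_const_nhds h3 (fun _ => zero_le)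
      fun n => ?_
    have e : (fun x => S.grad (c • φ n) x - c • F x) = c • fun x => S.grad (φ n) x - F x := by
      ext x
      rw [S.grad_const_smul ((isBddC1_of_mem_expFunctions (hφ n)).1.differentiable one_ne_zero)]
      simp [smul_sub]
    simp only
    rw [e, eLpNorm_const_smul]
    gcongr
    exact eLpNorm_le_eLpNorm_of_exponent_le one_le_two (hm n)

variable [IsGaussian μ] {g : H → ℝ}

/-- A density in `W^{1,1}(ℝ)` of a signed image measure, for arbitrary gradients of `ρ` and of its
divergence. -/
theorem exists_isDensity_memW11Real_of_isSobolevGrad (S : CovEigenbasis ι Q)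
    (hmean : ∫ x, x ∂μ = 0) (hcov : ∀ x y : H, covarianceBilin μ x y = ⟪Q x, y⟫)
    (hg : S.MemDomL0 μ g) (hinv : ∫⁻ x, (‖S.grad12 μ g x‖ₑ⁻¹) ^ 4 ∂μ < ⊤)
    {ρ : H → ℝ} {R R₁ : H → H} (hρ : S.IsSobolevGrad μ {f | IsBddC1 f} 1 ρ R)
    (hψ : Integrable (fun x => S.psi μ g x * ρ x) μ)
    (hR : Integrable (fun x => ‖R x‖ / ‖S.grad12 μ g x‖) μ) {ρ₁ : H → ℝ}
    (hρ₁ : ρ₁ = fun x => 2 * S.psi μ g x * ρ x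
      + ⟪S.grad12 μ g x, R x⟫ / ‖S.grad12 μ g x‖ ^ 2)
    (hs : S.IsSobolevGrad μ {f | IsBddC1 f} 1 ρ₁ R₁)
    (hψ₁ : Integrable (fun x => S.psi μ g x * ρ₁ x) μ)
    (hR₁ : Integrable (fun x => ‖R₁ x‖ / ‖S.grad12 μ g x‖) μ) :
    ∃ k : ℝ → ℝ, IsDensity (fun I => ∫ x in g ⁻¹' I, ρ x ∂μ) k ∧ MemW11Real k := by
  obtain ⟨⟨mg, mG, -⟩, -⟩ := S.exists_approx_sequence hmean hcov hg
    (S.memW12_of_lintegral_inv_lt_top hinv)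
  have i₂ : Integrable (fun x => 2 * S.psi μ g x * ρ₁ x
      + ⟪S.grad12 μ g x, R₁ x⟫ / ‖S.grad12 μ g x‖ ^ 2) μ := by
    refine Integrable.add ?_ (S.integrable_inner_grad12_div mG.1 hs.2.1.1 hR₁)
    simpa only [mul_assoc] using hψ₁.const_mul 2
  refine exists_isDensity_memW11Real mg.1.aemeasurable (hρ.1.integrable le_rfl)
    (hs.1.integrable le_rfl) i₂ (fun η B hη hB hB' => ?_) (fun η B hη hB hB' => ?_)
  · rw [hρ₁]
    exact S.integral_deriv_comp_mul hmean hcov hη hB hB' hg hinv hρ hψ hR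
  · exact S.integral_deriv_comp_mul hmean hcov hη hB hB' hg hinv hs hψ₁ hR₁

end CovEigenbasis

end GaussSobolev

theorem propositionA2 {H : Type*} [NormedAddCommGroup H] [InnerProductSpace ℝ H] [CompleteSpace H]
    [SecondCountableTopology H] [MeasurableSpace H] [BorelSpace H] {ι : Type*}
    -- the symmetric strictly positive trace class operator `Q`, with its eigenbasis
    (Q : H →L[ℝ] H) (S : GaussSobolev.CovEigenbasis ι Q)
    -- `μ` is the Gaussian measure with mean `0` and covariance `Q`
    (μ : Measure H) [IsGaussian μ] (hmean : ∫ x, x ∂μ = 0)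
    (hcov : ∀ x y : H, covarianceBilin μ x y = ⟪Q x, y⟫)
    -- `g ∈ D(L₀)` and `|Q^{1/2}Dg|⁻¹ ∈ L⁴(H, μ)`
    (g : H → ℝ) (hg : S.MemDomL0 μ g)
    (hinv : ∫⁻ x, (‖S.grad12 μ g x‖ₑ⁻¹) ^ 4 ∂μ < ⊤) :
    (S.MemW12 μ (S.psi μ g) →
      ∃ k : ℝ → ℝ, GaussSobolev.IsDensity (fun I => (μ.map g).real I) k ∧
        GaussSobolev.MemW11Real k) ∧
    (∀ ρ : H → ℝ, S.MemW11 μ ρ → S.RhoCondition μ g ρ →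
      S.MemW11 μ (S.rhoOne μ g ρ) → S.RhoCondition μ g (S.rhoOne μ g ρ) →
      ∃ k : ℝ → ℝ, GaussSobolev.IsDensity (fun I => ∫ x in g ⁻¹' I, ρ x ∂μ) k ∧
        GaussSobolev.MemW11Real k) := by
  constructor
  · intro hψ
    obtain ⟨⟨mg, mG, -⟩, -⟩ := S.exists_approx_sequence hmean hcov hg
      (S.memW12_of_lintegral_inv_lt_top hinv)
    have hspec := hψ.choose_spec
    have mψ : MemLp (S.psi μ g) 2 μ := hspec.1
    have mF : MemLp hψ.choose 2 μ := hspec.2.1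
    have hw : MemLp (fun x => ‖S.grad12 μ g x‖⁻¹) 2 μ := by
      refine (memLp_two_iff_integrable_sq mG.1.norm.aemeasurable.inv.aestronglyMeasurable).2 ?_
      exact (S.memLp_inv_norm_grad12_sq mG.1 hinv).integrable one_le_two
    -- With `ρ = 1` and `R = 0` the divergence is `ρ₁ = 2ψ`. The two integrability conditions on
    -- `ρ₁` hold as products of functions in `L²`: `ψ` with itself, and the gradient of `ψ` with
    -- `|Q^{1/2}Dg|⁻¹`.
    have h := S.exists_isDensity_memW11Real_of_isSobolevGrad hmean hcov hg hinv
      S.isSobolevGrad_one (by simpa using mψ.integrable one_le_two) (by simp)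
      (ρ₁ := fun x => 2 * S.psi μ g x) (by simp) (hspec.const_mul_of_expFunctions 2)
      (by
        have := (mψ.integrable_mul mψ).const_mul 2
        refine this.congr (ae_of_all _ fun x => ?_)
        simp only [Pi.mul_apply]
        ring)
      (by
        have := (mF.norm.integrable_mul hw).const_mul 2
        refine this.congr (ae_of_all _ fun x => ?_)
        simp only [Pi.mul_apply, norm_smul, Real.norm_ofNat]
        ring)
    obtain ⟨k, ⟨ik, hk⟩, hk'⟩ := h
    refine ⟨k, ⟨ik, fun I hI => ?_⟩, hk'⟩
    rw [← hk I hI]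
    simp [Measure.real, Measure.map_apply_of_aemeasurable mg.1.aemeasurable hI]
  · intro ρ hρ hc hρ₁ hc₁
    exact S.exists_isDensity_memW11Real_of_isSobolevGrad hmean hcov hg hinv
      (S.isSobolevGrad_grad11 hρ) hc.1 hc.2 rfl (S.isSobolevGrad_grad11 hρ₁) hc₁.1 hc₁.2
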